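/- Let $\alpha>2$, $\theta>0$, $\lambda>0$. Base stations form a homogeneous Poisson point process $\{x_i\}$ of density $\lambda$ in $\mathbb{R}^2$; their power fading gains $g_i$ are i.i.d. and independent of $\{x_i\}$. For a user at the origin, the signal-to-interference ratio when served by the $i$-th base station is $$\mathrm{SIR}_i=\frac{g_i\|x_i\|^{-\alpha}}{\sum_{j\neq i} g_j\|x_j\|^{-\alpha}}.$$ The coverage probability for closest association, $\mathrm{P}^{(\mathrm C)}$, is $\Pr[\mathrm{SIR}_i>\theta]$ with $x_i$ the base station closest to the origin; for strongest association, $\mathrm{P}^{(\mathrm S)}$, it is $\Pr[\mathrm{SIR}_i>\theta]$ with $x_i$ the base station of highest SIR. Write $\mathrm{P}_{\mathrm{cov}}^{\mathrm{LOS},(\mathrm C)}(\theta,m)$ for $\mathrm{P}^{(\mathrm C)}$ when the gains have the Gamma distribution $\Gamma(m,\tfrac1m)$ of shape $m$ and scale $\tfrac1m$ (LOS Nakagami-$m$ fading, $m\ge 1$ an integer), and $\mathrm{P}_{\mathrm{cov}}^{\mathrm{NLOS},(\mathrm C)}(\theta)$, $\mathrm{P}_{\mathrm{cov}}^{\mathrm{NLOS},(\mathrm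 S)}(\theta)$ for $\mathrm{P}^{(\mathrm C)}$, $\mathrm{P}^{(\mathrm S)}$ when the gains are exponential of mean $1$ (Rayleigh fading). Then: (a) $\mathrm{P}_{\mathrm{cov}}^{\mathrm{LOS},(\mathrm C)}(\theta,m+1)>\mathrm{P}_{\mathrm{cov}}^{\mathrm{LOS},(\mathrm C)}(\theta,m)$ for all integers $m\ge1$; moreover $\mathrm{P}_{\mathrm{cov}}^{\mathrm{LOS},(\mathrm C)}(\theta,1)=\mathrm{P}_{\mathrm{cov}}^{\mathrm{NLOS},(\mathrm C)}(\theta)$ and $\mathrm{P}_{\mathrm{cov}}^{\mathrm{LOS},(\mathrm C)}(\theta,m)>\mathrm{P}_{\mathrm{cov}}^{\mathrm{NLOS},(\mathrm C)}(\theta)$ for all integers $m\ge2$. (b) $\lim_{m\to\infty}\mathrm{P}_{\mathrm{cov}}^{\mathrm{LOS},(\mathrm C)}(\theta,m)=\mathrm{P}_{\mathrm{cov}}^{\mathrm{NLOS},(\mathrm S)}(\theta)$, and if $\theta\ge1$ this limit has the closed form $$\mathrm{P}_{\mathrm{cov}}^{\mathrm{NLOS},(\mathrm S)}(\theta)=\frac{1}{2\,\zeta(1)\,\theta^{2/\alpha}},\qquad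 \zeta(m)=-\frac{\Gamma(m+\tfrac2\alpha)\,\Gamma(-\tfrac2\alpha)}{\alpha\,\Gamma(m)}.$$ -/

import Mathlib

open MeasureTheory ProbabilityTheory Filter Topology
open scoped ENNReal NNReal

noncomputable section

namespace CellularNetwork

/-- The Euclidean plane, in which the base stations are located; the typical user is at the
origin. -/
abbrev Plane : Type := EuclideanSpace ℝ (Fin 2)

/-- The number of points of the (enumerated) point process `X` that lie in `A`. -/
def count {Ω : Type*} (X : ℕ → Ω → Plane) (A : Set Plane) (ω : Ω) : ℕ∞ :=
  {i : ℕ | X i ω ∈ A}.encard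

/-- `X 0, X 1, …` is a (measurable) enumeration of the points of a homogeneous Poisson point
process of density `lam` on the plane: the number of points in a bounded Borel set `A` is Poisson
distributed with mean `lam * area A`, and the numbers of points in finitely many pairwise disjoint
bounded Borel sets are independent. -/
structure IsHomogeneousPPP {Ω : Type*} [MeasurableSpace Ω] (P : Measure Ω)
    (X : ℕ → Ω → Plane) (lam : ℝ≥0) : Prop where
  measurable_point : ∀ i, Measurable (X i)
  count_law : ∀ A : Set Plane, MeasurableSet A → Bornology.IsBounded A → ∀ k : ℕ,
    P {ω | count X A ω = k} = poissonMeasure (lam * (volume A).toNNReal) {k}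
  count_indep : ∀ (n : ℕ) (A : Fin n → Set Plane), (∀ j, MeasurableSet (A j)) →
    (∀ j, Bornology.IsBounded (A j)) → Pairwise (Function.onFun Disjoint A) →
    iIndepFun (fun j => count X (A j)) P

/-- A marked Poisson point process `{(X i, g i)}`: the points form a homogeneous Poisson point
process of density `lam`, and the marks `g i` (the channel power fading gains) are independent of
each other and of the points, with common law `F`. -/
structure IsNetwork {Ω : Type*} [MeasurableSpace Ω] (P : Measure Ω)
    (X : ℕ → Ω → Plane) (g : ℕ → Ω → ℝ) (lam : ℝ≥0) (F : Measure ℝ) : Prop where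
  isPPP : IsHomogeneousPPP P X lam
  measurable_mark : ∀ i, Measurable (g i)
  mark_law : ∀ i, P.map (g i) = F
  mark_iIndep : iIndepFun g P
  mark_indep_points : IndepFun (fun ω i => X i ω) (fun ω i => g i ω) P

/-- Law of the power gain under LOS (Nakagami-`m`) fading: the Gamma distribution with shape `m`
and scale `1 / m`, that is, with rate `m`. -/
def losFading (m : ℕ) : Measure ℝ := gammaMeasure m m

/-- Law of the power gain under NLOS (Rayleigh) fading: the exponential distribution of mean 1. -/
def nlosFading : Measure ℝ := expMeasure 1

/-- The power `g i * r ^ (-α)` received at the origin from the `i`-th base station, where `r` is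
its distance from the origin. -/
def rxPower {Ω : Type*} (α : ℝ) (X : ℕ → Ω → Plane) (g : ℕ → Ω → ℝ) (i : ℕ) (ω : Ω) : ℝ≥0∞ :=
  ENNReal.ofReal (g i ω) * ENNReal.ofReal ‖X i ω‖ ^ (-α)

/-- The aggregate interference when the user is served by the `i`-th base station. -/
def interference {Ω : Type*} (α : ℝ) (X : ℕ → Ω → Plane) (g : ℕ → Ω → ℝ) (i : ℕ) (ω : Ω) :
    ℝ≥0∞ :=
  ∑' j : {j : ℕ // j ≠ i}, rxPower α X g j ω

/-- The signal-to-interference ratio when the user is served by the `i`-th base station. -/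
def sir {Ω : Type*} (α : ℝ) (X : ℕ → Ω → Plane) (g : ℕ → Ω → ℝ) (i : ℕ) (ω : Ω) : ℝ≥0∞ :=
  rxPower α X g i ω / interference α X g i ω

/-- Coverage probability for closest association: the probability that the SIR from the closest
base station exceeds `θ`. -/
def coverageClosest {Ω : Type*} [MeasurableSpace Ω] (P : Measure Ω) (X : ℕ → Ω → Plane)
    (g : ℕ → Ω → ℝ) (α θ : ℝ) : ℝ :=
  P.real {ω | ∃ i, (∀ j, ‖X i ω‖ ≤ ‖X j ω‖) ∧ ENNReal.ofReal θ < sir α X g i ω}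

/-- Coverage probability for strongest association: the probability that the SIR from the base
station of highest SIR exceeds `θ`. -/
def coverageStrongest {Ω : Type*} [MeasurableSpace Ω] (P : Measure Ω) (X : ℕ → Ω → Plane)
    (g : ℕ → Ω → ℝ) (α θ : ℝ) : ℝ :=
  P.real {ω | ∃ i, (∀ j, sir α X g j ω ≤ sir α X g i ω) ∧ ENNReal.ofReal θ < sir α X g i ω}

/-- `ζ(m) = -Γ(m + 2/α) Γ(-2/α) / (α Γ(m))`. -/
def zetaCoeff (α m : ℝ) : ℝ :=
  -(Real.Gamma (m + 2 / α) * Real.Gamma (-(2 / α))) / (α * Real.Gamma m)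

end CellularNetwork

end

/-!
Everything is compared on a single marked Poisson process. Move every point of a process with
`Γ(a, 1/a)` gains radially, and change its gain `y` to `χ y`, in such a way that its received power
changes only by a common constant factor. If `χ` is the increasing map between the two Gamma laws
tilted by `y ^ (2 / α)`, the result is a Poisson process of the same density with `Γ(b, 1/b)` gains.
The indices with SIR above `θ` stay the same, but the order of the points by distance, which is the
order by (inverse power) `*` (gain), becomes the order by (inverse power) `* χ` (gain).

The Gamma laws are ordered in the star order: `χ y / y` is strictly decreasing if `a < b`. Hence a
point which is closer and received with more power than another stays closer, and coverage by the
closest point persists under the move. Conversely, a strong point together with a much weaker one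
that is barely closer, all others being negligible, is covered only after the move; such
configurations have positive probability, so the coverage probability increases strictly with the
shape. As `b → ∞` the gains concentrate at `1`, `χ → 1`, and the order by distance becomes the order
by power, in which the covering points come first: the limit is the probability that some point
covers.

For `θ ≥ 1` at most one point covers, so this probability is the mean number of covering points. By
the Mecke formula and Rayleigh fading it is an integral of the Laplace transform of the total power.
-/

noncomputable section

namespace CellularNetwork

/-! ### Exponentials of extended nonnegative reals -/

/-- The exponential `e^{-x}` of an extended nonnegative real, with `e^{-∞} = 0`. Laplace transforms
are written with it so that they make sense for sums of arbitrary nonnegative series. -/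
def expNeg (x : ℝ≥0∞) : ℝ≥0∞ := EReal.exp (-(x : EReal))

@[simp] lemma expNeg_zero : expNeg 0 = 1 := by simp [expNeg]

@[simp] lemma expNeg_top : expNeg ⊤ = 0 := by simp [expNeg]

lemma expNeg_ofReal {x : ℝ} (hx : 0 ≤ x) :
    expNeg (ENNReal.ofReal x) = ENNReal.ofReal (Real.exp (-x)) := by
  rw [expNeg, EReal.coe_ennreal_ofReal, max_eq_left hx, ← EReal.coe_neg, EReal.exp_coe]

lemma expNeg_coe (x : ℝ≥0) : expNeg x = ENNReal.ofReal (Real.exp (-x)) := by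
  rw [← ENNReal.ofReal_coe_nnreal, expNeg_ofReal x.coe_nonneg]

lemma expNeg_strictAnti : StrictAnti expNeg := fun x y h => by
  rw [expNeg, expNeg, EReal.exp_lt_exp_iff, EReal.neg_lt_neg_iff]
  exact_mod_cast h

lemma expNeg_le_one (x : ℝ≥0∞) : expNeg x ≤ 1 :=
  expNeg_zero ▸ expNeg_strictAnti.antitone (zero_le (a := x))

lemma expNeg_ne_top (x : ℝ≥0∞) : expNeg x ≠ ⊤ := ((expNeg_le_one x).trans_lt ENNReal.one_lt_top).ne

lemma continuous_expNeg : Continuous expNeg :=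
  ENNReal.continuous_exp.comp (continuous_neg.comp continuous_coe_ennreal_ereal)

@[fun_prop] lemma measurable_expNeg : Measurable expNeg := continuous_expNeg.measurable

lemma expNeg_add (x y : ℝ≥0∞) : expNeg (x + y) = expNeg x * expNeg y := by
  induction x with
  | top => simp
  | coe x =>
    induction y with
    | top => simp
    | coe y =>
      rw [← ENNReal.coe_add, expNeg_coe, expNeg_coe, expNeg_coe,
        ← ENNReal.ofReal_mul (by positivity), ← Real.exp_add, NNReal.coe_add, neg_add]

lemma expNeg_sum {ι : Type*} (s : Finset ι) (f : ι → ℝ≥0∞) :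
    expNeg (∑ i ∈ s, f i) = ∏ i ∈ s, expNeg (f i) := by
  classical
  induction s using Finset.induction_on with
  | empty => simp
  | insert a s ha ih => rw [Finset.sum_insert ha, Finset.prod_insert ha, expNeg_add, ih]

lemma expNeg_nsmul (n : ℕ) (x : ℝ≥0∞) : expNeg (n • x) = expNeg x ^ n := by
  simpa using expNeg_sum (Finset.range n) fun _ => x

lemma one_sub_expNeg_le (x : ℝ≥0∞) : 1 - expNeg x ≤ x := by
  induction x with
  | top => simp
  | coe x =>
    rw [expNeg_coe, ← ENNReal.ofReal_one, ← ENNReal.ofReal_sub _ (Real.exp_pos _).le,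
      ← ENNReal.ofReal_coe_nnreal]
    exact ENNReal.ofReal_le_ofReal (by linarith [Real.add_one_le_exp (-(x : ℝ))])

lemma one_sub_expNeg_mono : Monotone fun x => 1 - expNeg x := fun _ _ h =>
  tsub_le_tsub_left (expNeg_strictAnti.antitone h) 1

lemma continuous_one_sub_expNeg : Continuous fun x => 1 - expNeg x :=
  (ENNReal.continuous_sub_left ENNReal.one_ne_top).comp continuous_expNeg

/-- The inverse of `expNeg` on `[0, 1]`. -/
def negLog (y : ℝ≥0∞) : ℝ≥0∞ := (-(ENNReal.log y)).toENNReal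

lemma expNeg_negLog {y : ℝ≥0∞} (hy : y ≤ 1) : expNeg (negLog y) = y := by
  have h : 0 ≤ -(ENNReal.log y) := by
    rw [EReal.le_neg]
    simpa using hy
  rw [expNeg, negLog, EReal.coe_toENNReal h, neg_neg, ENNReal.exp_log]

@[fun_prop] lemma measurable_negLog : Measurable negLog := by
  unfold negLog
  fun_prop

lemma lintegral_expNeg_ne_top {Ω : Type*} [MeasurableSpace Ω] (P : Measure Ω) [IsFiniteMeasure P]
    (F : Ω → ℝ≥0∞) : ∫⁻ ω, expNeg (F ω) ∂P ≠ ⊤ :=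
  ((lintegral_mono fun ω => expNeg_le_one (F ω)).trans_lt (by simp [measure_lt_top])).ne

lemma tendsto_lintegral_expNeg {Ω : Type*} [MeasurableSpace Ω] (P : Measure Ω) [IsFiniteMeasure P]
    {F : ℕ → Ω → ℝ≥0∞} {G : Ω → ℝ≥0∞} (hF : ∀ n, Measurable (F n))
    (h : ∀ᵐ ω ∂P, Tendsto (fun n => F n ω) atTop (𝓝 (G ω))) :
    Tendsto (fun n => ∫⁻ ω, expNeg (F n ω) ∂P) atTop (𝓝 (∫⁻ ω, expNeg (G ω) ∂P)) := by
  refine tendsto_lintegral_of_dominated_convergence (fun _ => 1)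
    (fun n => measurable_expNeg.comp (hF n)) (fun n => ae_of_all _ fun ω => expNeg_le_one _)
    (by simp) ?_
  filter_upwards [h] with ω hω
  exact (continuous_expNeg.tendsto _).comp hω

lemma tendsto_lintegral_one_sub_expNeg {E : Type*} [MeasurableSpace E] (Λ : Measure E)
    {f : ℕ → E → ℝ≥0∞} {g : E → ℝ≥0∞} (hf : ∀ n, Measurable (f n)) (hmono : Monotone f)
    (h : ∀ z, Tendsto (fun n => f n z) atTop (𝓝 (g z))) :
    Tendsto (fun n => ∫⁻ z, (1 - expNeg (f n z)) ∂Λ) atTop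
      (𝓝 (∫⁻ z, (1 - expNeg (g z)) ∂Λ)) :=
  lintegral_tendsto_of_tendsto_of_monotone
    (fun n => (continuous_one_sub_expNeg.measurable.comp (hf n)).aemeasurable)
    (ae_of_all _ fun z _ _ hmn => one_sub_expNeg_mono (hmono hmn z))
    (ae_of_all _ fun z => (continuous_one_sub_expNeg.tendsto _).comp (h z))

lemma tendsto_tsum_of_monotone {ι : Type*} {u : ℕ → ι → ℝ≥0∞} {v : ι → ℝ≥0∞}
    (hu : Monotone u) (h : ∀ i, Tendsto (fun n => u n i) atTop (𝓝 (v i))) :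
    Tendsto (fun n => ∑' i, u n i) atTop (𝓝 (∑' i, v i)) := by
  let _ : MeasurableSpace ι := ⊤
  simp_rw [← lintegral_count]
  exact lintegral_tendsto_of_tendsto_of_monotone (fun n => measurable_from_top.aemeasurable)
    (ae_of_all _ fun i m n hmn => hu hmn i) (ae_of_all _ h)

lemma map_sum_indicator_of_pairwise_disjoint {ι E M N : Type*} [Fintype ι] [AddCommMonoid M]
    [AddCommMonoid N] {A : ι → Set E} (hA : Pairwise (Function.onFun Disjoint A)) (c : ι → M)
    {φ : M → N} (hφ : φ 0 = 0) (z : E) :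
    φ (∑ j, (A j).indicator (fun _ => c j) z) = ∑ j, (A j).indicator (fun _ => φ (c j)) z := by
  by_cases hz : ∃ j, z ∈ A j
  · obtain ⟨j, hj⟩ := hz
    have hoff : ∀ i, i ≠ j → z ∉ A i := fun i hij hi => Set.disjoint_left.1 (hA hij) hi hj
    rw [Finset.sum_eq_single_of_mem j (Finset.mem_univ j)
        fun i _ hij => Set.indicator_of_notMem (hoff i hij) _,
      Finset.sum_eq_single_of_mem j (Finset.mem_univ j)
        fun i _ hij => Set.indicator_of_notMem (hoff i hij) _,
      Set.indicator_of_mem hj, Set.indicator_of_mem hj]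
  · push Not at hz
    simp [Set.indicator_of_notMem (hz _), hφ]

lemma simpleFunc_eq_sum_indicator {E M : Type*} [MeasurableSpace E] [AddCommMonoid M]
    (f : SimpleFunc E M) (z : E) :
    f z = ∑ j, (f ⁻¹' {(f.range.equivFin.symm j : M)}).indicator
      (fun _ => (f.range.equivFin.symm j : M)) z := by
  classical
  rw [f.range.equivFin.symm.sum_comp (fun y => (f ⁻¹' {(y : M)}).indicator (fun _ => (y : M)) z)]
  simp only [Set.indicator_apply, Set.mem_preimage, Set.mem_singleton_iff]
  rw [Finset.sum_eq_single_of_mem ⟨f z, f.mem_range_self z⟩ (Finset.mem_univ _)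
    fun y _ hy => if_neg fun h => hy (Subtype.ext h.symm), if_pos rfl]

/-! ### Poisson processes through their Laplace functionals -/

section LaplaceFunctional

variable {Ω : Type*} [MeasurableSpace Ω] {P : Measure Ω}

/-- The sequence `Z 0, Z 1, …` enumerates a Poisson process of intensity `Λ` on `E`. The definition
is by the Laplace functional rather than by counts, since mapping, marking and restriction are then
substitutions of the test function. -/
structure IsPoisson {E : Type*} [MeasurableSpace E] (P : Measure Ω) (Z : ℕ → Ω → E)
    (Λ : Measure E) : Prop where
  measurable : ∀ i, Measurable (Z i)
  laplace : ∀ f : E → ℝ≥0∞, Measurable f →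
    ∫⁻ ω, expNeg (∑' i, f (Z i ω)) ∂P = expNeg (∫⁻ z, (1 - expNeg (f z)) ∂Λ)

/-- The number of points of the configuration `z` in `A`, as an extended nonnegative real. -/
def num {E : Type*} (A : Set E) (z : ℕ → E) : ℝ≥0∞ := ∑' i, A.indicator (fun _ => 1) (z i)

lemma num_eq_encard {E : Type*} (A : Set E) (z : ℕ → E) :
    num A z = (({i | z i ∈ A}.encard : ℕ∞) : ℝ≥0∞) := by
  rw [← ENNReal.tsum_set_one, tsum_subtype {i | z i ∈ A} (fun _ => (1 : ℝ≥0∞))]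
  rfl

lemma count_toENNReal {Ω : Type*} (X : ℕ → Ω → Plane) (A : Set Plane) (ω : Ω) :
    ((count X A ω : ℕ∞) : ℝ≥0∞) = num A fun i => X i ω :=
  (num_eq_encard A fun i => X i ω).symm

lemma measurable_count {X : ℕ → Ω → Plane} (hX : ∀ i, Measurable (X i)) {A : Set Plane}
    (hA : MeasurableSet A) : Measurable (count X A) := by
  refine measurable_to_countable' fun k => ?_
  have h : count X A ⁻¹' {k} =
      (fun ω => num A fun i => X i ω) ⁻¹' {(k : ℝ≥0∞)} := by
    ext ω
    simp only [Set.mem_preimage, Set.mem_singleton_iff, ← count_toENNReal]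
    exact ENat.toENNReal_inj.symm
  rw [h]
  exact (Measurable.tsum fun i => (measurable_const.indicator hA).comp (hX i))
    (measurableSet_singleton _)

lemma lintegral_expNeg_mul_poissonMeasure (r : ℝ≥0) (c : ℝ≥0∞) :
    ∫⁻ k : ℕ, expNeg (c * k) ∂(poissonMeasure r) = expNeg (r * (1 - expNeg c)) := by
  lift expNeg c to ℝ≥0 using expNeg_ne_top c with x hx
  have hx1 : x ≤ 1 := by exact_mod_cast hx ▸ expNeg_le_one c
  have hterm : ∀ k : ℕ, ∫⁻ n : ℕ, expNeg (c * n) ∂(ENNReal.ofReal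
      (Real.exp (-r) * r ^ k / k.factorial) • Measure.dirac k) =
      ENNReal.ofReal (Real.exp (-r) * ((r * x : ℝ) ^ k / k.factorial)) := fun k => by
    rw [lintegral_smul_measure, lintegral_dirac, mul_comm c, ← nsmul_eq_mul, expNeg_nsmul, ← hx,
      ← ENNReal.coe_pow, ← ENNReal.ofReal_coe_nnreal, smul_eq_mul,
      ← ENNReal.ofReal_mul (by positivity)]
    congr 1
    push_cast
    ring
  have hexp := (NormedSpace.expSeries_div_hasSum_exp (r * x : ℝ)).mul_left (Real.exp (-r))
  rw [poissonMeasure, lintegral_sum_measure]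
  simp_rw [hterm]
  rw [← ENNReal.ofReal_tsum_of_nonneg (fun k => by positivity) hexp.summable, hexp.tsum_eq,
    ← ENNReal.coe_one, ← ENNReal.coe_sub, ← ENNReal.coe_mul, expNeg_coe, ← Real.exp_eq_exp_ℝ,
    ← Real.exp_add]
  congr 2
  push_cast [hx1]
  ring

namespace IsHomogeneousPPP

variable [IsProbabilityMeasure P] {X : ℕ → Ω → Plane} {lam : ℝ≥0} {A : Set Plane}

-- The law of the count is given on finite values only, but these already carry mass `1`.
lemma map_count (h : IsHomogeneousPPP P X lam) (hA : MeasurableSet A)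
    (hb : Bornology.IsBounded A) :
    P.map (count X A) =
      (poissonMeasure (lam * (volume A).toNNReal)).map (Nat.cast : ℕ → ℕ∞) := by
  have hm := measurable_count h.measurable_point hA
  have := Measure.isProbabilityMeasure_map (μ := P) hm.aemeasurable
  symm
  refine Measure.eq_of_le_of_isProbabilityMeasure (Measure.le_iff.2 fun s hs => ?_)
  rw [Measure.map_apply measurable_from_nat hs, ← Measure.tsum_indicator_apply_singleton _ _
    (measurable_from_nat hs), ← Measure.tsum_indicator_apply_singleton _ _ hs,
    ← tsum_subtype, ← tsum_subtype]
  have hinj : Function.Injective (fun k : ((Nat.cast : ℕ → ℕ∞) ⁻¹' s) => (⟨(k : ℕ), k.2⟩ : s)) := by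
    rintro ⟨a, ha⟩ ⟨b, hb⟩ hab
    simpa using hab
  refine le_trans (le_of_eq ?_) (ENNReal.tsum_comp_le_tsum_of_injective hinj _)
  refine tsum_congr fun k => ?_
  rw [Measure.map_apply hm (measurableSet_singleton _), ← h.count_law A hA hb k]
  rfl

lemma lintegral_expNeg_mul_count (h : IsHomogeneousPPP P X lam) (hA : MeasurableSet A)
    (hb : Bornology.IsBounded A) (c : ℝ≥0∞) :
    ∫⁻ ω, expNeg (c * (count X A ω : ℕ∞)) ∂P = expNeg ((lam • volume) A * (1 - expNeg c)) := by
  rw [← lintegral_map (f := fun n : ℕ∞ => expNeg (c * n)) (measurable_of_countable _)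
      (measurable_count h.measurable_point hA), h.map_count hA hb,
    lintegral_map (measurable_of_countable _) measurable_from_nat]
  simp only [ENat.toENNReal_coe]
  rw [lintegral_expNeg_mul_poissonMeasure, ENNReal.coe_mul,
    ENNReal.coe_toNNReal hb.measure_lt_top.ne]
  rfl

lemma laplace_sum_indicator (h : IsHomogeneousPPP P X lam) {n : ℕ} {A : Fin n → Set Plane}
    (hA : ∀ j, MeasurableSet (A j)) (hb : ∀ j, Bornology.IsBounded (A j))
    (hd : Pairwise (Function.onFun Disjoint A)) (c : Fin n → ℝ≥0∞) :
    ∫⁻ ω, expNeg (∑' i, ∑ j, (A j).indicator (fun _ => c j) (X i ω)) ∂P =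
      expNeg (∫⁻ z, (1 - expNeg (∑ j, (A j).indicator (fun _ => c j) z)) ∂(lam • volume)) := by
  have hcount : ∀ ω, expNeg (∑' i, ∑ j, (A j).indicator (fun _ => c j) (X i ω)) =
      ∏ j, expNeg (c j * (count X (A j) ω : ℕ∞)) := fun ω => by
    rw [← expNeg_sum, Summable.tsum_finsetSum fun _ _ => ENNReal.summable]
    simp_rw [count_toENNReal, num, ← ENNReal.tsum_mul_left, ← Set.indicator_const_mul, mul_one]
  have hexpo : ∀ z, 1 - expNeg (∑ j, (A j).indicator (fun _ => c j) z) =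
      ∑ j, (A j).indicator (fun _ => 1 - expNeg (c j)) z :=
    map_sum_indicator_of_pairwise_disjoint hd c (φ := fun x => 1 - expNeg x) (by simp)
  simp_rw [hcount, hexpo]
  rw [lintegral_prod_eq_prod_lintegral_of_indepFun _
      (fun j ω => expNeg (c j * (count X (A j) ω : ℕ∞)))
      ((h.count_indep n A hA hb hd).comp (fun j (k : ℕ∞) => expNeg (c j * k))
        fun j => measurable_of_countable _)
      fun j => (measurable_of_countable fun k : ℕ∞ => expNeg (c j * k)).comp
        (measurable_count h.measurable_point (hA j)),
    lintegral_finsetSum _ fun j _ => measurable_const.indicator (hA j), expNeg_sum]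
  refine Finset.prod_congr rfl fun j _ => ?_
  rw [h.lintegral_expNeg_mul_count (hA j) (hb j), lintegral_indicator_const (hA j), mul_comm]

lemma laplace_indicator_simpleFunc (h : IsHomogeneousPPP P X lam) (f : SimpleFunc Plane ℝ≥0∞)
    {B : Set Plane} (hB : MeasurableSet B) (hb : Bornology.IsBounded B) :
    ∫⁻ ω, expNeg (∑' i, B.indicator f (X i ω)) ∂P =
      expNeg (∫⁻ z, (1 - expNeg (B.indicator f z)) ∂(lam • volume)) := by
  let v : Fin f.range.card → ℝ≥0∞ := fun j => f.range.equivFin.symm j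
  have hv : Function.Injective v := Subtype.val_injective.comp f.range.equivFin.symm.injective
  have hf : B.indicator f = fun z => ∑ j, (f ⁻¹' {v j} ∩ B).indicator (fun _ => v j) z := by
    ext z
    by_cases hz : z ∈ B
    · rw [Set.indicator_of_mem hz, simpleFunc_eq_sum_indicator f z]
      refine Finset.sum_congr rfl fun j _ => ?_
      rw [Set.inter_comm, ← Set.indicator_indicator, Set.indicator_of_mem hz]
    · simp [hz]
  rw [hf]
  exact h.laplace_sum_indicator (fun j => (f.measurableSet_preimage _).inter hB)
    (fun j => hb.subset Set.inter_subset_right)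
    (fun i j hij => Set.disjoint_left.2 fun z hi hj => hij (hv (hi.1.symm.trans hj.1))) v

theorem isPoisson (h : IsHomogeneousPPP P X lam) : IsPoisson P X (lam • volume) where
  measurable := h.measurable_point
  laplace f hf := by
    let B : ℕ → Set Plane := fun n => Metric.closedBall 0 n
    let u : ℕ → Plane → ℝ≥0∞ := fun n => (B n).indicator (SimpleFunc.eapprox f n)
    have hBmono : Monotone B := fun m n hmn =>
      Metric.closedBall_subset_closedBall (by exact_mod_cast hmn)
    have hum : ∀ n, Measurable (u n) := fun n =>
      (SimpleFunc.measurable _).indicator Metric.isClosed_closedBall.measurableSet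
    have hmono : Monotone u := fun m n hmn z =>
      (Set.indicator_le_indicator_of_subset (hBmono hmn) (fun _ => zero_le) z).trans
        (Set.indicator_le_indicator (SimpleFunc.monotone_eapprox f hmn z))
    have hlim : ∀ z, Tendsto (fun n => u n z) atTop (𝓝 (f z)) := fun z => by
      refine (SimpleFunc.tendsto_eapprox hf z).congr' ?_
      obtain ⟨N, hN⟩ := exists_nat_ge ‖z‖
      filter_upwards [eventually_ge_atTop N] with n hn
      have hz : z ∈ B n := mem_closedBall_zero_iff.2 (hN.trans (by exact_mod_cast hn))
      exact (Set.indicator_of_mem hz _).symm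
    have hleft : Tendsto (fun n => ∫⁻ ω, expNeg (∑' i, u n (X i ω)) ∂P) atTop
        (𝓝 (∫⁻ ω, expNeg (∑' i, f (X i ω)) ∂P)) :=
      tendsto_lintegral_expNeg P
        (fun n => Measurable.tsum fun i => (hum n).comp (h.measurable_point i))
        (ae_of_all _ fun ω => tendsto_tsum_of_monotone (fun m n hmn i => hmono hmn _)
          fun i => hlim _)
    have hright := (continuous_expNeg.tendsto _).comp
      (tendsto_lintegral_one_sub_expNeg (lam • volume) hum hmono hlim)
    refine tendsto_nhds_unique hleft (hright.congr fun n => ?_)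
    exact (h.laplace_indicator_simpleFunc _ Metric.isClosed_closedBall.measurableSet
      Metric.isBounded_closedBall).symm

end IsHomogeneousPPP

lemma lintegral_uncurry_of_indepFun [IsFiniteMeasure P] {S T : Type*} [MeasurableSpace S]
    [MeasurableSpace T] {U : Ω → S} {V : Ω → T} (hU : Measurable U) (hV : Measurable V)
    (h : IndepFun U V P) {Φ : S × T → ℝ≥0∞} (hΦ : Measurable Φ) :
    ∫⁻ ω, Φ (U ω, V ω) ∂P = ∫⁻ ω, ∫⁻ ω', Φ (U ω, V ω') ∂P ∂P := by
  calc ∫⁻ ω, Φ (U ω, V ω) ∂P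
      = ∫⁻ q, Φ q ∂(P.map fun ω => (U ω, V ω)) := (lintegral_map hΦ (hU.prodMk hV)).symm
    _ = ∫⁻ ω, ∫⁻ ω', Φ (U ω, V ω') ∂P ∂P := by
        rw [(indepFun_iff_map_prod_eq_prod_map_map hU.aemeasurable hV.aemeasurable).1 h,
          lintegral_prod _ hΦ.aemeasurable, lintegral_map hΦ.lintegral_prod_right' hU]
        exact lintegral_congr fun ω => lintegral_map (hΦ.comp measurable_prodMk_left) hV

lemma lintegral_expNeg_tsum_of_iIndepFun [IsProbabilityMeasure P] {f : ℕ → Ω → ℝ≥0∞}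
    (hf : ∀ i, Measurable (f i)) (h : iIndepFun f P) :
    ∫⁻ ω, expNeg (∑' i, f i ω) ∂P =
      expNeg (∑' i, negLog (∫⁻ ω, expNeg (f i ω) ∂P)) := by
  refine tendsto_nhds_unique (tendsto_lintegral_expNeg P
    (fun n => Finset.measurable_sum (Finset.range n) fun i _ => hf i)
    (ae_of_all _ fun ω => ENNReal.summable.hasSum.tendsto_sum_nat)) ?_
  refine ((continuous_expNeg.tendsto _).comp
    ENNReal.summable.hasSum.tendsto_sum_nat).congr fun n => ?_
  simp_rw [Function.comp_apply, expNeg_sum]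
  rw [lintegral_prod_eq_prod_lintegral_of_indepFun _ (fun i ω => expNeg (f i ω))
    (h.comp (fun _ => expNeg) fun _ => measurable_expNeg) fun i => measurable_expNeg.comp (hf i)]
  exact Finset.prod_congr rfl fun i _ => expNeg_negLog
    ((lintegral_mono fun ω => expNeg_le_one _).trans (by simp))

theorem IsPoisson.marking [IsProbabilityMeasure P] {E T : Type*} [MeasurableSpace E]
    [MeasurableSpace T] {X : ℕ → Ω → E} {g : ℕ → Ω → T} {Λ : Measure E} {F : Measure T}
    [IsProbabilityMeasure F] (hX : IsPoisson P X Λ) (hg : ∀ i, Measurable (g i))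
    (hlaw : ∀ i, P.map (g i) = F) (hiid : iIndepFun g P)
    (hindep : IndepFun (fun ω i => X i ω) (fun ω i => g i ω) P) :
    IsPoisson P (fun i ω => (X i ω, g i ω)) (Λ.prod F) where
  measurable i := (hX.measurable i).prodMk (hg i)
  laplace f hf := by
    let H : E → ℝ≥0∞ := fun x => ∫⁻ y, expNeg (f (x, y)) ∂F
    have hef : Measurable fun q : E × T => expNeg (f q) := measurable_expNeg.comp hf
    have hH : Measurable H := hef.lintegral_prod_right'
    have hH1 : ∀ x, H x ≤ 1 := fun x => (lintegral_mono fun y => expNeg_le_one _).trans (by simp)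
    have hmarks : ∀ x : ℕ → E,
        ∫⁻ ω, expNeg (∑' i, f (x i, g i ω)) ∂P = expNeg (∑' i, negLog (H (x i))) := fun x => by
      rw [lintegral_expNeg_tsum_of_iIndepFun (f := fun i ω => f (x i, g i ω))
        (fun i => hf.comp (measurable_const.prodMk (hg i)))
        (hiid.comp (fun i y => f (x i, y)) fun i => hf.comp measurable_prodMk_left)]
      congr 1
      refine tsum_congr fun i => ?_
      rw [← lintegral_map (f := fun y => expNeg (f (x i, y)))
        (hef.comp measurable_prodMk_left) (hg i), hlaw]
    rw [lintegral_uncurry_of_indepFun (measurable_pi_lambda _ hX.measurable)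
      (measurable_pi_lambda _ hg) hindep
      (Φ := fun q : (ℕ → E) × (ℕ → T) => expNeg (∑' i, f (q.1 i, q.2 i)))
      (measurable_expNeg.comp (Measurable.tsum fun i => hf.comp
        (((measurable_pi_apply i).comp measurable_fst).prodMk
          ((measurable_pi_apply i).comp measurable_snd))))]
    simp_rw [hmarks]
    rw [hX.laplace (fun x => negLog (H x)) (measurable_negLog.comp hH), lintegral_prod
      (fun z => 1 - expNeg (f z)) (measurable_const.sub hef).aemeasurable]
    congr 1
    refine lintegral_congr fun x => ?_
    rw [expNeg_negLog (hH1 x), lintegral_sub (f := fun _ => 1) (g := fun y => expNeg (f (x, y)))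
      (hef.comp measurable_prodMk_left) (lintegral_expNeg_ne_top F _)
      (ae_of_all _ fun y => expNeg_le_one _)]
    simp [H]

lemma IsNetwork.isPoisson [IsProbabilityMeasure P] {X : ℕ → Ω → Plane} {g : ℕ → Ω → ℝ}
    {lam : ℝ≥0} {F : Measure ℝ} [IsProbabilityMeasure F] (h : IsNetwork P X g lam F) :
    IsPoisson P (fun i ω => (X i ω, g i ω)) ((lam • volume : Measure Plane).prod F) :=
  h.isPPP.isPoisson.marking h.measurable_mark h.mark_law h.mark_iIndep h.mark_indep_points

end LaplaceFunctional

/-! ### Uniqueness of Laplace transforms -/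

section LaplaceUniqueness

open scoped BoundedContinuousFunction

variable {ι : Type*}

/-- The linear form `∑ c_i y_i` on families of extended nonnegative numbers; integer coefficients
suffice to determine laws. -/
def linForm (c : ι →₀ ℕ) (y : ι → ℝ≥0∞) : ℝ≥0∞ := c.sum fun i n => n • y i

lemma linForm_add (c d : ι →₀ ℕ) (y : ι → ℝ≥0∞) :
    linForm (c + d) y = linForm c y + linForm d y := by
  classical
  exact Finsupp.sum_add_index' (fun _ => zero_nsmul _) fun _ _ _ => add_nsmul _ _ _

lemma linForm_eq_sum [Fintype ι] (c : ι →₀ ℕ) (y : ι → ℝ≥0∞) : linForm c y = ∑ j, c j • y j :=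
  Finsupp.sum_fintype _ _ fun _ => zero_nsmul _

lemma linForm_tsum {κ : Type*} (c : ι →₀ ℕ) (f : ι → κ → ℝ≥0∞) :
    linForm c (fun j => ∑' i, f j i) = ∑' i, linForm c fun j => f j i := by
  simp only [linForm, Finsupp.sum, nsmul_eq_mul]
  rw [Summable.tsum_finsetSum fun _ _ => ENNReal.summable]
  simp_rw [ENNReal.tsum_mul_left]

lemma continuous_linForm (c : ι →₀ ℕ) : Continuous (linForm c) := by
  unfold linForm Finsupp.sum
  simp only [nsmul_eq_mul]
  exact continuous_finsetSum _ fun i _ =>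
    (ENNReal.continuous_const_mul (ENNReal.natCast_ne_top _)).comp (continuous_apply i)

lemma measurable_linForm_apply {E : Type*} [MeasurableSpace E] (c : ι →₀ ℕ) {f : ι → E → ℝ≥0∞}
    (hf : ∀ j, Measurable (f j)) : Measurable fun z => linForm c fun j => f j z := by
  simp only [linForm, Finsupp.sum, nsmul_eq_mul]
  exact Finset.measurable_sum _ fun i _ => (hf i).const_mul _

lemma measurable_expNeg_linForm (c : ι →₀ ℕ) :
    Measurable fun y : ι → ℝ≥0∞ => expNeg (linForm c y) :=
  measurable_expNeg.comp (measurable_linForm_apply c measurable_pi_apply)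

/-- The bounded continuous function `y ↦ e^{-∑ c_i y_i}`. -/
def expForm (c : ι →₀ ℕ) : (ι → ℝ≥0∞) →ᵇ ℝ :=
  BoundedContinuousFunction.ofNormedAddCommGroup (fun y => (expNeg (linForm c y)).toReal)
    (ENNReal.continuousOn_toReal.comp_continuous (continuous_expNeg.comp (continuous_linForm c))
      fun _ => expNeg_ne_top _) 1 fun y => by
    rw [Real.norm_of_nonneg ENNReal.toReal_nonneg]
    exact ENNReal.toReal_mono ENNReal.one_ne_top (expNeg_le_one _)

lemma expForm_apply (c : ι →₀ ℕ) (y : ι → ℝ≥0∞) :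
    expForm c y = (expNeg (linForm c y)).toReal := rfl

lemma expForm_single_ne {y z : ι → ℝ≥0∞} {i : ι} (h : y i ≠ z i) :
    expForm (Finsupp.single i 1) y ≠ expForm (Finsupp.single i 1) z := by
  rw [expForm_apply, expForm_apply, Ne,
    ENNReal.toReal_eq_toReal_iff' (expNeg_ne_top _) (expNeg_ne_top _)]
  intro heq
  exact h (by simpa [linForm] using expNeg_strictAnti.injective heq)

lemma integral_expForm (μ : Measure (ι → ℝ≥0∞)) (c : ι →₀ ℕ) :
    ∫ y, expForm c y ∂μ = (∫⁻ y, expNeg (linForm c y) ∂μ).toReal :=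
  integral_toReal (measurable_expNeg_linForm c).aemeasurable
    (ae_of_all _ fun _ => (expNeg_ne_top _).lt_top)

/-- The multiplicative monoid of the functions `y ↦ e^{-∑ c_i y_i}`. -/
def expSubmonoid (ι : Type*) : Submonoid ((ι → ℝ≥0∞) →ᵇ ℝ) where
  carrier := Set.range expForm
  one_mem' := ⟨0, by ext y; simp [expForm_apply, linForm]⟩
  mul_mem' := by
    rintro _ _ ⟨c, rfl⟩ ⟨d, rfl⟩
    refine ⟨c + d, ?_⟩
    ext y
    simp [expForm_apply, linForm_add, expNeg_add]

lemma integral_eq_of_mem_span {S : Type*} [TopologicalSpace S] [MeasurableSpace S]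
    [OpensMeasurableSpace S] {μ ν : Measure S} [IsFiniteMeasure μ] [IsFiniteMeasure ν]
    {s : Set (S →ᵇ ℝ)} (h : ∀ f ∈ s, ∫ x, f x ∂μ = ∫ x, f x ∂ν) {f : S →ᵇ ℝ}
    (hf : f ∈ Submodule.span ℝ s) : ∫ x, f x ∂μ = ∫ x, f x ∂ν := by
  induction hf using Submodule.span_induction with
  | mem f hf => exact h f hf
  | zero => simp
  | add f g _ _ ihf ihg =>
    simp_rw [BoundedContinuousFunction.add_apply]
    rw [integral_add (f.integrable μ) (g.integrable μ),
      integral_add (f.integrable ν) (g.integrable ν), ihf, ihg]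
  | smul a f _ ihf =>
    simp_rw [BoundedContinuousFunction.smul_apply]
    rw [integral_smul, integral_smul, ihf]

-- Stone-Weierstrass: since `[0, ∞]^ι` is compact, the exponentials `e^{-∑ c_i y_i}` span a
-- point-separating algebra.
theorem measure_eq_of_laplace [Countable ι] {μ ν : Measure (ι → ℝ≥0∞)} [IsFiniteMeasure μ]
    [IsFiniteMeasure ν]
    (h : ∀ c : ι →₀ ℕ, ∫⁻ y, expNeg (linForm c y) ∂μ = ∫⁻ y, expNeg (linForm c y) ∂ν) :
    μ = ν := by
  let A : StarSubalgebra ℝ ((ι → ℝ≥0∞) →ᵇ ℝ) :=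
    { Algebra.adjoin ℝ (expSubmonoid ι : Set ((ι → ℝ≥0∞) →ᵇ ℝ)) with
      star_mem' := fun {f} hf => by
        have hstar : star f = f := by ext y; simp
        rwa [hstar] }
  refine ext_of_forall_mem_subalgebra_integral_eq_of_polish (𝕜 := ℝ) (A := A)
    (fun y z hyz => ?_) fun f hf => ?_
  · obtain ⟨i, hi⟩ := Function.ne_iff.1 hyz
    exact ⟨_, ⟨_, ⟨expForm (Finsupp.single i 1), Algebra.subset_adjoin ⟨_, rfl⟩, rfl⟩, rfl⟩,
      expForm_single_ne hi⟩
  · have hspan : f ∈ Submodule.span ℝ (expSubmonoid ι : Set ((ι → ℝ≥0∞) →ᵇ ℝ)) := by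
      have hadjoin : f ∈ Subalgebra.toSubmodule (Algebra.adjoin ℝ (expSubmonoid ι : Set _)) := hf
      rwa [Algebra.adjoin_eq_span, Submonoid.closure_eq] at hadjoin
    refine integral_eq_of_mem_span ?_ hspan
    rintro _ ⟨c, rfl⟩
    rw [integral_expForm, integral_expForm, h]

lemma measure_eq_of_laplace_nsmul {μ ν : Measure ℝ≥0∞} [IsFiniteMeasure μ] [IsFiniteMeasure ν]
    (h : ∀ n : ℕ, ∫⁻ x, expNeg (n • x) ∂μ = ∫⁻ x, expNeg (n • x) ∂ν) : μ = ν := by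
  let e := MeasurableEquiv.funUnique Unit ℝ≥0∞
  refine e.symm.map_measurableEquiv_injective (measure_eq_of_laplace fun c => ?_)
  rw [lintegral_map_equiv, lintegral_map_equiv]
  simpa [linForm_eq_sum, e] using h (c ())

end LaplaceUniqueness

/-! ### Linear functionals of a Poisson process -/

section LinearFunctionals

variable {Ω E : Type*} [MeasurableSpace Ω] [MeasurableSpace E] {P : Measure Ω}

lemma lintegral_expNeg_linForm_pi {ι : Type*} [Fintype ι] (c : ι →₀ ℕ) (μ : ι → Measure ℝ≥0∞)
    [∀ j, IsProbabilityMeasure (μ j)] :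
    ∫⁻ y, expNeg (linForm c y) ∂(Measure.pi μ) = ∏ j, ∫⁻ x, expNeg (c j • x) ∂(μ j) := by
  have hm : ∀ j, Measurable fun x : ℝ≥0∞ => expNeg (c j • x) := fun j => by
    simp only [nsmul_eq_mul]
    exact measurable_expNeg.comp (measurable_id.const_mul _)
  simp_rw [linForm_eq_sum, expNeg_sum]
  rw [lintegral_prod_eq_prod_lintegral_of_indepFun _ (fun j (y : ι → ℝ≥0∞) => expNeg (c j • y j))
    (iIndepFun_pi (μ := μ) fun j => (hm j).aemeasurable)
    fun j => (hm j).comp (measurable_pi_apply j)]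
  exact Finset.prod_congr rfl fun j _ => (measurePreserving_eval μ j).lintegral_comp (hm j)

lemma ae_eq_zero_of_lintegral_expNeg [IsProbabilityMeasure P] {F : Ω → ℝ≥0∞} (hF : Measurable F)
    (h : ∫⁻ ω, expNeg (F ω) ∂P = 1) : ∀ᵐ ω ∂P, F ω = 0 := by
  have hzero : ∫⁻ ω, (1 - expNeg (F ω)) ∂P = 0 := by
    rw [lintegral_sub (f := fun _ => 1) (g := fun ω => expNeg (F ω)) (measurable_expNeg.comp hF)
      (lintegral_expNeg_ne_top P _) (ae_of_all _ fun _ => expNeg_le_one _), h]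
    simp
  rw [lintegral_eq_zero_iff (continuous_one_sub_expNeg.measurable.fun_comp hF)] at hzero
  filter_upwards [hzero] with ω hω
  apply expNeg_strictAnti.injective
  rw [expNeg_zero]
  exact le_antisymm (expNeg_le_one _) (tsub_eq_zero_iff_le.1 hω)

lemma tendsto_lintegral_expNeg_mul [IsFiniteMeasure P] {a : ℕ → ℝ≥0∞} (ha : Tendsto a atTop (𝓝 0))
    (ha0 : ∀ n, a n ≠ 0) {F : Ω → ℝ≥0∞} (hF : Measurable F) :
    Tendsto (fun n => ∫⁻ ω, expNeg (a n * F ω) ∂P) atTop (𝓝 (P {ω | F ω ≠ ⊤})) := by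
  classical
  have hlim : ∀ ω, Tendsto (fun n => a n * F ω) atTop (𝓝 (if F ω = ⊤ then ⊤ else 0)) := fun ω => by
    by_cases hω : F ω = ⊤
    · simp [hω, ENNReal.mul_top (ha0 _)]
    · simpa [hω] using ENNReal.Tendsto.mul_const (b := F ω) ha (Or.inr hω)
  convert tendsto_lintegral_expNeg P (fun n => hF.const_mul (a n)) (ae_of_all _ hlim) using 2
  rw [← lintegral_indicator_one (s := {ω | F ω ≠ ⊤}) (hF (measurableSet_singleton ⊤).compl)]
  refine lintegral_congr fun ω => ?_
  by_cases hω : F ω = ⊤ <;> simp [hω]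

lemma tendsto_lintegral_one_sub_expNeg_mul {Λ : Measure E} {a : ℕ → ℝ≥0∞}
    (ha : Tendsto a atTop (𝓝 0)) (ha1 : ∀ n, a n ≤ 1) {f : E → ℝ≥0∞} (hf : Measurable f)
    (hfin : ∀ z, f z ≠ ⊤) (hint : ∫⁻ z, (1 - expNeg (f z)) ∂Λ ≠ ⊤) :
    Tendsto (fun n => ∫⁻ z, (1 - expNeg (a n * f z)) ∂Λ) atTop (𝓝 0) := by
  have hlim : ∀ z, Tendsto (fun n => 1 - expNeg (a n * f z)) atTop (𝓝 0) := fun z => by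
    simpa [Function.comp_def] using (continuous_one_sub_expNeg.tendsto (0 * f z)).comp
      (ENNReal.Tendsto.mul_const (b := f z) ha (Or.inr (hfin z)))
  simpa using tendsto_lintegral_of_dominated_convergence (μ := Λ) (f := fun _ => 0)
    (fun z => 1 - expNeg (f z))
    (fun n => continuous_one_sub_expNeg.measurable.comp (hf.const_mul (a n)))
    (fun n => ae_of_all _ fun z => one_sub_expNeg_mono (mul_le_of_le_one_left' (ha1 n))) hint
    (ae_of_all _ hlim)

namespace IsPoisson

variable {Z : ℕ → Ω → E} {Λ : Measure E}

lemma measurable_tsum (hZ : IsPoisson P Z Λ) {f : E → ℝ≥0∞} (hf : Measurable f) :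
    Measurable fun ω => ∑' i, f (Z i ω) :=
  Measurable.tsum fun i => hf.comp (hZ.measurable i)

lemma laplace_linForm (hZ : IsPoisson P Z Λ) {ι : Type*} (c : ι →₀ ℕ)
    {f : ι → E → ℝ≥0∞} (hf : ∀ j, Measurable (f j)) :
    ∫⁻ ω, expNeg (linForm c fun j => ∑' i, f j (Z i ω)) ∂P =
      expNeg (∫⁻ z, (1 - expNeg (linForm c fun j => f j z)) ∂Λ) := by
  simp_rw [linForm_tsum]
  exact hZ.laplace _ (measurable_linForm_apply c hf)

theorem map_tsum_eq [IsFiniteMeasure P] (hZ : IsPoisson P Z Λ)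
    {Ω' : Type*} [MeasurableSpace Ω'] {P' : Measure Ω'} [IsFiniteMeasure P']
    {Z' : ℕ → Ω' → E} (hZ' : IsPoisson P' Z' Λ) {ι : Type*} [Countable ι]
    {f : ι → E → ℝ≥0∞} (hf : ∀ j, Measurable (f j)) :
    P.map (fun ω j => ∑' i, f j (Z i ω)) = P'.map (fun ω j => ∑' i, f j (Z' i ω)) := by
  refine measure_eq_of_laplace fun c => ?_
  rw [lintegral_map (measurable_expNeg_linForm c)
      (measurable_pi_lambda _ fun j => hZ.measurable_tsum (hf j)),
    lintegral_map (measurable_expNeg_linForm c)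
      (measurable_pi_lambda _ fun j => hZ'.measurable_tsum (hf j)),
    hZ.laplace_linForm c hf, hZ'.laplace_linForm c hf]

-- Test functions of disjoint supports make the Laplace exponent additive.
theorem iIndepFun_tsum [IsProbabilityMeasure P] (hZ : IsPoisson P Z Λ) {ι : Type*}
    [Finite ι] {f : ι → E → ℝ≥0∞} (hf : ∀ j, Measurable (f j))
    (hd : ∀ i j z, i ≠ j → f i z = 0 ∨ f j z = 0) :
    iIndepFun (fun j ω => ∑' i, f j (Z i ω)) P := by
  have := Fintype.ofFinite ι
  have hm : ∀ j, Measurable fun ω => ∑' i, f j (Z i ω) := fun j => hZ.measurable_tsum (hf j)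
  rw [iIndepFun_iff_map_fun_eq_pi_map fun j => (hm j).aemeasurable]
  have : ∀ j, IsProbabilityMeasure (P.map fun ω => ∑' i, f j (Z i ω)) := fun j =>
    Measure.isProbabilityMeasure_map (hm j).aemeasurable
  refine measure_eq_of_laplace fun c => ?_
  have hexponent : ∀ z, 1 - expNeg (linForm c fun j => f j z) =
      ∑ j, (1 - expNeg (c j * f j z)) := fun z => by
    simp_rw [linForm_eq_sum, nsmul_eq_mul]
    by_cases hz : ∃ j, f j z ≠ 0
    · obtain ⟨j, hj⟩ := hz
      have hoff : ∀ i, i ≠ j → f i z = 0 := fun i hij => (hd i j z hij).resolve_right hj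
      rw [Finset.sum_eq_single j (fun i _ hij => by simp [hoff i hij]) (by simp),
        Finset.sum_eq_single j (fun i _ hij => by simp [hoff i hij]) (by simp)]
    · push Not at hz
      simp [hz]
  rw [lintegral_map (measurable_expNeg_linForm c) (measurable_pi_lambda _ hm),
    hZ.laplace_linForm c hf, lintegral_expNeg_linForm_pi]
  simp_rw [hexponent]
  rw [lintegral_finsetSum _ fun j _ =>
    continuous_one_sub_expNeg.measurable.fun_comp ((hf j).const_mul _), expNeg_sum]
  refine Finset.prod_congr rfl fun j _ => ?_
  simp_rw [nsmul_eq_mul]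
  rw [lintegral_map (f := fun x => expNeg (c j * x))
    (measurable_expNeg.comp (measurable_id.const_mul _)) (hm j)]
  simp_rw [← ENNReal.tsum_mul_left]
  exact (hZ.laplace _ ((hf j).const_mul _)).symm

variable [IsProbabilityMeasure P]

lemma ae_notMem (hZ : IsPoisson P Z Λ) {A : Set E} (hA : MeasurableSet A) (h0 : Λ A = 0) :
    ∀ᵐ ω ∂P, ∀ i, Z i ω ∉ A := by
  have hf : Measurable (A.indicator fun _ => (1 : ℝ≥0∞)) := measurable_const.indicator hA
  have hexponent : ∫⁻ z, (1 - expNeg (A.indicator (fun _ => (1 : ℝ≥0∞)) z)) ∂Λ = 0 := by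
    refine le_antisymm ((lintegral_mono fun z => one_sub_expNeg_le _).trans ?_) zero_le
    rw [lintegral_indicator_const hA, h0, mul_zero]
  have hlaplace := hZ.laplace _ hf
  rw [hexponent, expNeg_zero] at hlaplace
  filter_upwards [ae_eq_zero_of_lintegral_expNeg (hZ.measurable_tsum hf) hlaplace] with ω hω i hi
  simpa [hi] using ENNReal.tsum_eq_zero.1 hω i

lemma ae_forall (hZ : IsPoisson P Z Λ) {p : E → Prop} (h : ∀ᵐ z ∂Λ, p z) :
    ∀ᵐ ω ∂P, ∀ i, p (Z i ω) := by
  obtain ⟨A, hpA, hA, h0⟩ := exists_measurable_superset_of_null (ae_iff.1 h)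
  filter_upwards [hZ.ae_notMem hA h0] with ω hω i
  by_contra hp
  exact hω i (hpA hp)

lemma ae_tsum_ne_top (hZ : IsPoisson P Z Λ) {f : E → ℝ≥0∞} (hf : Measurable f)
    (hfin : ∀ z, f z ≠ ⊤) (hint : ∫⁻ z, (1 - expNeg (f z)) ∂Λ ≠ ⊤) :
    ∀ᵐ ω ∂P, ∑' i, f (Z i ω) ≠ ⊤ := by
  let a : ℕ → ℝ≥0∞ := fun n => ((n : ℝ≥0∞) + 1)⁻¹
  have ha : Tendsto a atTop (𝓝 0) :=
    (ENNReal.tendsto_inv_nat_nhds_zero.comp (tendsto_add_atTop_nat 1)).congr fun n => by simp [a]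
  have hm := hZ.measurable_tsum hf
  have hexponent := (continuous_expNeg.tendsto 0).comp (tendsto_lintegral_one_sub_expNeg_mul ha
    (fun n => ENNReal.inv_le_one.2 le_add_self) hf hfin hint)
  have hone : P {ω | ∑' i, f (Z i ω) ≠ ⊤} = 1 := by
    rw [← expNeg_zero]
    refine tendsto_nhds_unique (tendsto_lintegral_expNeg_mul ha
      (fun n => ENNReal.inv_ne_zero.2 (by finiteness)) hm) (hexponent.congr fun n => ?_)
    simp_rw [← ENNReal.tsum_mul_left]
    exact (hZ.laplace _ (hf.const_mul _)).symm
  exact (prob_compl_eq_zero_iff (hm (measurableSet_singleton ⊤).compl)).2 hone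

end IsPoisson

end LinearFunctionals

/-! ### Counting the points of a Poisson process -/

section Counts

lemma two_le_num {E : Type*} {A : Set E} {z : ℕ → E} {i j : ℕ} (hij : i ≠ j) (hi : z i ∈ A)
    (hj : z j ∈ A) : 2 ≤ num A z := by
  have h := ENNReal.sum_le_tsum (f := fun i => A.indicator (fun _ => (1 : ℝ≥0∞)) (z i)) {i, j}
  rwa [Finset.sum_pair hij, Set.indicator_of_mem hi, Set.indicator_of_mem hj,
    one_add_one_eq_two] at h

lemma one_le_num {E : Type*} {A : Set E} {z : ℕ → E} : 1 ≤ num A z ↔ ∃ i, z i ∈ A := by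
  rw [num_eq_encard, ← ENat.toENNReal_one, ENat.toENNReal_le, Set.one_le_encard_iff_nonempty]
  rfl

lemma num_eq_zero {E : Type*} {A : Set E} {z : ℕ → E} : num A z = 0 ↔ ∀ i, z i ∉ A := by
  simp [num]

lemma num_ne_top {E : Type*} {A : Set E} {z : ℕ → E} : num A z ≠ ⊤ ↔ {i | z i ∈ A}.Finite := by
  rw [num_eq_encard, Ne, ENat.toENNReal_eq_top, ← Ne, Set.encard_ne_top_iff]

lemma poissonMeasure_Ici_two_le (r : ℝ≥0) : poissonMeasure r (Set.Ici 2) ≤ (r : ℝ≥0∞) ^ 2 := by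
  have hcompl : (Set.Ici 2 : Set ℕ)ᶜ = {0} ∪ {1} := by
    ext n
    simp only [Set.mem_compl_iff, Set.mem_Ici, Set.mem_union, Set.mem_singleton_iff]
    lia
  have htail : (poissonMeasure r).real (Set.Ici 2) = 1 - Real.exp (-r) * (1 + r) := by
    rw [← compl_compl (Set.Ici 2), probReal_compl_eq_one_sub (.of_discrete), hcompl,
      measureReal_union (by simp) (.of_discrete), poissonMeasure_real_singleton,
      poissonMeasure_real_singleton]
    simp
    ring
  rw [← ofReal_measureReal, ← ENNReal.coe_pow, ← ENNReal.ofReal_coe_nnreal, htail]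
  refine ENNReal.ofReal_le_ofReal ?_
  push_cast
  nlinarith [mul_le_mul_of_nonneg_right (Real.add_one_le_exp (-(r : ℝ)))
    (by positivity : (0 : ℝ) ≤ 1 + r)]

variable {Ω E : Type*} [MeasurableSpace Ω] [MeasurableSpace E] {P : Measure Ω}

namespace IsPoisson

variable {Z : ℕ → Ω → E} {Λ : Measure E} {A : Set E}

lemma measurable_num (hZ : IsPoisson P Z Λ) (hA : MeasurableSet A) :
    Measurable fun ω => num A fun i => Z i ω :=
  hZ.measurable_tsum (measurable_const.indicator hA)

lemma laplace_num (hZ : IsPoisson P Z Λ) (hA : MeasurableSet A) (c : ℝ≥0∞) :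
    ∫⁻ ω, expNeg (c * num A fun i => Z i ω) ∂P = expNeg (Λ A * (1 - expNeg c)) := by
  simp_rw [num, ← ENNReal.tsum_mul_left]
  rw [hZ.laplace (fun z => c * A.indicator (fun _ => 1) z)
    ((measurable_const.indicator hA).const_mul _), mul_comm, ← lintegral_indicator_const hA]
  congr 1
  refine lintegral_congr fun z => ?_
  by_cases h : z ∈ A <;> simp [h]

theorem map_num [IsFiniteMeasure P] (hZ : IsPoisson P Z Λ) (hA : MeasurableSet A)
    (hfin : Λ A ≠ ⊤) :
    P.map (fun ω => num A fun i => Z i ω) =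
      (poissonMeasure (Λ A).toNNReal).map (Nat.cast : ℕ → ℝ≥0∞) := by
  refine measure_eq_of_laplace_nsmul fun n => ?_
  simp_rw [nsmul_eq_mul]
  have hm : Measurable fun x : ℝ≥0∞ => expNeg (n * x) :=
    measurable_expNeg.comp (measurable_id.const_mul _)
  rw [lintegral_map hm (hZ.measurable_num hA), lintegral_map hm measurable_from_nat,
    hZ.laplace_num hA, lintegral_expNeg_mul_poissonMeasure, ENNReal.coe_toNNReal hfin]

lemma measure_num_eq_one_ne_zero [IsFiniteMeasure P] (hZ : IsPoisson P Z Λ)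
    (hA : MeasurableSet A) (h0 : Λ A ≠ 0) (hfin : Λ A ≠ ⊤) :
    P {ω | num A (fun i => Z i ω) = 1} ≠ 0 := by
  have hpreimage : (Nat.cast : ℕ → ℝ≥0∞) ⁻¹' {1} = {1} := by
    ext n
    simp
  have hmap := congrArg (fun μ => μ {1}) (hZ.map_num hA hfin)
  simp only [Measure.map_apply (hZ.measurable_num hA) (measurableSet_singleton 1),
    Measure.map_apply measurable_from_nat (measurableSet_singleton (1 : ℝ≥0∞)), hpreimage] at hmap
  change P ((fun ω => num A fun i => Z i ω) ⁻¹' {1}) ≠ 0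
  rw [hmap]
  exact fun h => (poissonMeasure_real_singleton_pos 1 (ENNReal.toNNReal_pos h0 hfin)).ne'
    ((measureReal_eq_zero_iff (measure_ne_top _ _)).2 h)

lemma measure_two_le_num_le [IsFiniteMeasure P] (hZ : IsPoisson P Z Λ) (hA : MeasurableSet A) :
    P {ω | 2 ≤ num A fun i => Z i ω} ≤ Λ A ^ 2 := by
  rcases eq_or_ne (Λ A) ⊤ with htop | hfin
  · simp [htop]
  have hpreimage : (Nat.cast : ℕ → ℝ≥0∞) ⁻¹' Set.Ici 2 = Set.Ici 2 := by
    ext n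
    simp only [Set.mem_preimage, Set.mem_Ici]
    exact_mod_cast Iff.rfl
  change P ((fun ω => num A fun i => Z i ω) ⁻¹' Set.Ici 2) ≤ _
  rw [← Measure.map_apply (hZ.measurable_num hA) measurableSet_Ici, hZ.map_num hA hfin,
    Measure.map_apply measurable_from_nat measurableSet_Ici, hpreimage]
  simpa [ENNReal.coe_toNNReal hfin] using poissonMeasure_Ici_two_le (Λ A).toNNReal

variable [IsProbabilityMeasure P]

lemma ae_finite (hZ : IsPoisson P Z Λ) (hA : MeasurableSet A) (hfin : Λ A ≠ ⊤) :
    ∀ᵐ ω ∂P, {i | Z i ω ∈ A}.Finite := by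
  have hint : ∫⁻ z, (1 - expNeg (A.indicator (fun _ => 1) z)) ∂Λ ≠ ⊤ := by
    refine ne_top_of_le_ne_top hfin ((lintegral_mono fun z => one_sub_expNeg_le _).trans ?_)
    rw [lintegral_indicator_const hA, one_mul]
  filter_upwards [hZ.ae_tsum_ne_top (measurable_const.indicator hA)
    (fun z => by by_cases h : z ∈ A <;> simp [h]) hint] with ω hω
  exact num_ne_top.1 hω

-- Two points tied at level below `M` share one of the `M (n + 1)` cells of width `1 / (n + 1)`,
-- and a cell contains two points with probability at most `1 / (n + 1) ^ 2`.
lemma measure_exists_tie_le (hZ : IsPoisson P Z Λ) {r : E → ℝ} (hr : Measurable r)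
    (hr0 : ∀ z, 0 ≤ r z)
    (hΛ : ∀ a b : ℝ, 0 ≤ a → a ≤ b → Λ (r ⁻¹' Set.Ico a b) = ENNReal.ofReal (b - a)) (M n : ℕ) :
    P {ω | ∃ i j, i ≠ j ∧ r (Z i ω) = r (Z j ω) ∧ r (Z i ω) < M} ≤
      ENNReal.ofReal (M * (1 / ((n : ℝ) + 1))) := by
  have hn : (0 : ℝ) < (n : ℝ) + 1 := by positivity
  let cell : ℕ → Set E := fun k => r ⁻¹' Set.Ico (k / ((n : ℝ) + 1)) ((k + 1) / ((n : ℝ) + 1))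
  have hsub : {ω | ∃ i j, i ≠ j ∧ r (Z i ω) = r (Z j ω) ∧ r (Z i ω) < M} ⊆
      ⋃ k ∈ Finset.range (M * (n + 1)), {ω | 2 ≤ num (cell k) fun i => Z i ω} := by
    rintro ω ⟨i, j, hij, htie, hM⟩
    have hcell : ∀ l, r (Z l ω) = r (Z i ω) → Z l ω ∈ cell ⌊r (Z i ω) * ((n : ℝ) + 1)⌋₊ := by
      intro l hl
      refine ⟨?_, ?_⟩
      · rw [hl, div_le_iff₀ hn]
        exact Nat.floor_le (mul_nonneg (hr0 _) hn.le)
      · rw [hl, lt_div_iff₀ hn]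
        exact Nat.lt_floor_add_one _
    refine Set.mem_biUnion (x := ⌊r (Z i ω) * ((n : ℝ) + 1)⌋₊) ?_
      (two_le_num hij (hcell i rfl) (hcell j htie.symm))
    simp only [Finset.coe_range, Set.mem_Iio]
    rw [Nat.floor_lt (mul_nonneg (hr0 _) hn.le)]
    push_cast
    exact mul_lt_mul_of_pos_right hM hn
  have hprob : ∀ k, P {ω | 2 ≤ num (cell k) fun i => Z i ω} ≤
      ENNReal.ofReal ((1 / ((n : ℝ) + 1)) ^ 2) := fun k => by
    have hwidth : ((k : ℝ) + 1) / ((n : ℝ) + 1) - k / ((n : ℝ) + 1) = 1 / ((n : ℝ) + 1) := by ring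
    refine (hZ.measure_two_le_num_le (hr measurableSet_Ico)).trans_eq ?_
    rw [hΛ _ _ (by positivity) (by gcongr; linarith), hwidth, ENNReal.ofReal_pow (by positivity)]
  calc P _ ≤ ∑ k ∈ Finset.range (M * (n + 1)), P {ω | 2 ≤ num (cell k) fun i => Z i ω} :=
        (measure_mono hsub).trans (measure_biUnion_finset_le _ _)
    _ ≤ ∑ k ∈ Finset.range (M * (n + 1)), ENNReal.ofReal ((1 / ((n : ℝ) + 1)) ^ 2) :=
        Finset.sum_le_sum fun k _ => hprob k
    _ = ENNReal.ofReal (M * (1 / ((n : ℝ) + 1))) := by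
        rw [Finset.sum_const, Finset.card_range, nsmul_eq_mul, ← ENNReal.ofReal_natCast,
          ← ENNReal.ofReal_mul (by positivity)]
        push_cast
        field_simp

lemma ae_injective (hZ : IsPoisson P Z Λ) {r : E → ℝ} (hr : Measurable r) (hr0 : ∀ z, 0 ≤ r z)
    (hΛ : ∀ a b : ℝ, 0 ≤ a → a ≤ b → Λ (r ⁻¹' Set.Ico a b) = ENNReal.ofReal (b - a)) :
    ∀ᵐ ω ∂P, ∀ i j, i ≠ j → r (Z i ω) ≠ r (Z j ω) := by
  have hnull : ∀ M : ℕ, P {ω | ∃ i j, i ≠ j ∧ r (Z i ω) = r (Z j ω) ∧ r (Z i ω) < M} = 0 := by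
    intro M
    have hlim : Tendsto (fun n : ℕ => ENNReal.ofReal (M * (1 / ((n : ℝ) + 1)))) atTop (𝓝 0) := by
      simpa using ENNReal.tendsto_ofReal (tendsto_one_div_add_atTop_nhds_zero_nat.const_mul (M : ℝ))
    exact le_antisymm (ge_of_tendsto' hlim (hZ.measure_exists_tie_le hr hr0 hΛ M)) zero_le
  filter_upwards [ae_all_iff.2 fun M => measure_eq_zero_iff_ae_notMem.1 (hnull M)] with ω hω
    i j hij htie
  obtain ⟨M, hM⟩ := exists_nat_gt (r (Z i ω))
  exact hω M ⟨i, j, hij, htie, hM⟩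

end IsPoisson

end Counts

/-! ### The derivative of the Laplace functional -/

section Campbell

lemma mul_expNeg_le (x : ℝ≥0∞) : x * expNeg x ≤ 1 - expNeg x := by
  induction x with
  | top => simp
  | coe x =>
    refine ENNReal.le_sub_of_add_le_right (expNeg_ne_top _) ?_
    have hreal : x * Real.exp (-x) + Real.exp (-x) ≤ 1 := by
      calc x * Real.exp (-x) + Real.exp (-x) = (x + 1) * Real.exp (-x) := by ring
        _ ≤ Real.exp x * Real.exp (-x) := by gcongr; exact Real.add_one_le_exp _
        _ = 1 := by rw [← Real.exp_add]; simp
    rw [expNeg_coe, ← ENNReal.ofReal_coe_nnreal, ← ENNReal.ofReal_mul x.coe_nonneg,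
      ← ENNReal.ofReal_add (by positivity) (by positivity), ← ENNReal.ofReal_one]
    exact ENNReal.ofReal_le_ofReal hreal

lemma expNeg_add_one_sub (x : ℝ≥0∞) : expNeg x + (1 - expNeg x) = 1 :=
  add_tsub_cancel_of_le (expNeg_le_one x)

lemma one_sub_expNeg_add (x y : ℝ≥0∞) :
    1 - expNeg (x + y) = (1 - expNeg y) + (1 - expNeg x) * expNeg y := by
  rw [expNeg_add]
  refine (ENNReal.eq_sub_of_add_eq (ENNReal.mul_ne_top (expNeg_ne_top _) (expNeg_ne_top _)) ?_).symm
  rw [add_assoc, ← add_mul, add_comm (1 - expNeg x), expNeg_add_one_sub, one_mul, add_comm,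
    expNeg_add_one_sub]

/-- The difference quotient at `0` of `t ↦ 1 - e^{-t x}`, with step `2^{-k}`; dyadic steps make it
monotone in `k`. -/
def quot (k : ℕ) (x : ℝ≥0∞) : ℝ≥0∞ := 2 ^ k * (1 - expNeg (x * (2 ^ k)⁻¹))

lemma two_pow_mul_inv (k : ℕ) : (2 : ℝ≥0∞) ^ k * (2 ^ k)⁻¹ = 1 :=
  ENNReal.mul_inv_cancel (by positivity) (by finiteness)

lemma continuous_quot (k : ℕ) : Continuous (quot k) :=
  (ENNReal.continuous_const_mul (by finiteness)).comp
    (continuous_one_sub_expNeg.comp (ENNReal.continuous_mul_const (by finiteness)))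

@[fun_prop] lemma measurable_quot (k : ℕ) : Measurable (quot k) := (continuous_quot k).measurable

-- With `y = e^{-x / 2^{k+1}}` the claim reads `1 - y ^ 2 ≤ 2 (1 - y)`.
lemma quot_mono (x : ℝ≥0∞) : Monotone fun k => quot k x := by
  refine monotone_nat_of_le_succ fun k => ?_
  set y := x * (2 ^ (k + 1))⁻¹ with hy
  have hdouble : x * (2 ^ k)⁻¹ = y + y := by
    rw [hy, ← two_mul, pow_succ, ENNReal.mul_inv (by simp) (by simp), mul_left_comm,
      mul_left_comm 2, ENNReal.mul_inv_cancel (by simp) (by simp), mul_one]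
  calc quot k x = 2 ^ k * ((1 - expNeg y) + (1 - expNeg y) * expNeg y) := by
        rw [quot, hdouble, one_sub_expNeg_add]
    _ ≤ 2 ^ k * ((1 - expNeg y) + (1 - expNeg y) * 1) := by gcongr; exact expNeg_le_one y
    _ = quot (k + 1) x := by rw [quot, ← hy, mul_one, ← two_mul, pow_succ, mul_assoc]

lemma quot_le (k : ℕ) (x : ℝ≥0∞) : quot k x ≤ x := by
  calc quot k x ≤ 2 ^ k * (x * (2 ^ k)⁻¹) := by unfold quot; gcongr; exact one_sub_expNeg_le _
    _ = x := by rw [mul_left_comm, two_pow_mul_inv, mul_one]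

lemma le_quot (k : ℕ) (x : ℝ≥0∞) : x * expNeg (x * (2 ^ k)⁻¹) ≤ quot k x := by
  calc x * expNeg (x * (2 ^ k)⁻¹)
      = 2 ^ k * (x * (2 ^ k)⁻¹ * expNeg (x * (2 ^ k)⁻¹)) := by
        rw [← mul_assoc, mul_left_comm, two_pow_mul_inv, mul_one]
    _ ≤ quot k x := by unfold quot; gcongr; exact mul_expNeg_le _

lemma tendsto_quot (x : ℝ≥0∞) : Tendsto (fun k => quot k x) atTop (𝓝 x) := by
  rcases eq_or_ne x ⊤ with rfl | hx
  · have htop : ∀ k, quot k ⊤ = 2 ^ k := fun k => by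
      rw [quot, ENNReal.top_mul (by simp), expNeg_top, tsub_zero, mul_one]
    simp_rw [htop]
    exact ENNReal.tendsto_pow_atTop_nhds_top_iff.2 (by norm_num)
  · refine tendsto_of_tendsto_of_tendsto_of_le_of_le ?_ tendsto_const_nhds (fun k => le_quot k x)
      fun k => quot_le k x
    have hstep : Tendsto (fun k : ℕ => x * (2 ^ k : ℝ≥0∞)⁻¹) atTop (𝓝 0) := by
      have hpow : Tendsto (fun k : ℕ => (2⁻¹ : ℝ≥0∞) ^ k) atTop (𝓝 0) :=
        ENNReal.tendsto_pow_atTop_nhds_zero_of_lt_one (by norm_num)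
      simpa [ENNReal.inv_pow] using ENNReal.Tendsto.const_mul (a := x) hpow (Or.inr hx)
    simpa using ENNReal.Tendsto.const_mul (a := x) ((continuous_expNeg.tendsto 0).comp hstep)
      (Or.inr hx)

lemma tendsto_quot_diag {b : ℕ → ℝ≥0∞} {B : ℝ≥0∞} (hb : Monotone b)
    (hB : Tendsto b atTop (𝓝 B)) : Tendsto (fun k => quot k (b k)) atTop (𝓝 B) := by
  refine tendsto_order.2 ⟨fun a ha => ?_, fun a ha => ?_⟩
  · obtain ⟨j, hj⟩ := ((tendsto_order.1 (tendsto_quot B)).1 a ha).exists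
    filter_upwards [(tendsto_order.1 (((continuous_quot j).tendsto B).comp hB)).1 a hj,
      eventually_ge_atTop j] with k hk hjk
    exact lt_of_lt_of_le hk (quot_mono _ hjk)
  · exact Eventually.of_forall fun k =>
      ((quot_le k _).trans (hb.ge_of_tendsto hB k)).trans_lt ha

lemma lintegral_quot_mul_monotone {S : Type*} [MeasurableSpace S] (μ : Measure S)
    (f w : S → ℝ≥0∞) : Monotone fun k => ∫⁻ s, quot k (f s) * w s ∂μ := fun _ _ hjk =>
  lintegral_mono fun _ => mul_le_mul_left (quot_mono _ hjk) _

lemma tendsto_lintegral_quot_mul {S : Type*} [MeasurableSpace S] (μ : Measure S)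
    {f w : S → ℝ≥0∞} (hf : Measurable f) (hw : Measurable w) (hfin : ∀ s, w s ≠ ⊤) :
    Tendsto (fun k => ∫⁻ s, quot k (f s) * w s ∂μ) atTop (𝓝 (∫⁻ s, f s * w s ∂μ)) :=
  lintegral_tendsto_of_tendsto_of_monotone
    (fun k => (((measurable_quot k).comp hf).mul hw).aemeasurable)
    (ae_of_all _ fun _ _ _ hjk => mul_le_mul_left (quot_mono _ hjk) _)
    (ae_of_all _ fun s => ENNReal.Tendsto.mul_const (tendsto_quot _) (Or.inr (hfin s)))

variable {Ω E : Type*} [MeasurableSpace Ω] [MeasurableSpace E] {P : Measure Ω}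
  {Z : ℕ → Ω → E} {Λ : Measure E}

lemma lintegral_one_sub_expNeg_add {f v : E → ℝ≥0∞} (hv : Measurable v) (k : ℕ) :
    ∫⁻ z, (1 - expNeg (f z * (2 ^ k)⁻¹ + v z)) ∂Λ =
      ∫⁻ z, (1 - expNeg (v z)) ∂Λ + (∫⁻ z, quot k (f z) * expNeg (v z) ∂Λ) * (2 ^ k)⁻¹ := by
  have hquot : ∀ z, (1 - expNeg (f z * (2 ^ k)⁻¹)) * expNeg (v z) =
      quot k (f z) * expNeg (v z) * (2 ^ k)⁻¹ := fun z => by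
    rw [quot, mul_right_comm, mul_right_comm (2 ^ k), two_pow_mul_inv, one_mul]
  simp_rw [one_sub_expNeg_add, hquot]
  rw [lintegral_add_left (continuous_one_sub_expNeg.measurable.fun_comp hv),
    lintegral_mul_const' _ _ (ENNReal.inv_ne_top.2 (by simp))]

lemma quot_mul_expNeg (k : ℕ) (x y : ℝ≥0∞) :
    quot k x * expNeg y = 2 ^ k * (expNeg y - expNeg (x * (2 ^ k)⁻¹ + y)) := by
  rw [quot, mul_assoc, ENNReal.sub_mul fun _ _ => expNeg_ne_top _, one_mul, expNeg_add]

lemma IsPoisson.lintegral_quot_tsum_mul_expNeg [IsProbabilityMeasure P] (hZ : IsPoisson P Z Λ)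
    {f v : E → ℝ≥0∞} (hf : Measurable f) (hv : Measurable v) (k : ℕ) :
    ∫⁻ ω, quot k (∑' i, f (Z i ω)) * expNeg (∑' i, v (Z i ω)) ∂P =
      quot k (∫⁻ z, quot k (f z) * expNeg (v z) ∂Λ) *
        expNeg (∫⁻ z, (1 - expNeg (v z)) ∂Λ) := by
  have hm : Measurable fun z => f z * (2 ^ k)⁻¹ + v z := (hf.mul_const _).add hv
  simp_rw [quot_mul_expNeg k (∑' i, f (Z i _)), ← ENNReal.tsum_mul_right, ← ENNReal.tsum_add]
  rw [lintegral_const_mul' _ _ (by finiteness), lintegral_sub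
    (f := fun ω => expNeg (∑' i, v (Z i ω)))
    (g := fun ω => expNeg (∑' i, (f (Z i ω) * (2 ^ k)⁻¹ + v (Z i ω))))
    (measurable_expNeg.comp (hZ.measurable_tsum hm)) (lintegral_expNeg_ne_top P _)
    (ae_of_all _ fun ω => expNeg_strictAnti.antitone (ENNReal.tsum_le_tsum fun _ => le_add_self)),
    hZ.laplace v hv, hZ.laplace _ hm, lintegral_one_sub_expNeg_add hv, add_comm, ← quot_mul_expNeg]

-- Differentiate the Laplace functional of `v + t f` in `t` at `0`.
theorem IsPoisson.lintegral_tsum_mul_expNeg [IsProbabilityMeasure P] (hZ : IsPoisson P Z Λ)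
    {f v : E → ℝ≥0∞} (hf : Measurable f) (hv : Measurable v) :
    ∫⁻ ω, (∑' i, f (Z i ω)) * expNeg (∑' i, v (Z i ω)) ∂P =
      (∫⁻ z, f z * expNeg (v z) ∂Λ) * expNeg (∫⁻ z, (1 - expNeg (v z)) ∂Λ) := by
  refine tendsto_nhds_unique (tendsto_lintegral_quot_mul P (hZ.measurable_tsum hf)
    (measurable_expNeg.comp (hZ.measurable_tsum hv)) fun _ => expNeg_ne_top _) ?_
  refine Tendsto.congr (fun k => (hZ.lintegral_quot_tsum_mul_expNeg hf hv k).symm) ?_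
  exact ENNReal.Tendsto.mul_const (tendsto_quot_diag (lintegral_quot_mul_monotone Λ _ _)
    (tendsto_lintegral_quot_mul Λ hf (measurable_expNeg.comp hv) fun _ => expNeg_ne_top _))
    (Or.inr (expNeg_ne_top _))

end Campbell

/-! ### Increasing rearrangements -/

/-- A probability law on `(0, ∞)` without atoms and with full support. -/
structure IsPosLaw (μ : Measure ℝ) : Prop where
  isProb : IsProbabilityMeasure μ
  noAtoms : NullSingletonClass μ
  nonpos : μ (Set.Iic 0) = 0
  pos : ∀ a b, 0 ≤ a → a < b → μ (Set.Ioc a b) ≠ 0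

/-- The increasing rearrangement `G⁻¹ ∘ F` carrying `μ` to `ν`, where `F` and `G` are the
distribution functions of `μ` and `ν`; it is `0` on `(-∞, 0]` when `μ` lives on `(0, ∞)`. -/
def transport (μ ν : Measure ℝ) (v : ℝ) : ℝ :=
  sInf {x | 0 < x ∧ μ (Set.Iic v) ≤ ν (Set.Iic x)}

lemma lt_of_measure_Iic_lt {μ : Measure ℝ} {a b : ℝ} (hab : μ (Set.Iic a) < μ (Set.Iic b)) :
    a < b :=
  lt_of_not_ge fun hba => hab.not_ge (measure_mono (Set.Iic_subset_Iic.2 hba))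

section Transport

variable {μ ν : Measure ℝ}

namespace IsPosLaw

lemma measure_Iic_lt (h : IsPosLaw μ) {a b : ℝ} (ha : 0 ≤ a) (hab : a < b) :
    μ (Set.Iic a) < μ (Set.Iic b) := by
  have := h.isProb
  rw [← Set.Iic_union_Ioc_eq_Iic hab.le,
    measure_union (Set.Iic_disjoint_Ioc le_rfl) measurableSet_Ioc]
  exact ENNReal.lt_add_right (measure_ne_top _ _) (h.pos a b ha hab)

lemma measure_Iic_le_iff (h : IsPosLaw μ) {a b : ℝ} (hb : 0 ≤ b) :
    μ (Set.Iic a) ≤ μ (Set.Iic b) ↔ a ≤ b :=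
  ⟨fun hle => not_lt.1 fun hba => hle.not_gt (h.measure_Iic_lt hb hba),
    fun hab => measure_mono (Set.Iic_subset_Iic.2 hab)⟩

lemma measure_Iic_pos (h : IsPosLaw μ) {b : ℝ} (hb : 0 < b) : 0 < μ (Set.Iic b) :=
  h.nonpos ▸ h.measure_Iic_lt le_rfl hb

lemma measure_Iic_lt_one (h : IsPosLaw μ) {b : ℝ} (hb : 0 < b) : μ (Set.Iic b) < 1 :=
  have := h.isProb
  (h.measure_Iic_lt hb.le (lt_add_one b)).trans_le prob_le_one

lemma continuous_cdf (h : IsPosLaw μ) : Continuous (cdf μ) := by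
  have := h.isProb
  have := h.noAtoms
  refine continuous_iff_continuousAt.2 fun x => ?_
  have hjump : ENNReal.ofReal (cdf μ x - Function.leftLim (cdf μ) x) = 0 := by
    rw [← StieltjesFunction.measure_singleton, measure_cdf, measure_singleton]
  rw [(monotone_cdf μ).continuousAt_iff_leftLim_eq_rightLim, (cdf μ).rightLim_eq]
  exact le_antisymm ((monotone_cdf μ).leftLim_le le_rfl)
    (sub_nonpos.1 (ENNReal.ofReal_eq_zero.1 hjump))

lemma exists_measure_Iic_eq (h : IsPosLaw μ) {p : ℝ≥0∞} (hp0 : 0 < p) (hp1 : p < 1) :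
    ∃ x, 0 < x ∧ μ (Set.Iic x) = p := by
  have := h.isProb
  have hp : p ≠ ⊤ := hp1.ne_top
  have hcdf0 : cdf μ 0 = 0 :=
    le_antisymm (ENNReal.ofReal_eq_zero.1 ((ofReal_cdf μ 0).trans h.nonpos)) (cdf_nonneg μ 0)
  have hlarge : ∀ᶠ x in atTop, p.toReal < cdf μ x :=
    (tendsto_cdf_atTop μ).eventually_const_lt (ENNReal.toReal_lt_of_lt_ofReal (by simpa using hp1))
  obtain ⟨y, hy, hy0⟩ := (hlarge.and (eventually_ge_atTop 0)).exists
  obtain ⟨x, hx, hxp⟩ := intermediate_value_Icc hy0 h.continuous_cdf.continuousOn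
    ⟨hcdf0.trans_le ENNReal.toReal_nonneg, hy.le⟩
  have hx0 : x ≠ 0 := by
    rintro rfl
    exact (ENNReal.toReal_pos hp0.ne' hp).ne (hcdf0.symm.trans hxp)
  exact ⟨x, hx.1.lt_of_ne' hx0, by rw [← ofReal_cdf, hxp, ENNReal.ofReal_toReal hp]⟩

end IsPosLaw

lemma transport_of_nonpos (hμ : IsPosLaw μ) {v : ℝ} (hv : v ≤ 0) : transport μ ν v = 0 := by
  have hzero : μ (Set.Iic v) = 0 := measure_mono_null (Set.Iic_subset_Iic.2 hv) hμ.nonpos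
  simp only [transport, hzero, zero_le, and_true]
  exact csInf_Ioi

lemma transport_eq (hν : IsPosLaw ν) {v x : ℝ} (hx : 0 < x) (h : ν (Set.Iic x) = μ (Set.Iic v)) :
    transport μ ν v = x := by
  refine IsLeast.csInf_eq ⟨⟨hx, h.ge⟩, fun y ⟨hy, hle⟩ => ?_⟩
  exact (hν.measure_Iic_le_iff hy.le).1 (h.trans_le hle)

lemma transport_spec (hμ : IsPosLaw μ) (hν : IsPosLaw ν) {v : ℝ} (hv : 0 < v) :
    0 < transport μ ν v ∧ ν (Set.Iic (transport μ ν v)) = μ (Set.Iic v) := by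
  obtain ⟨x, hx, h⟩ := hν.exists_measure_Iic_eq (hμ.measure_Iic_pos hv) (hμ.measure_Iic_lt_one hv)
  rw [transport_eq hν hx h]
  exact ⟨hx, h⟩

lemma transport_pos (hμ : IsPosLaw μ) (hν : IsPosLaw ν) {v : ℝ} (hv : 0 < v) :
    0 < transport μ ν v :=
  (transport_spec hμ hν hv).1

lemma measure_Iic_transport (hμ : IsPosLaw μ) (hν : IsPosLaw ν) {v : ℝ} (hv : 0 < v) :
    ν (Set.Iic (transport μ ν v)) = μ (Set.Iic v) :=
  (transport_spec hμ hν hv).2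

lemma strictMonoOn_transport (hμ : IsPosLaw μ) (hν : IsPosLaw ν) :
    StrictMonoOn (transport μ ν) (Set.Ioi 0) := fun a ha b hb hab => by
  apply lt_of_measure_Iic_lt (μ := ν)
  rw [measure_Iic_transport hμ hν ha, measure_Iic_transport hμ hν hb]
  exact hμ.measure_Iic_lt (Set.mem_Ioi.1 ha).le hab

lemma exists_transport_eq (hμ : IsPosLaw μ) (hν : IsPosLaw ν) {x : ℝ} (hx : 0 < x) :
    ∃ v, 0 < v ∧ transport μ ν v = x := by
  obtain ⟨v, hv, h⟩ := hμ.exists_measure_Iic_eq (hν.measure_Iic_pos hx) (hν.measure_Iic_lt_one hx)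
  exact ⟨v, hv, transport_eq hν hx h.symm⟩

lemma monotone_transport (hμ : IsPosLaw μ) (hν : IsPosLaw ν) : Monotone (transport μ ν) := by
  intro a b hab
  rcases le_or_gt a 0 with ha | ha
  · rw [transport_of_nonpos hμ ha]
    exact Real.sInf_nonneg fun x hx => hx.1.le
  · exact (strictMonoOn_transport hμ hν).monotoneOn ha (ha.trans_le hab) hab

lemma continuousAt_transport (hμ : IsPosLaw μ) (hν : IsPosLaw ν) {v : ℝ} (hv : 0 < v) :
    ContinuousAt (transport μ ν) v := by
  refine continuousAt_of_monotoneOn_of_image_mem_nhds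
    (strictMonoOn_transport hμ hν).monotoneOn (Ioi_mem_nhds hv) ?_
  exact mem_of_superset (Ioi_mem_nhds (transport_pos hμ hν hv))
    fun x hx => exists_transport_eq hμ hν hx

lemma map_transport (hμ : IsPosLaw μ) (hν : IsPosLaw ν) : μ.map (transport μ ν) = ν := by
  have := hμ.isProb
  have := hν.isProb
  have hm := (monotone_transport hμ hν).measurable
  have := Measure.isProbabilityMeasure_map (μ := μ) hm.aemeasurable
  refine Measure.ext_of_Iic _ _ fun t => ?_
  rw [Measure.map_apply hm measurableSet_Iic]
  rcases le_or_gt t 0 with ht | ht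
  · rw [measure_mono_null (Set.Iic_subset_Iic.2 ht) hν.nonpos]
    refine measure_mono_null (fun v hv => ?_) hμ.nonpos
    exact not_lt.1 fun hv0 => (hv.trans ht).not_gt (transport_pos hμ hν hv0)
  · obtain ⟨w, hw, rfl⟩ := exists_transport_eq hμ hν ht
    rw [measure_Iic_transport hμ hν hw]
    congr 1
    ext v
    rcases le_or_gt v 0 with hv | hv
    · simp only [Set.mem_preimage, transport_of_nonpos hμ hv, Set.mem_Iic, ht.le, hv.trans hw.le]
    · exact (strictMonoOn_transport hμ hν).le_iff_le hv hw

lemma tendsto_transport {ι : Type*} {l : Filter ι} {ν : ι → Measure ℝ} (hμ : IsPosLaw μ)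
    (hν : ∀ᶠ i in l, IsPosLaw (ν i))
    (hbelow : ∀ ε : ℝ, 0 < ε → Tendsto (fun i => ν i (Set.Iic (1 - ε))) l (𝓝 0))
    (habove : ∀ ε : ℝ, 0 < ε → Tendsto (fun i => ν i (Set.Ioi (1 + ε))) l (𝓝 0)) {v : ℝ}
    (hv : 0 < v) : Tendsto (fun i => transport μ (ν i) v) l (𝓝 1) := by
  refine tendsto_order.2 ⟨fun a ha => ?_, fun a ha => ?_⟩
  · filter_upwards [hν, (hbelow (1 - a) (by linarith)).eventually_lt_const
      (hμ.measure_Iic_pos hv)] with i hi hlt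
    apply lt_of_measure_Iic_lt (μ := ν i)
    rw [measure_Iic_transport hμ hi hv]
    simpa using hlt
  · have hgap : 0 < 1 - μ (Set.Iic v) := tsub_pos_of_lt (hμ.measure_Iic_lt_one hv)
    obtain ⟨b, hb1, hba⟩ := exists_between ha
    filter_upwards [hν, (habove (b - 1) (by linarith)).eventually_lt_const hgap] with i hi hlt
    have := hi.isProb
    refine (lt_of_measure_Iic_lt (μ := ν i) ?_).trans hba
    rw [measure_Iic_transport hμ hi hv, ← Set.compl_Ioi (a := b),
      prob_compl_eq_one_sub measurableSet_Ioi]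
    rw [add_sub_cancel] at hlt
    exact lt_tsub_comm.1 hlt

end Transport

/-! ### Gamma laws -/

section Gamma

variable {a r : ℝ}

lemma measurable_gammaPDF (a r : ℝ) : Measurable (gammaPDF a r) :=
  (measurable_gammaPDFReal a r).ennreal_ofReal

lemma isPosLaw_gammaMeasure (ha : 0 < a) (hr : 0 < r) : IsPosLaw (gammaMeasure a r) where
  isProb := isProbabilityMeasure_gammaMeasure ha hr
  noAtoms := ⟨fun x => withDensity_absolutelyContinuous _ _ (measure_singleton x)⟩
  nonpos := by
    rw [gammaMeasure, withDensity_apply _ measurableSet_Iic, setLIntegral_congr Iio_ae_eq_Iic.symm]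
    exact lintegral_gammaPDF_of_nonpos le_rfl
  pos x y hx hxy := by
    rw [gammaMeasure, withDensity_apply _ measurableSet_Ioc]
    refine ((setLIntegral_pos_iff (measurable_gammaPDF a r)).2 ?_).ne'
    refine lt_of_lt_of_le ?_ (measure_mono (s := Set.Ioc x y) fun z hz =>
      ⟨(ENNReal.ofReal_pos.2 (gammaPDFReal_pos ha hr (hx.trans_lt hz.1))).ne', hz⟩)
    simpa using hxy

lemma ae_pos_gammaMeasure (ha : 0 < a) (hr : 0 < r) : ∀ᵐ x ∂(gammaMeasure a r), 0 < x := by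
  simpa [ae_iff, Set.Iic] using (isPosLaw_gammaMeasure ha hr).nonpos

/-- The moment of order `s` of the gamma law of shape `a` and rate `r`, finite for `-a < s`. -/
def gammaMoment (a r s : ℝ) : ℝ := Real.Gamma (a + s) / (Real.Gamma a * r ^ s)

lemma gammaMoment_pos (ha : 0 < a) (hr : 0 < r) {s : ℝ} (has : 0 < a + s) :
    0 < gammaMoment a r s :=
  div_pos (Real.Gamma_pos_of_pos has)
    (mul_pos (Real.Gamma_pos_of_pos ha) (Real.rpow_pos_of_pos hr s))

lemma rpow_mul_gammaPDFReal (ha : 0 < a) (hr : 0 < r) {s : ℝ} (has : 0 < a + s) {x : ℝ}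
    (hx : 0 < x) :
    x ^ s * gammaPDFReal a r x = gammaMoment a r s * gammaPDFReal (a + s) r x := by
  have hΓ := (Real.Gamma_pos_of_pos ha).ne'
  have hΓs := (Real.Gamma_pos_of_pos has).ne'
  have hrs := (Real.rpow_pos_of_pos hr s).ne'
  rw [gammaPDFReal, gammaPDFReal, if_pos hx.le, if_pos hx.le, gammaMoment, Real.rpow_add hr,
    add_sub_right_comm, Real.rpow_add hx]
  field_simp

lemma lintegral_rpow_mul_gammaMeasure (ha : 0 < a) (hr : 0 < r) {s : ℝ} (has : 0 < a + s)
    {Φ : ℝ → ℝ≥0∞} (hΦ : Measurable Φ) :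
    ∫⁻ x, ENNReal.ofReal (x ^ s) * Φ x ∂(gammaMeasure a r) =
      ENNReal.ofReal (gammaMoment a r s) * ∫⁻ x, Φ x ∂(gammaMeasure (a + s) r) := by
  have hpow : Measurable fun x : ℝ => ENNReal.ofReal (x ^ s) :=
    (measurable_id.pow_const s).ennreal_ofReal
  rw [gammaMeasure, gammaMeasure,
    lintegral_withDensity_eq_lintegral_mul _ (measurable_gammaPDF a r) (hpow.fun_mul hΦ),
    lintegral_withDensity_eq_lintegral_mul _ (measurable_gammaPDF (a + s) r) hΦ,
    ← lintegral_const_mul' _ _ ENNReal.ofReal_ne_top]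
  have hne : ∀ᵐ x : ℝ, x ≠ 0 := by simp [ae_iff]
  refine lintegral_congr_ae (hne.mono fun x hx => ?_)
  simp only [Pi.mul_apply]
  rw [← mul_assoc, ← mul_assoc]
  congr 1
  rcases lt_or_gt_of_ne hx with hneg | hpos
  · rw [gammaPDF_of_neg hneg, gammaPDF_of_neg hneg, zero_mul, mul_zero]
  · rw [gammaPDF, gammaPDF, ← ENNReal.ofReal_mul (gammaPDFReal_nonneg ha hr x),
      ← ENNReal.ofReal_mul (gammaMoment_pos ha hr has).le, mul_comm,
      rpow_mul_gammaPDFReal ha hr has hpos]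

lemma lintegral_rpow_gammaMeasure (ha : 0 < a) (hr : 0 < r) {s : ℝ} (has : 0 < a + s) :
    ∫⁻ x, ENNReal.ofReal (x ^ s) ∂(gammaMeasure a r) = ENNReal.ofReal (gammaMoment a r s) := by
  have := isProbabilityMeasure_gammaMeasure has hr
  simpa using lintegral_rpow_mul_gammaMeasure ha hr has (Φ := fun _ => 1) measurable_const

lemma const_mul_gammaPDFReal_mul (hr : 0 < r) {c : ℝ} (hc : 0 < c) (x : ℝ) :
    c * gammaPDFReal a r (c * x) = gammaPDFReal a (c * r) x := by
  rcases lt_or_ge x 0 with hx | hx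
  · rw [gammaPDFReal, gammaPDFReal, if_neg hx.not_ge,
      if_neg (mul_neg_of_pos_of_neg hc hx).not_ge, mul_zero]
  · rw [gammaPDFReal, gammaPDFReal, if_pos hx, if_pos (by positivity), Real.mul_rpow hc.le hr.le,
      Real.mul_rpow hc.le hx, Real.rpow_sub_one hc.ne']
    field_simp

lemma gammaMeasure_Iic_mul (hr : 0 < r) {c : ℝ} (hc : 0 < c) (x : ℝ) :
    gammaMeasure a r (Set.Iic (c * x)) = gammaMeasure a (c * r) (Set.Iic x) := by
  have hpreimage : (fun y => c * y) ⁻¹' Set.Iic (c * x) = Set.Iic x := by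
    ext y
    exact mul_le_mul_iff_right₀ hc
  rw [gammaMeasure, gammaMeasure, withDensity_apply _ measurableSet_Iic,
    withDensity_apply _ measurableSet_Iic]
  conv_lhs => rw [← Real.smul_map_volume_mul_left hc.ne']
  rw [Measure.restrict_smul, lintegral_smul_measure, Measure.restrict_map (measurable_const_mul c)
    measurableSet_Iic, lintegral_map (measurable_gammaPDF a r) (measurable_const_mul c),
    smul_eq_mul, ← lintegral_const_mul' _ _ ENNReal.ofReal_ne_top, hpreimage]
  refine lintegral_congr fun y => ?_
  rw [gammaPDF, gammaPDF, abs_of_pos hc, ← ENNReal.ofReal_mul hc.le,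
    const_mul_gammaPDFReal_mul hr hc]

end Gamma

section StarOrder

variable {a a' r r' : ℝ}

lemma log_gammaPDFReal (ha : 0 < a) (hr : 0 < r) {x : ℝ} (hx : 0 < x) :
    Real.log (gammaPDFReal a r x) =
      Real.log (r ^ a / Real.Gamma a) + (a - 1) * Real.log x - r * x := by
  have _ := Real.Gamma_pos_of_pos ha
  rw [gammaPDFReal, if_pos hx.le, Real.log_mul (by positivity) (by positivity),
    Real.log_mul (by positivity) (by positivity), Real.log_exp, Real.log_rpow hx]
  ring

lemma strictConcaveOn_log_gammaPDFReal_sub (ha : 0 < a) (hr : 0 < r) (haa : a < a')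
    (hr' : 0 < r') :
    StrictConcaveOn ℝ (Set.Ioi 0) fun x =>
      Real.log (gammaPDFReal a' r' x) - Real.log (gammaPDFReal a r x) := by
  let affine : ℝ → ℝ := fun x =>
    (r - r') * x + (Real.log (r' ^ a' / Real.Gamma a') - Real.log (r ^ a / Real.Gamma a))
  have haffine : ConcaveOn ℝ (Set.Ioi 0) affine :=
    (((LinearMap.mul ℝ ℝ) (r - r')).concaveOn (convex_Ioi 0)).add_const _
  have hlog : StrictConcaveOn ℝ (Set.Ioi 0) fun x => (a' - a) * Real.log x := by
    refine ⟨convex_Ioi 0, fun x hx y hy hxy p q hp hq hpq => ?_⟩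
    have := mul_lt_mul_of_pos_left (strictConcaveOn_log_Ioi.2 hx hy hxy hp hq hpq) (sub_pos.2 haa)
    simp only [smul_eq_mul] at this ⊢
    linarith
  refine (haffine.add_strictConcaveOn hlog).congr fun x hx => ?_
  rw [log_gammaPDFReal (ha.trans haa) hr' hx, log_gammaPDFReal ha hr hx, Pi.add_apply]
  ring

lemma gammaMeasure_lt_of_gammaPDFReal_lt (ha : 0 < a) (hr : 0 < r) {S : Set ℝ}
    (hS : MeasurableSet S) (hvol : volume S ≠ 0)
    (hlt : ∀ x ∈ S, gammaPDFReal a r x < gammaPDFReal a' r' x) :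
    gammaMeasure a r S < gammaMeasure a' r' S := by
  have := isProbabilityMeasure_gammaMeasure ha hr
  have hne : gammaMeasure a r S ≠ ⊤ := measure_ne_top _ _
  rw [gammaMeasure, withDensity_apply _ hS] at hne ⊢
  rw [gammaMeasure, withDensity_apply _ hS]
  refine lintegral_strict_mono (by simpa [Measure.restrict_eq_zero] using hvol)
    (measurable_gammaPDF a' r').aemeasurable hne ?_
  refine (ae_restrict_iff' hS).2 (ae_of_all _ fun x hx => ?_)
  exact (ENNReal.ofReal_lt_ofReal_iff_of_nonneg (gammaPDFReal_nonneg ha hr x)).2 (hlt x hx)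

lemma exists_log_gammaPDFReal_le (ha : 0 < a) (hr : 0 < r) (ha' : 0 < a') (hr' : 0 < r')
    {S : Set ℝ} (hS : MeasurableSet S) (hpos : S ⊆ Set.Ioi 0) (hvol : volume S ≠ 0)
    (hle : gammaMeasure a r S ≤ gammaMeasure a' r' S) :
    ∃ x ∈ S, Real.log (gammaPDFReal a r x) ≤ Real.log (gammaPDFReal a' r' x) := by
  by_contra! hlt
  refine hle.not_gt (gammaMeasure_lt_of_gammaPDFReal_lt ha' hr' hS hvol fun x hx => ?_)
  exact (Real.log_lt_log_iff (gammaPDFReal_pos ha' hr' (hpos hx))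
    (gammaPDFReal_pos ha hr (hpos hx))).1 (hlt x hx)

-- Otherwise the difference of the log-densities would be nonnegative somewhere on `(0, x]` and on
-- `(y, ∞)` and nonpositive somewhere on `(x, y]`, contradicting its strict concavity.
lemma gammaMeasure_Iic_lt_of_eq (ha : 0 < a) (hr : 0 < r) (haa : a < a') (hr' : 0 < r') {x y : ℝ}
    (hx : 0 < x) (hxy : x < y) (h : gammaMeasure a' r' (Set.Iic y) = gammaMeasure a r (Set.Iic y)) :
    gammaMeasure a' r' (Set.Iic x) < gammaMeasure a r (Set.Iic x) := by
  have ha' : 0 < a' := ha.trans haa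
  have := isProbabilityMeasure_gammaMeasure ha hr
  have := isProbabilityMeasure_gammaMeasure ha' hr'
  by_contra! hle
  have hIoc : ∀ (μ : Measure ℝ) [IsProbabilityMeasure μ] {u v : ℝ}, u ≤ v →
      μ (Set.Ioc u v) = μ (Set.Iic v) - μ (Set.Iic u) := fun μ _ u v huv => by
    rw [← Set.Iic_sdiff_Iic, measure_sdiff (Set.Iic_subset_Iic.2 huv)
      measurableSet_Iic.nullMeasurableSet (measure_ne_top _ _)]
  obtain ⟨z₁, hz₁, hle₁⟩ := exists_log_gammaPDFReal_le ha hr ha' hr' (S := Set.Ioc 0 x)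
    measurableSet_Ioc (fun z hz => hz.1) (by simpa using hx) (by
      rw [hIoc _ hx.le, hIoc _ hx.le, (isPosLaw_gammaMeasure ha hr).nonpos,
        (isPosLaw_gammaMeasure ha' hr').nonpos]
      simpa using hle)
  obtain ⟨z₂, hz₂, hle₂⟩ := exists_log_gammaPDFReal_le ha' hr' ha hr (S := Set.Ioc x y)
    measurableSet_Ioc (fun z hz => hx.trans hz.1) (by simpa using hxy) (by
      rw [hIoc _ hxy.le, hIoc _ hxy.le, h]
      exact tsub_le_tsub_left hle _)
  obtain ⟨z₃, hz₃, hle₃⟩ := exists_log_gammaPDFReal_le ha hr ha' hr' (S := Set.Ioi y)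
    measurableSet_Ioi (fun z hz => (hx.trans hxy).trans hz) (by simp) (by
      rw [← Set.compl_Iic, prob_compl_eq_one_sub measurableSet_Iic,
        prob_compl_eq_one_sub measurableSet_Iic, h])
  have h₁₂ : z₁ < z₂ := hz₁.2.trans_lt hz₂.1
  have h₂₃ : z₂ < z₃ := hz₂.2.trans_lt hz₃
  have hmin := (strictConcaveOn_log_gammaPDFReal_sub ha hr haa hr').lt_on_openSegment
    (Set.mem_Ioi.2 hz₁.1) (Set.mem_Ioi.2 ((hx.trans hxy).trans hz₃)) (h₁₂.trans h₂₃).ne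
    (by rw [openSegment_eq_Ioo (h₁₂.trans h₂₃)]; exact ⟨h₁₂, h₂₃⟩)
  exact absurd ((le_min (sub_nonneg.2 hle₁) (sub_nonneg.2 hle₃)).trans_lt hmin)
    (sub_nonpos.2 hle₂).not_gt

lemma transport_gammaMeasure_div_lt (ha : 0 < a) (hr : 0 < r) (haa : a < a') (hr' : 0 < r')
    {x y : ℝ} (hx : 0 < x) (hxy : x < y) :
    transport (gammaMeasure a r) (gammaMeasure a' r') y / y <
      transport (gammaMeasure a r) (gammaMeasure a' r') x / x := by
  have hμ := isPosLaw_gammaMeasure ha hr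
  have hν := isPosLaw_gammaMeasure (ha.trans haa) hr'
  have hy := hx.trans hxy
  obtain ⟨hψy, hIic_y⟩ := transport_spec hμ hν hy
  have hIic_x := measure_Iic_transport hμ hν hx
  set ψ := transport (gammaMeasure a r) (gammaMeasure a' r')
  have hc : 0 < ψ y / y := div_pos hψy hy
  rw [← div_mul_cancel₀ (ψ y) hy.ne', gammaMeasure_Iic_mul hr' hc] at hIic_y
  have hlt := gammaMeasure_Iic_lt_of_eq ha hr haa (mul_pos hc hr') hx hxy hIic_y
  rw [← gammaMeasure_Iic_mul hr' hc, ← hIic_x] at hlt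
  exact (lt_div_iff₀ hx).2 (lt_of_measure_Iic_lt hlt)

end StarOrder

section Concentration

variable {a r : ℝ}

lemma lintegral_id_gammaMeasure (ha : 0 < a) (hr : 0 < r) :
    ∫⁻ x, ENNReal.ofReal x ∂(gammaMeasure a r) = ENNReal.ofReal (a / r) := by
  have hΓ := (Real.Gamma_pos_of_pos ha).ne'
  have hmoment : gammaMoment a r 1 = a / r := by
    rw [gammaMoment, Real.Gamma_add_one ha.ne', Real.rpow_one, mul_comm,
      mul_div_mul_left _ _ hΓ]
  simpa [hmoment] using lintegral_rpow_gammaMeasure ha hr (s := 1) (by positivity)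

lemma lintegral_sq_gammaMeasure (ha : 0 < a) (hr : 0 < r) :
    ∫⁻ x, ENNReal.ofReal (x ^ 2) ∂(gammaMeasure a r) = ENNReal.ofReal (a * (a + 1) / r ^ 2) := by
  have hΓ := (Real.Gamma_pos_of_pos ha).ne'
  have hmoment : gammaMoment a r 2 = a * (a + 1) / r ^ 2 := by
    rw [gammaMoment, ← one_add_one_eq_two, ← add_assoc, Real.Gamma_add_one (by positivity),
      Real.Gamma_add_one ha.ne', one_add_one_eq_two, Real.rpow_two]
    field_simp
  simpa [hmoment] using lintegral_rpow_gammaMeasure ha hr (s := 2) (by positivity)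

lemma lintegral_sub_one_sq_gammaMeasure (ha : 0 < a) (hr : 0 < r) :
    ∫⁻ x, ENNReal.ofReal ((x - 1) ^ 2) ∂(gammaMeasure a r) =
      ENNReal.ofReal (a * (a + 1) / r ^ 2 + 1 - 2 * (a / r)) := by
  have := isProbabilityMeasure_gammaMeasure ha hr
  have hexpand :
      ∫⁻ x, (ENNReal.ofReal ((x - 1) ^ 2) + ENNReal.ofReal 2 * ENNReal.ofReal x)
        ∂(gammaMeasure a r) = ∫⁻ x, (ENNReal.ofReal (x ^ 2) + 1) ∂(gammaMeasure a r) := by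
    refine lintegral_congr_ae ((ae_pos_gammaMeasure ha hr).mono fun x hx => ?_)
    beta_reduce
    rw [← ENNReal.ofReal_one, ← ENNReal.ofReal_mul zero_le_two,
      ← ENNReal.ofReal_add (by positivity) (by positivity),
      ← ENNReal.ofReal_add (by positivity) zero_le_one]
    ring_nf
  rw [lintegral_add_left (by fun_prop), lintegral_add_right _ measurable_const,
    lintegral_const_mul' _ _ ENNReal.ofReal_ne_top, lintegral_id_gammaMeasure ha hr,
    lintegral_sq_gammaMeasure ha hr, lintegral_const, measure_univ, one_mul, ← ENNReal.ofReal_one,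
    ← ENNReal.ofReal_mul zero_le_two, ← ENNReal.ofReal_add (by positivity) zero_le_one] at hexpand
  rw [ENNReal.ofReal_sub _ (by positivity)]
  exact ENNReal.eq_sub_of_add_eq ENNReal.ofReal_ne_top hexpand

lemma tendsto_lintegral_sub_one_sq {δ : ℝ} (hδ : 0 < δ) :
    Tendsto (fun k : ℝ => ∫⁻ x, ENNReal.ofReal ((x - 1) ^ 2) ∂(gammaMeasure (k + δ) k)) atTop
      (𝓝 0) := by
  have hlim : Tendsto (fun k : ℝ => (δ ^ 2 + δ) * (k⁻¹ * k⁻¹) + k⁻¹) atTop (𝓝 0) := by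
    simpa using ((tendsto_inv_atTop_zero.mul tendsto_inv_atTop_zero).const_mul (δ ^ 2 + δ)).add
      tendsto_inv_atTop_zero
  rw [← ENNReal.ofReal_zero]
  refine (ENNReal.tendsto_ofReal hlim).congr' ?_
  filter_upwards [eventually_gt_atTop 0] with k hk
  rw [lintegral_sub_one_sq_gammaMeasure (by positivity) hk]
  congr 1
  field_simp
  ring

lemma tendsto_gammaMeasure_of_far {δ ε : ℝ} (hδ : 0 < δ) (hε : 0 < ε) {S : Set ℝ}
    (hS : ∀ x ∈ S, ε ^ 2 ≤ (x - 1) ^ 2) :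
    Tendsto (fun k : ℝ => gammaMeasure (k + δ) k S) atTop (𝓝 0) := by
  have hε2 : ENNReal.ofReal (ε ^ 2) ≠ 0 := (ENNReal.ofReal_pos.2 (by positivity)).ne'
  have hbound := ENNReal.Tendsto.div_const (tendsto_lintegral_sub_one_sq hδ) (Or.inr hε2)
  rw [ENNReal.zero_div] at hbound
  refine tendsto_of_tendsto_of_tendsto_of_le_of_le tendsto_const_nhds hbound (fun _ => zero_le)
    fun k => (measure_mono fun x hx => ?_).trans (meas_ge_le_lintegral_div
      (f := fun x : ℝ => ENNReal.ofReal ((x - 1) ^ 2)) (by fun_prop) hε2 ENNReal.ofReal_ne_top)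
  exact ENNReal.ofReal_le_ofReal (hS x hx)

lemma tendsto_transport_gammaMeasure {μ : Measure ℝ} (hμ : IsPosLaw μ) {δ : ℝ} (hδ : 0 < δ)
    {v : ℝ} (hv : 0 < v) :
    Tendsto (fun k : ℝ => transport μ (gammaMeasure (k + δ) k) v) atTop (𝓝 1) := by
  refine tendsto_transport hμ ?_
    (fun ε hε => tendsto_gammaMeasure_of_far hδ hε fun x (hx : x ≤ _) => by nlinarith)
    (fun ε hε => tendsto_gammaMeasure_of_far hδ hε fun x (hx : _ < x) => by nlinarith) hv
  filter_upwards [eventually_gt_atTop 0] with k hk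
  exact isPosLaw_gammaMeasure (by positivity) hk

end Concentration

/-! ### Received powers -/

section Power

/-- The power received at the origin from a marked point, that is, from a base station at `z.1`
with gain `z.2`. -/
def power (α : ℝ) (z : Plane × ℝ) : ℝ≥0∞ := ENNReal.ofReal z.2 * ENNReal.ofReal ‖z.1‖ ^ (-α)

lemma measurable_power (α : ℝ) : Measurable (power α) := by
  unfold power
  fun_prop

variable {α : ℝ}

lemma power_of_pos {x : Plane} (hx : 0 < ‖x‖) {y : ℝ} (hy : 0 ≤ y) :
    power α (x, y) = ENNReal.ofReal (y * ‖x‖ ^ (-α)) := by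
  rw [power, ENNReal.ofReal_rpow_of_pos hx, ENNReal.ofReal_mul hy]

lemma power_ne_top {z : Plane × ℝ} (hz : 0 < ‖z.1‖) : power α z ≠ ⊤ := by
  rw [power, ENNReal.ofReal_rpow_of_pos hz]
  exact ENNReal.mul_ne_top ENNReal.ofReal_ne_top ENNReal.ofReal_ne_top

lemma ofReal_mul_power {s : ℝ} (hs : 0 ≤ s) (x : Plane) (y : ℝ) :
    ENNReal.ofReal s * power α (x, y) = power α (x, s * y) := by
  rw [power, power, ENNReal.ofReal_mul hs, mul_assoc]

lemma lintegral_one_sub_expNeg_eq_lintegral_meas_lt {E : Type*} [MeasurableSpace E]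
    {μ : Measure E} {f : E → ℝ} (hf : Measurable f) (hf0 : ∀ x, 0 ≤ f x) :
    ∫⁻ x, (1 - expNeg (ENNReal.ofReal (f x))) ∂μ =
      ∫⁻ t in Set.Ioi 0, μ {x | t < f x} * ENNReal.ofReal (Real.exp (-t)) := by
  have hprim : ∀ x, 1 - expNeg (ENNReal.ofReal (f x)) =
      ENNReal.ofReal (∫ t in (0)..(f x), Real.exp (-t)) := fun x => by
    rw [expNeg_ofReal (hf0 x), ← ENNReal.ofReal_one, ← ENNReal.ofReal_sub _ (Real.exp_pos _).le,
      intervalIntegral.integral_comp_neg fun t => Real.exp t, integral_exp, neg_zero, Real.exp_zero]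
  simp_rw [hprim]
  exact lintegral_comp_eq_lintegral_meas_lt_mul μ (ae_of_all _ hf0) hf.aemeasurable
    (fun t _ => (by fun_prop : Continuous fun t : ℝ => Real.exp (-t)).intervalIntegrable _ _)
    (ae_of_all _ fun t => (Real.exp_pos _).le)

lemma volume_lt_mul_norm_rpow_neg (hα : 0 < α) {y t : ℝ} (hy : 0 ≤ y) (ht : 0 < t) :
    volume {x : Plane | t < y * ‖x‖ ^ (-α)} = ENNReal.ofReal (Real.pi * (y / t) ^ (2 / α)) := by
  have hball : {x : Plane | t < y * ‖x‖ ^ (-α)} = Metric.ball 0 ((y / t) ^ α⁻¹) \ {0} := by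
    ext x
    simp only [Set.mem_ofPred_eq, Set.mem_sdiff, mem_ball_zero_iff, Set.mem_singleton_iff]
    rcases eq_or_ne x 0 with rfl | hx
    · simp [Real.zero_rpow (neg_ne_zero.2 hα.ne'), ht.le]
    · have hnorm := norm_pos_iff.2 hx
      rw [Real.lt_rpow_inv_iff_of_pos hnorm.le (by positivity) hα, Real.rpow_neg hnorm.le,
        ← div_eq_mul_inv, lt_div_iff₀ (by positivity), lt_div_iff₀ ht, mul_comm]
      exact (and_iff_left hx).symm
  have hpow : ((y / t) ^ α⁻¹) ^ 2 = (y / t) ^ (2 / α) := by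
    rw [← Real.rpow_mul_natCast (by positivity), Nat.cast_ofNat, inv_mul_eq_div]
  rw [hball, measure_sdiff_null (measure_singleton _), EuclideanSpace.volume_ball_fin_two,
    ← ENNReal.ofReal_pow (by positivity), hpow, ← ENNReal.ofReal_mul (by positivity), mul_comm]

lemma lintegral_one_sub_expNeg_pathloss (hα : 2 < α) {y : ℝ} (hy : 0 ≤ y) :
    ∫⁻ x : Plane, (1 - expNeg (power α (x, y))) =
      ENNReal.ofReal (Real.pi * Real.Gamma (1 - 2 / α) * y ^ (2 / α)) := by
  have hα0 : 0 < α := by linarith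
  have hδ : 0 < 1 - 2 / α := sub_pos.2 ((div_lt_one hα0).2 hα)
  have hreal : ∫⁻ x : Plane, (1 - expNeg (power α (x, y))) =
      ∫⁻ x : Plane, (1 - expNeg (ENNReal.ofReal (y * ‖x‖ ^ (-α)))) := by
    have hne : ∀ᵐ x : Plane, x ≠ 0 := by simp [ae_iff]
    exact lintegral_congr_ae (hne.mono fun x hx => by
      beta_reduce
      rw [power_of_pos (norm_pos_iff.2 hx) hy])
  have htail : ∀ t ∈ Set.Ioi (0 : ℝ),
      volume {x : Plane | t < y * ‖x‖ ^ (-α)} * ENNReal.ofReal (Real.exp (-t)) =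
      ENNReal.ofReal (Real.pi * y ^ (2 / α)) *
        ENNReal.ofReal (Real.exp (-t) * t ^ ((1 - 2 / α) - 1)) := fun t (ht : 0 < t) => by
    rw [volume_lt_mul_norm_rpow_neg hα0 hy ht, ← ENNReal.ofReal_mul (by positivity),
      ← ENNReal.ofReal_mul (by positivity), Real.div_rpow hy ht.le, sub_sub_cancel_left,
      Real.rpow_neg ht.le]
    congr 1
    ring
  rw [hreal, lintegral_one_sub_expNeg_eq_lintegral_meas_lt (by fun_prop) fun x => by positivity,
    setLIntegral_congr_fun measurableSet_Ioi htail, lintegral_const_mul' _ _ ENNReal.ofReal_ne_top,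
    ← ofReal_integral_eq_lintegral_ofReal (Real.GammaIntegral_convergent hδ),
    ← Real.Gamma_eq_integral hδ, ← ENNReal.ofReal_mul (by positivity), mul_right_comm]
  refine (ae_restrict_iff' measurableSet_Ioi).2 (ae_of_all _ fun t (ht : 0 < t) => ?_)
  exact mul_nonneg (Real.exp_pos _).le (Real.rpow_nonneg ht.le _)

end Power

/-- The intensity of the marked process of density `lam` with mark law `F`. -/
def intensity (lam : ℝ≥0) (F : Measure ℝ) : Measure (Plane × ℝ) :=
  (lam • volume : Measure Plane).prod F

/-- A law of positive power gains with finite moment of order `2 / α`, which makes the total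
received power almost surely finite. -/
structure IsFading (α : ℝ) (F : Measure ℝ) : Prop where
  isProb : IsProbabilityMeasure F
  pos : ∀ᵐ x ∂F, 0 < x
  moment : ∫⁻ x, ENNReal.ofReal (x ^ (2 / α)) ∂F ≠ ⊤

lemma isFading_gammaMeasure {α a r : ℝ} (hα : 0 < α) (ha : 0 < a) (hr : 0 < r) :
    IsFading α (gammaMeasure a r) where
  isProb := isProbabilityMeasure_gammaMeasure ha hr
  pos := ae_pos_gammaMeasure ha hr
  moment := by
    rw [lintegral_rpow_gammaMeasure ha hr (by positivity)]
    exact ENNReal.ofReal_ne_top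

section Intensity

variable {α : ℝ} {lam : ℝ≥0} {F : Measure ℝ}

lemma lintegral_intensity [SFinite F] {f : Plane × ℝ → ℝ≥0∞} (hf : Measurable f) :
    ∫⁻ z, f z ∂(intensity lam F) = ∫⁻ y, (lam * ∫⁻ x : Plane, f (x, y)) ∂F := by
  rw [intensity, lintegral_prod_symm' _ hf]
  exact lintegral_congr fun y => lintegral_smul_measure _ _

lemma ae_intensity_snd {p : ℝ → Prop} (h : ∀ᵐ y ∂F, p y) :
    ∀ᵐ z ∂(intensity lam F), p z.2 :=
  (Measure.quasiMeasurePreserving_snd (μ := (lam • volume : Measure Plane)) (ν := F)).ae h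

lemma ae_intensity_fst {p : Plane → Prop} (h : ∀ᵐ x : Plane, p x) :
    ∀ᵐ z ∂(intensity lam F), p z.1 :=
  (Measure.quasiMeasurePreserving_fst (μ := (lam • volume : Measure Plane)) (ν := F)).ae
    (Measure.ae_smul_measure h lam)

lemma intensity_fst_preimage [IsProbabilityMeasure F] (A : Set Plane) :
    intensity lam F (Prod.fst ⁻¹' A) = lam * volume A := by
  rw [← Set.prod_univ, intensity, Measure.prod_prod, measure_univ, mul_one]
  rfl

lemma lintegral_one_sub_expNeg_power (hα : 2 < α) (hF : IsFading α F) {s : ℝ} (hs : 0 ≤ s) :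
    ∫⁻ z, (1 - expNeg (ENNReal.ofReal s * power α z)) ∂(intensity lam F) =
      ENNReal.ofReal (lam * (Real.pi * Real.Gamma (1 - 2 / α)) * s ^ (2 / α)) *
        ∫⁻ y, ENNReal.ofReal (y ^ (2 / α)) ∂F := by
  have := hF.isProb
  have hδ : 0 < 1 - 2 / α := sub_pos.2 ((div_lt_one (by linarith)).2 hα)
  have _ : 0 < Real.Gamma (1 - 2 / α) := Real.Gamma_pos_of_pos hδ
  rw [lintegral_intensity (continuous_one_sub_expNeg.measurable.fun_comp
    ((measurable_power α).const_mul _)), ← lintegral_const_mul' _ _ ENNReal.ofReal_ne_top]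
  refine lintegral_congr_ae (hF.pos.mono fun y hy => ?_)
  simp_rw [ofReal_mul_power hs]
  rw [lintegral_one_sub_expNeg_pathloss hα (mul_nonneg hs hy.le), Real.mul_rpow hs hy.le,
    ← ENNReal.ofReal_coe_nnreal, ← ENNReal.ofReal_mul lam.coe_nonneg,
    ← ENNReal.ofReal_mul (by positivity)]
  congr 1
  ring

lemma volume_annulus {c : ℝ} (hc : 0 < c) {a b : ℝ} (ha : 0 ≤ a) (hab : a ≤ b) :
    volume {x : Plane | c * ‖x‖ ^ 2 ∈ Set.Ico a b} = ENNReal.ofReal (Real.pi / c * (b - a)) := by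
  have hmem : ∀ t : ℝ, ∀ x : Plane, x ∈ Metric.ball 0 (√(t / c)) ↔ c * ‖x‖ ^ 2 < t := fun t x => by
    rw [mem_ball_zero_iff, Real.lt_sqrt (norm_nonneg x), lt_div_iff₀ hc, mul_comm]
  have hvolume : ∀ t : ℝ, 0 ≤ t → volume (Metric.ball (0 : Plane) (√(t / c))) =
      ENNReal.ofReal (Real.pi / c * t) := fun t ht => by
    rw [EuclideanSpace.volume_ball_fin_two, ← ENNReal.ofReal_pow (by positivity),
      Real.sq_sqrt (by positivity), ← ENNReal.ofReal_mul (by positivity)]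
    congr 1
    ring
  have hset : {x : Plane | c * ‖x‖ ^ 2 ∈ Set.Ico a b} =
      Metric.ball 0 (√(b / c)) \ Metric.ball 0 (√(a / c)) := by
    ext x
    rw [Set.mem_sdiff, hmem, hmem, not_lt]
    exact and_comm
  rw [hset, measure_sdiff (Metric.ball_subset_ball (Real.sqrt_le_sqrt (by gcongr)))
    Metric.isOpen_ball.measurableSet.nullMeasurableSet measure_ball_lt_top.ne,
    hvolume b (ha.trans hab), hvolume a ha, ← ENNReal.ofReal_sub _ (by positivity), mul_sub]

-- In the area coordinate `π lam ‖x‖²` the points have Lebesgue intensity.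
lemma intensity_area [IsProbabilityMeasure F] (hlam : 0 < lam) {a b : ℝ} (ha : 0 ≤ a)
    (hab : a ≤ b) :
    intensity lam F ((fun z => Real.pi * lam * ‖z.1‖ ^ 2) ⁻¹' Set.Ico a b) =
      ENNReal.ofReal (b - a) := by
  have _ : (0 : ℝ) < lam := hlam
  refine (intensity_fst_preimage {x : Plane | Real.pi * lam * ‖x‖ ^ 2 ∈ Set.Ico a b}).trans ?_
  rw [volume_annulus (by positivity) ha hab, ← ENNReal.ofReal_coe_nnreal,
    ← ENNReal.ofReal_mul lam.coe_nonneg]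
  congr 1
  field_simp

/-- Marked configurations of generic type: positive distances and gains, finite total power,
finitely many points in every disc, no two points at the same distance. -/
structure IsGood (α : ℝ) (z : ℕ → Plane × ℝ) : Prop where
  norm_pos : ∀ i, 0 < ‖(z i).1‖
  gain_pos : ∀ i, 0 < (z i).2
  total_ne_top : ∑' i, power α (z i) ≠ ⊤
  finite : ∀ R : ℝ, {i | ‖(z i).1‖ ≤ R}.Finite
  norm_ne : ∀ i j, i ≠ j → ‖(z i).1‖ ≠ ‖(z j).1‖

namespace IsPoisson

variable {Ω : Type*} [MeasurableSpace Ω] {P : Measure Ω} [IsProbabilityMeasure P]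
  {Z : ℕ → Ω → Plane × ℝ}

lemma ae_norm_pos (hZ : IsPoisson P Z (intensity lam F)) :
    ∀ᵐ ω ∂P, ∀ i, 0 < ‖(Z i ω).1‖ :=
  hZ.ae_forall (p := fun z => 0 < ‖z.1‖)
    (ae_intensity_fst (p := fun x => 0 < ‖x‖) (by simp [ae_iff]))

lemma ae_tsum_power_ne_top (hα : 2 < α) (hF : IsFading α F)
    (hZ : IsPoisson P Z (intensity lam F)) : ∀ᵐ ω ∂P, ∑' i, power α (Z i ω) ≠ ⊤ := by
  have := hF.isProb
  let offOrigin : Set (Plane × ℝ) := {z | z.1 ≠ 0}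
  have hmeas : MeasurableSet offOrigin := (measurable_fst (measurableSet_singleton 0)).compl
  have hexponent : ∫⁻ z, (1 - expNeg (offOrigin.indicator (power α) z)) ∂(intensity lam F) ≠ ⊤ := by
    have hle : ∀ z, offOrigin.indicator (power α) z ≤ ENNReal.ofReal 1 * power α z := fun z => by
      rw [ENNReal.ofReal_one, one_mul]
      exact Set.indicator_le_self _ _ z
    refine ne_top_of_le_ne_top ?_ (lintegral_mono fun z => one_sub_expNeg_mono (hle z))
    rw [lintegral_one_sub_expNeg_power hα hF zero_le_one]
    exact ENNReal.mul_ne_top ENNReal.ofReal_ne_top hF.moment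
  have hsum := hZ.ae_tsum_ne_top ((measurable_power α).indicator hmeas) (fun z => by
    by_cases hz : z ∈ offOrigin
    · simpa [hz] using power_ne_top (norm_pos_iff.2 hz)
    · simp [hz]) hexponent
  filter_upwards [hsum, hZ.ae_norm_pos] with ω hω hnorm
  refine ne_of_eq_of_ne (tsum_congr fun i => ?_) hω
  rw [Set.indicator_of_mem (show Z i ω ∈ offOrigin from norm_pos_iff.1 (hnorm i))]

lemma ae_finite_norm_le [IsProbabilityMeasure F] (hZ : IsPoisson P Z (intensity lam F)) :
    ∀ᵐ ω ∂P, ∀ R : ℝ, {i | ‖(Z i ω).1‖ ≤ R}.Finite := by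
  have hdisc : ∀ᵐ ω ∂P, ∀ n : ℕ,
      {i | Z i ω ∈ Prod.fst ⁻¹' Metric.closedBall (0 : Plane) n}.Finite := by
    refine ae_all_iff.2 fun n =>
      hZ.ae_finite (measurable_fst Metric.isClosed_closedBall.measurableSet) ?_
    rw [intensity_fst_preimage]
    exact ENNReal.mul_ne_top ENNReal.coe_ne_top measure_closedBall_lt_top.ne
  filter_upwards [hdisc] with ω hω R
  obtain ⟨n, hn⟩ := exists_nat_ge R
  exact (hω n).subset fun i (hi : _ ≤ R) => mem_closedBall_zero_iff.2 (hi.trans hn)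

lemma ae_norm_ne [IsProbabilityMeasure F] (hlam : 0 < lam)
    (hZ : IsPoisson P Z (intensity lam F)) :
    ∀ᵐ ω ∂P, ∀ i j, i ≠ j → ‖(Z i ω).1‖ ≠ ‖(Z j ω).1‖ := by
  filter_upwards [hZ.ae_injective (r := fun z => Real.pi * lam * ‖z.1‖ ^ 2) (by fun_prop)
    (fun z => by positivity) fun a b => intensity_area hlam] with ω hω i j hij hnorm
  exact hω i j hij (by rw [hnorm])

lemma ae_isGood (hα : 2 < α) (hlam : 0 < lam) (hF : IsFading α F)
    (hZ : IsPoisson P Z (intensity lam F)) : ∀ᵐ ω ∂P, IsGood α fun i => Z i ω := by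
  have := hF.isProb
  filter_upwards [hZ.ae_norm_pos, hZ.ae_forall (p := fun z => 0 < z.2) (ae_intensity_snd hF.pos),
    hZ.ae_tsum_power_ne_top hα hF, hZ.ae_finite_norm_le, hZ.ae_norm_ne hlam]
    with ω hnorm hgain htotal hfinite hne
  exact ⟨hnorm, hgain, htotal, hfinite, hne⟩

end IsPoisson

end Intensity

/-! ### Coverage as a property of the marked configuration -/

/-- The total power received from a marked configuration. -/
def total (α : ℝ) (z : ℕ → Plane × ℝ) : ℝ≥0∞ := ∑' i, power α (z i)

/-- The `i`-th point carries more than the fraction `θ / (1 + θ)` of the total power, which says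
that its signal-to-interference ratio exceeds `θ`. -/
def IsCovering (α θ : ℝ) (z : ℕ → Plane × ℝ) (i : ℕ) : Prop :=
  ENNReal.ofReal θ * total α z < ENNReal.ofReal (1 + θ) * power α (z i)

/-- Some covering point is closer than all the points that are not covering; as long as a closest
point exists, this says that it covers. -/
def ClosestCovers (α θ : ℝ) (z : ℕ → Plane × ℝ) : Prop :=
  ∃ i, IsCovering α θ z i ∧ ∀ j, ¬IsCovering α θ z j → ‖(z i).1‖ < ‖(z j).1‖

section Configuration

variable {α θ : ℝ} {z : ℕ → Plane × ℝ}

lemma IsGood.power_pos (h : IsGood α z) (i : ℕ) : 0 < power α (z i) := by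
  have _ := h.norm_pos i
  have _ := h.gain_pos i
  rw [power, ENNReal.ofReal_rpow_of_pos (h.norm_pos i), ← ENNReal.ofReal_mul (h.gain_pos i).le]
  positivity

lemma IsGood.finite_le_power (h : IsGood α z) {ε : ℝ≥0∞} (hε : ε ≠ 0) :
    {i | ε ≤ power α (z i)}.Finite :=
  ENNReal.finite_const_le_of_tsum_ne_top h.total_ne_top hε

lemma power_add_tsum_ne (α : ℝ) (z : ℕ → Plane × ℝ) (i : ℕ) :
    power α (z i) + ∑' j : {j : ℕ // j ≠ i}, power α (z j) = total α z := by
  rw [← tsum_singleton i fun j => power α (z j)]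
  exact ENNReal.summable.tsum_add_tsum_compl (f := fun j => power α (z j)) ENNReal.summable

section Sir

variable {Ω : Type*} {X : ℕ → Ω → Plane} {g : ℕ → Ω → ℝ} {ω : Ω}

lemma interference_eq_total_sub (i : ℕ) (h : IsGood α fun i => (X i ω, g i ω)) :
    interference α X g i ω = total α (fun i => (X i ω, g i ω)) - power α (X i ω, g i ω) :=
  ENNReal.eq_sub_of_add_eq (power_ne_top (h.norm_pos i)) <|
    (add_comm _ _).trans (power_add_tsum_ne α (fun i => (X i ω, g i ω)) i)

lemma interference_pos (i : ℕ) (h : IsGood α fun i => (X i ω, g i ω)) :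
    0 < interference α X g i ω :=
  (h.power_pos (i + 1)).trans_le <|
    ENNReal.le_tsum (f := fun j : {j : ℕ // j ≠ i} => rxPower α X g j ω)
      ⟨i + 1, Nat.succ_ne_self i⟩

lemma interference_ne_top (i : ℕ) (h : IsGood α fun i => (X i ω, g i ω)) :
    interference α X g i ω ≠ ⊤ := by
  rw [interference_eq_total_sub i h]
  exact ne_top_of_le_ne_top h.total_ne_top tsub_le_self

lemma lt_sir_iff (hθ : 0 ≤ θ) (i : ℕ) (h : IsGood α fun i => (X i ω, g i ω)) :
    ENNReal.ofReal θ < sir α X g i ω ↔ IsCovering α θ (fun i => (X i ω, g i ω)) i := by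
  have hpower : rxPower α X g i ω = power α (X i ω, g i ω) := rfl
  have hadd : power α (X i ω, g i ω) + interference α X g i ω = total α fun i => (X i ω, g i ω) :=
    power_add_tsum_ne α (fun i => (X i ω, g i ω)) i
  rw [sir, ENNReal.lt_div_iff_mul_lt (Or.inl (interference_pos i h).ne')
    (Or.inl (interference_ne_top i h)), IsCovering, ← hadd, mul_add,
    ENNReal.ofReal_add zero_le_one hθ, ENNReal.ofReal_one, add_mul, one_mul, hpower,
    add_comm (power α _), ENNReal.add_lt_add_iff_left
      (ENNReal.mul_ne_top ENNReal.ofReal_ne_top (power_ne_top (h.norm_pos i)))]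

lemma sir_le_sir (i j : ℕ) (h : IsGood α fun i => (X i ω, g i ω))
    (hij : power α (X i ω, g i ω) ≤ power α (X j ω, g j ω)) :
    sir α X g i ω ≤ sir α X g j ω := by
  rw [sir, sir]
  refine ENNReal.div_le_div hij ?_
  rw [interference_eq_total_sub i h, interference_eq_total_sub j h]
  exact tsub_le_tsub_left hij _

lemma exists_lt_sir_closest_iff (hθ : 0 ≤ θ) (h : IsGood α fun i => (X i ω, g i ω)) :
    (∃ i, (∀ j, ‖X i ω‖ ≤ ‖X j ω‖) ∧ ENNReal.ofReal θ < sir α X g i ω) ↔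
      ClosestCovers α θ fun i => (X i ω, g i ω) := by
  constructor
  · rintro ⟨i, hclosest, hsir⟩
    rw [lt_sir_iff hθ i h] at hsir
    refine ⟨i, hsir, fun j hj => lt_of_le_of_ne (hclosest j) (h.norm_ne i j ?_)⟩
    rintro rfl
    exact hj hsir
  · rintro ⟨i, -, hlt⟩
    obtain ⟨k, hki, hmin⟩ := Set.exists_min_image _ (fun j => ‖X j ω‖) (h.finite ‖X i ω‖)
      ⟨i, le_refl ‖X i ω‖⟩
    have hclosest : ∀ j, ‖X k ω‖ ≤ ‖X j ω‖ := fun j =>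
      (le_or_gt ‖X j ω‖ ‖X i ω‖).elim (hmin j) fun hij => le_trans hki hij.le
    refine ⟨k, hclosest, (lt_sir_iff hθ k h).2 ?_⟩
    by_contra hk
    exact absurd (hclosest i) (not_le.2 (hlt k hk))

lemma exists_lt_sir_strongest_iff (hθ : 0 ≤ θ) (h : IsGood α fun i => (X i ω, g i ω)) :
    (∃ i, (∀ j, sir α X g j ω ≤ sir α X g i ω) ∧ ENNReal.ofReal θ < sir α X g i ω) ↔
      ∃ i, IsCovering α θ (fun i => (X i ω, g i ω)) i := by
  constructor
  · rintro ⟨i, -, hsir⟩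
    exact ⟨i, (lt_sir_iff hθ i h).1 hsir⟩
  · rintro ⟨i, hi⟩
    obtain ⟨k, hik, hmax⟩ := Set.exists_max_image _ (fun j => power α (X j ω, g j ω))
      (h.finite_le_power (h.power_pos i).ne') ⟨i, le_refl (power α (X i ω, g i ω))⟩
    have hstrongest : ∀ j, power α (X j ω, g j ω) ≤ power α (X k ω, g k ω) := fun j =>
      (le_or_gt (power α (X i ω, g i ω)) _).elim (hmax j) fun hji => hji.le.trans hik
    exact ⟨k, fun j => sir_le_sir j k h (hstrongest j),
      (lt_sir_iff hθ k h).2 (hi.trans_le (mul_le_mul_right (hstrongest i) _))⟩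

end Sir

end Configuration

/-! ### The law of the coverage event -/

section Separation

variable {α θ : ℝ} {z : ℕ → Plane × ℝ}

/-- The points nearer than `a` that would be covering if the total power were `r`. -/
def innerStrong (α θ a r : ℝ) : Set (Plane × ℝ) :=
  {p | ENNReal.ofReal θ * ENNReal.ofReal r < ENNReal.ofReal (1 + θ) * power α p ∧ ‖p.1‖ < a}

/-- The points up to distance `a` that would not be covering if the total power were `r`. -/
def innerWeak (α θ a r : ℝ) : Set (Plane × ℝ) :=
  {p | ENNReal.ofReal (1 + θ) * power α p ≤ ENNReal.ofReal θ * ENNReal.ofReal r ∧ ‖p.1‖ ≤ a}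

lemma measurableSet_innerStrong (α θ a r : ℝ) : MeasurableSet (innerStrong α θ a r) :=
  (measurableSet_lt measurable_const ((measurable_power α).const_mul _)).inter
    (measurableSet_lt measurable_fst.norm measurable_const)

lemma measurableSet_innerWeak (α θ a r : ℝ) : MeasurableSet (innerWeak α θ a r) :=
  (measurableSet_le ((measurable_power α).const_mul _) measurable_const).inter
    (measurableSet_le measurable_fst.norm measurable_const)

lemma exists_rat_of_eventually_nhdsGT {t : ℝ} {p : ℝ → Prop} (h : ∀ᶠ x in 𝓝[>] t, p x) :
    ∃ q : ℚ, t < q ∧ p q := by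
  obtain ⟨b, htb, hsub⟩ := mem_nhdsGT_iff_exists_Ioo_subset.1 h
  obtain ⟨q, htq, hqb⟩ := exists_rat_btwn (show t < b from htb)
  exact ⟨q, htq, hsub ⟨htq, hqb⟩⟩

lemma IsGood.exists_rat_norm_lt (h : IsGood α z) {i : ℕ}
    (hi : ∀ j, ¬IsCovering α θ z j → ‖(z i).1‖ < ‖(z j).1‖) :
    ∃ a : ℚ, ‖(z i).1‖ < a ∧ ∀ j, ‖(z j).1‖ ≤ a → IsCovering α θ z j := by
  have hsep : ∀ᶠ a in 𝓝 ‖(z i).1‖, a < ‖(z i).1‖ + 1 ∧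
      ∀ j ∈ {j | ‖(z j).1‖ ≤ ‖(z i).1‖ + 1}, ¬IsCovering α θ z j → a < ‖(z j).1‖ :=
    (eventually_lt_nhds (lt_add_one _)).and <| (Set.Finite.eventually_all (h.finite _)).2
      fun j _ => eventually_imp_distrib_left.2 fun hj => eventually_lt_nhds (hi j hj)
  obtain ⟨a, hia, ha, hweak⟩ :=
    exists_rat_of_eventually_nhdsGT (eventually_nhdsWithin_of_eventually_nhds hsep)
  exact ⟨a, hia, fun j hj => by_contra fun hcov => hj.not_gt (hweak j (hj.trans ha.le) hcov)⟩

lemma IsGood.exists_rat_total_lt (h : IsGood α z) {S : Set ℕ} (hS : S.Finite)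
    (hcov : ∀ j ∈ S, IsCovering α θ z j) :
    ∃ r : ℚ, total α z < ENNReal.ofReal r ∧
      ∀ j ∈ S, ENNReal.ofReal θ * ENNReal.ofReal r < ENNReal.ofReal (1 + θ) * power α (z j) := by
  have htotal : ENNReal.ofReal (total α z).toReal = total α z :=
    ENNReal.ofReal_toReal h.total_ne_top
  have hcont : Continuous fun r : ℝ => ENNReal.ofReal θ * ENNReal.ofReal r :=
    (ENNReal.continuous_const_mul ENNReal.ofReal_ne_top).comp ENNReal.continuous_ofReal
  have hstrong : ∀ᶠ r in 𝓝 (total α z).toReal, ∀ j ∈ S,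
      ENNReal.ofReal θ * ENNReal.ofReal r < ENNReal.ofReal (1 + θ) * power α (z j) :=
    (Set.Finite.eventually_all hS).2 fun j hj =>
      (hcont.tendsto _).eventually (eventually_lt_nhds (htotal.symm ▸ hcov j hj))
  obtain ⟨r, htr, hr⟩ :=
    exists_rat_of_eventually_nhdsGT (eventually_nhdsWithin_of_eventually_nhds hstrong)
  exact ⟨r, (ENNReal.lt_ofReal_iff_toReal_lt h.total_ne_top).2 htr, hr⟩

-- Only countably many counts and the total power are involved, so the probability of this event
-- is determined by the joint law of such functionals.
lemma closestCovers_iff_num (h : IsGood α z) :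
    ClosestCovers α θ z ↔ ∃ a r : ℚ, total α z < ENNReal.ofReal r ∧
      1 ≤ num (innerStrong α θ a r) z ∧ num (innerWeak α θ a r) z = 0 := by
  simp_rw [one_le_num, num_eq_zero]
  constructor
  · rintro ⟨i, -, hi⟩
    obtain ⟨a, hia, hcov⟩ := h.exists_rat_norm_lt hi
    obtain ⟨r, htr, hstrong⟩ := h.exists_rat_total_lt (h.finite a) hcov
    exact ⟨a, r, htr, ⟨i, hstrong i hia.le, hia⟩, fun j hj => hj.1.not_gt (hstrong j hj.2)⟩
  · rintro ⟨a, r, htr, ⟨i, hstrong, hia⟩, hweak⟩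
    have hle : ENNReal.ofReal θ * total α z ≤ ENNReal.ofReal θ * ENNReal.ofReal r :=
      mul_le_mul_right htr.le _
    refine ⟨i, hle.trans_lt hstrong, fun j hj => ?_⟩
    by_contra hji
    exact hweak j ⟨(not_lt.1 hj).trans hle, (not_lt.1 hji).trans hia.le⟩

end Separation

section Law

variable {α θ : ℝ} {lam : ℝ≥0} {F : Measure ℝ}

/-- The functionals that determine whether the closest point covers: the power, and the
indicators of `innerStrong` and `innerWeak` for rational parameters. -/
def covFunctional (α θ : ℝ) : Option (Bool × ℚ × ℚ) → Plane × ℝ → ℝ≥0∞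
  | none => power α
  | some (true, a, r) => (innerStrong α θ a r).indicator fun _ => 1
  | some (false, a, r) => (innerWeak α θ a r).indicator fun _ => 1

lemma measurable_covFunctional (α θ : ℝ) : ∀ j, Measurable (covFunctional α θ j)
  | none => measurable_power α
  | some (true, a, r) => measurable_const.indicator (measurableSet_innerStrong α θ a r)
  | some (false, a, r) => measurable_const.indicator (measurableSet_innerWeak α θ a r)

/-- The values of the sums of `covFunctional` for which the closest point covers, as in
`closestCovers_iff_num`. -/
def covRegion : Set (Option (Bool × ℚ × ℚ) → ℝ≥0∞) := ⋃ a : ℚ, ⋃ r : ℚ,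
  {y | y none < ENNReal.ofReal r ∧ 1 ≤ y (some (true, a, r)) ∧ y (some (false, a, r)) = 0}

lemma measurableSet_covRegion : MeasurableSet covRegion :=
  MeasurableSet.iUnion fun _ => MeasurableSet.iUnion fun _ =>
    (measurableSet_lt (measurable_pi_apply _) measurable_const).inter
      ((measurableSet_le measurable_const (measurable_pi_apply _)).inter
        (measurableSet_eq_fun (measurable_pi_apply _) measurable_const))

lemma mem_covRegion {y : Option (Bool × ℚ × ℚ) → ℝ≥0∞} : y ∈ covRegion ↔ ∃ a r : ℚ,
    y none < ENNReal.ofReal r ∧ 1 ≤ y (some (true, a, r)) ∧ y (some (false, a, r)) = 0 := by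
  simp [covRegion]

variable {Ω : Type*} [MeasurableSpace Ω] {P : Measure Ω} {Z : ℕ → Ω → Plane × ℝ}

lemma IsPoisson.measurable_tsum_covFunctional {μ : Measure (Plane × ℝ)} (hZ : IsPoisson P Z μ)
    (α θ : ℝ) : Measurable fun ω j => ∑' i, covFunctional α θ j (Z i ω) :=
  measurable_pi_lambda _ fun j => hZ.measurable_tsum (measurable_covFunctional α θ j)

variable [IsProbabilityMeasure P]

lemma IsPoisson.closestCovers_ae_eq (hα : 2 < α) (hlam : 0 < lam) (hF : IsFading α F)
    (hZ : IsPoisson P Z (intensity lam F)) :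
    {ω | ClosestCovers α θ fun i => Z i ω} =ᵐ[P]
      (fun ω j => ∑' i, covFunctional α θ j (Z i ω)) ⁻¹' covRegion := by
  refine eventuallyEq_set.2 ?_
  filter_upwards [hZ.ae_isGood hα hlam hF] with ω hω
  rw [Set.mem_preimage, mem_covRegion]
  exact closestCovers_iff_num hω

lemma IsPoisson.nullMeasurableSet_closestCovers (hα : 2 < α) (hlam : 0 < lam)
    (hF : IsFading α F) (hZ : IsPoisson P Z (intensity lam F)) :
    NullMeasurableSet {ω | ClosestCovers α θ fun i => Z i ω} P :=
  ((hZ.measurable_tsum_covFunctional α θ) measurableSet_covRegion).nullMeasurableSet.congr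
    (hZ.closestCovers_ae_eq hα hlam hF).symm

theorem IsPoisson.measure_closestCovers_eq {Ω' : Type*} [MeasurableSpace Ω'] {P' : Measure Ω'}
    [IsProbabilityMeasure P'] {Z' : ℕ → Ω' → Plane × ℝ} (hα : 2 < α) (hlam : 0 < lam)
    (hF : IsFading α F) (hZ : IsPoisson P Z (intensity lam F))
    (hZ' : IsPoisson P' Z' (intensity lam F)) :
    P {ω | ClosestCovers α θ fun i => Z i ω} = P' {ω | ClosestCovers α θ fun i => Z' i ω} := by
  rw [measure_congr (hZ.closestCovers_ae_eq hα hlam hF),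
    measure_congr (hZ'.closestCovers_ae_eq hα hlam hF),
    ← Measure.map_apply (hZ.measurable_tsum_covFunctional α θ) measurableSet_covRegion,
    ← Measure.map_apply (hZ'.measurable_tsum_covFunctional α θ) measurableSet_covRegion,
    hZ.map_tsum_eq hZ' (measurable_covFunctional α θ)]

end Law

/-! ### The displacement coupling -/

section Displacement

lemma lintegral_comp_smul_plane {f : Plane → ℝ≥0∞} (hf : Measurable f) {s : ℝ} (hs : 0 < s) :
    ∫⁻ x : Plane, f (s • x) = ENNReal.ofReal (s⁻¹ ^ 2) * ∫⁻ x : Plane, f x := by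
  rw [← lintegral_map hf (measurable_const_smul s),
    Measure.map_addHaar_smul (volume : Measure Plane) hs.ne', lintegral_smul_measure,
    finrank_euclideanSpace_fin, abs_of_pos (by positivity), inv_pow]
  rfl

-- Radial displacement by a factor depending on the mark alone changes the area element by a
-- factor depending on the mark alone, which can be absorbed in the mark law.
theorem IsPoisson.displace {Ω : Type*} [MeasurableSpace Ω] {P : Measure Ω}
    {Z : ℕ → Ω → Plane × ℝ} {lam : ℝ≥0} {F F' : Measure ℝ} [SFinite F] [SFinite F']
    (hZ : IsPoisson P Z (intensity lam F)) {s ψ : ℝ → ℝ}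
    (hs : Measurable s) (hψ : Measurable ψ) (hpos : ∀ᵐ y ∂F, 0 < s y)
    (hF : ∀ Φ : ℝ → ℝ≥0∞, Measurable Φ →
      ∫⁻ y, ENNReal.ofReal ((s y)⁻¹ ^ 2) * Φ (ψ y) ∂F = ∫⁻ y, Φ y ∂F') :
    IsPoisson P (fun i ω => (s (Z i ω).2 • (Z i ω).1, ψ (Z i ω).2)) (intensity lam F') := by
  have hmap : Measurable fun z : Plane × ℝ => (s z.2 • z.1, ψ z.2) := by fun_prop
  refine ⟨fun i => hmap.comp (hZ.measurable i), fun f hf => ?_⟩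
  rw [hZ.laplace (fun z => f (s z.2 • z.1, ψ z.2)) (hf.comp hmap)]
  congr 1
  have hexp : Measurable fun z => 1 - expNeg (f z) := continuous_one_sub_expNeg.measurable.comp hf
  rw [lintegral_intensity hexp, lintegral_intensity (hexp.fun_comp hmap), ← hF _
    ((hexp.lintegral_prod_left' (μ := (volume : Measure Plane))).const_mul _)]
  refine lintegral_congr_ae (hpos.mono fun y hy => ?_)
  beta_reduce
  rw [lintegral_comp_smul_plane (f := fun x => 1 - expNeg (f (x, ψ y)))
    (hexp.comp measurable_prodMk_right) hy, mul_left_comm]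

end Displacement

section Shift

/-- The Gamma law of shape and rate `a`, tilted by `y ^ (2 / α)` and normalised. -/
abbrev tiltedLaw (α a : ℝ) : Measure ℝ := gammaMeasure (a + 2 / α) a

/-- The increasing map from the tilted Gamma law of parameter `a` to that of parameter `b`. -/
def gainMap (α a b : ℝ) : ℝ → ℝ := transport (tiltedLaw α a) (tiltedLaw α b)

/-- The factor by which the points of gain `y` are moved. Up to a constant it is the one that
leaves the received power unchanged when the gain `y` becomes `gainMap α a b y`. -/
def radialFactor (α a b y : ℝ) : ℝ :=
  √(gammaMoment a a (2 / α) / gammaMoment b b (2 / α)) * (gainMap α a b y / y) ^ α⁻¹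

/-- The displacement of the marked points that turns Gamma gains of parameter `a` into Gamma gains
of parameter `b` while multiplying all received powers by the same constant. -/
def shift (α a b : ℝ) (z : Plane × ℝ) : Plane × ℝ :=
  (radialFactor α a b z.2 • z.1, gainMap α a b z.2)

variable {α a b y : ℝ}

lemma isPosLaw_tiltedLaw (hα : 0 < α) (ha : 0 < a) : IsPosLaw (tiltedLaw α a) :=
  isPosLaw_gammaMeasure (by positivity) ha

lemma gainMap_pos (hα : 0 < α) (ha : 0 < a) (hb : 0 < b) (hy : 0 < y) : 0 < gainMap α a b y :=
  transport_pos (isPosLaw_tiltedLaw hα ha) (isPosLaw_tiltedLaw hα hb) hy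

lemma strictMonoOn_gainMap (hα : 0 < α) (ha : 0 < a) (hb : 0 < b) :
    StrictMonoOn (gainMap α a b) (Set.Ioi 0) :=
  strictMonoOn_transport (isPosLaw_tiltedLaw hα ha) (isPosLaw_tiltedLaw hα hb)

lemma measurable_gainMap (hα : 0 < α) (ha : 0 < a) (hb : 0 < b) : Measurable (gainMap α a b) :=
  (monotone_transport (isPosLaw_tiltedLaw hα ha) (isPosLaw_tiltedLaw hα hb)).measurable

lemma map_gainMap (hα : 0 < α) (ha : 0 < a) (hb : 0 < b) :
    (tiltedLaw α a).map (gainMap α a b) = tiltedLaw α b :=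
  map_transport (isPosLaw_tiltedLaw hα ha) (isPosLaw_tiltedLaw hα hb)

lemma gainMap_div_lt (hα : 0 < α) (ha : 0 < a) (hab : a < b) {u v : ℝ} (hu : 0 < u)
    (huv : u < v) : gainMap α a b v / v < gainMap α a b u / u :=
  transport_gammaMeasure_div_lt (by positivity) ha (by linarith) (ha.trans hab) hu huv

lemma tendsto_gainMap (hα : 0 < α) (ha : 0 < a) (hy : 0 < y) :
    Tendsto (fun b => gainMap α a b y) atTop (𝓝 1) :=
  tendsto_transport_gammaMeasure (isPosLaw_tiltedLaw hα ha) (by positivity) hy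

lemma gammaMoment_self_pos (hα : 0 < α) (ha : 0 < a) : 0 < gammaMoment a a (2 / α) :=
  gammaMoment_pos ha ha (by positivity)

lemma gammaMoment_mul_gammaMoment_neg (ha : 0 < a) {r s : ℝ} (hr : 0 < r) (has : 0 < a + s) :
    gammaMoment a r s * gammaMoment (a + s) r (-s) = 1 := by
  have _ := Real.Gamma_pos_of_pos ha
  have _ := Real.Gamma_pos_of_pos has
  have _ := Real.rpow_pos_of_pos hr s
  rw [gammaMoment, gammaMoment, add_neg_cancel_right, Real.rpow_neg hr.le]
  field_simp

lemma radialFactor_pos (hα : 0 < α) (ha : 0 < a) (hb : 0 < b) (hy : 0 < y) :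
    0 < radialFactor α a b y := by
  have _ := gammaMoment_self_pos hα ha
  have _ := gammaMoment_self_pos hα hb
  have _ := gainMap_pos hα ha hb hy
  unfold radialFactor
  positivity

lemma inv_radialFactor_sq (hα : 0 < α) (ha : 0 < a) (hb : 0 < b) (hy : 0 < y) :
    (radialFactor α a b y)⁻¹ ^ 2 = gammaMoment b b (2 / α) / gammaMoment a a (2 / α) *
      (y ^ (2 / α) * gainMap α a b y ^ (-(2 / α))) := by
  have _ := gammaMoment_self_pos hα ha
  have _ := gammaMoment_self_pos hα hb
  have hgain := gainMap_pos hα ha hb hy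
  rw [radialFactor, mul_inv, mul_pow, inv_pow, Real.sq_sqrt (by positivity), inv_div, inv_pow,
    ← Real.rpow_natCast, ← Real.rpow_mul (by positivity), Nat.cast_ofNat, inv_mul_eq_div,
    Real.div_rpow hgain.le hy.le, Real.rpow_neg hgain.le, inv_div]
  simp only [div_eq_mul_inv]

lemma lintegral_inv_radialFactor_sq_mul (hα : 0 < α) (ha : 0 < a) (hb : 0 < b)
    {Φ : ℝ → ℝ≥0∞} (hΦ : Measurable Φ) :
    ∫⁻ y, ENNReal.ofReal ((radialFactor α a b y)⁻¹ ^ 2) * Φ (gainMap α a b y) ∂(gammaMeasure a a) =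
      ∫⁻ y, Φ y ∂(gammaMeasure b b) := by
  set Ma := gammaMoment a a (2 / α)
  set Mb := gammaMoment b b (2 / α)
  have hMa : 0 < Ma := gammaMoment_self_pos hα ha
  have hMb : 0 < Mb := gammaMoment_self_pos hα hb
  have hgain := measurable_gainMap hα ha hb
  have hΨ : Measurable fun u : ℝ => ENNReal.ofReal (u ^ (-(2 / α))) * Φ u :=
    (measurable_id.pow_const _).ennreal_ofReal.mul hΦ
  calc ∫⁻ y, ENNReal.ofReal ((radialFactor α a b y)⁻¹ ^ 2) * Φ (gainMap α a b y)
        ∂(gammaMeasure a a)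
      = ∫⁻ y, ENNReal.ofReal (Mb / Ma) * (ENNReal.ofReal (y ^ (2 / α)) *
          (ENNReal.ofReal (gainMap α a b y ^ (-(2 / α))) * Φ (gainMap α a b y)))
          ∂(gammaMeasure a a) := by
        refine lintegral_congr_ae ((ae_pos_gammaMeasure ha ha).mono fun y hy => ?_)
        beta_reduce
        rw [inv_radialFactor_sq hα ha hb hy, ENNReal.ofReal_mul (by positivity),
          ENNReal.ofReal_mul (by positivity), mul_assoc, mul_assoc]
    _ = ENNReal.ofReal (Mb / Ma) * (ENNReal.ofReal Ma *
          ∫⁻ u, ENNReal.ofReal (u ^ (-(2 / α))) * Φ u ∂(tiltedLaw α b)) := by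
        rw [lintegral_const_mul' _ _ ENNReal.ofReal_ne_top,
          lintegral_rpow_mul_gammaMeasure ha ha (by positivity) (hΨ.fun_comp hgain),
          ← map_gainMap hα ha hb, lintegral_map hΨ hgain]
    _ = ENNReal.ofReal (Mb * gammaMoment (b + 2 / α) b (-(2 / α))) *
          ∫⁻ y, Φ y ∂(gammaMeasure b b) := by
        rw [lintegral_rpow_mul_gammaMeasure (by positivity) hb (by simpa using hb) hΦ,
          ← mul_assoc, ← mul_assoc, ← ENNReal.ofReal_mul (by positivity),
          ← ENNReal.ofReal_mul (by positivity), div_mul_cancel₀ _ hMa.ne', add_neg_cancel_right]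
    _ = ∫⁻ y, Φ y ∂(gammaMeasure b b) := by
        rw [gammaMoment_mul_gammaMoment_neg hb hb (by positivity), ENNReal.ofReal_one, one_mul]

lemma IsPoisson.isPoisson_shift {Ω : Type*} [MeasurableSpace Ω] {P : Measure Ω}
    {Z : ℕ → Ω → Plane × ℝ} {lam : ℝ≥0} (hα : 0 < α) (ha : 0 < a) (hb : 0 < b)
    (hZ : IsPoisson P Z (intensity lam (gammaMeasure a a))) :
    IsPoisson P (fun i ω => shift α a b (Z i ω)) (intensity lam (gammaMeasure b b)) := by
  have := isProbabilityMeasure_gammaMeasure ha ha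
  have := isProbabilityMeasure_gammaMeasure hb hb
  have hgain := measurable_gainMap hα ha hb
  refine hZ.displace (s := radialFactor α a b) ?_ hgain ?_
    fun Φ hΦ => lintegral_inv_radialFactor_sq_mul hα ha hb hΦ
  · unfold radialFactor
    fun_prop
  · exact (ae_pos_gammaMeasure ha ha).mono fun y hy => radialFactor_pos hα ha hb hy

end Shift

section InvPower

variable {α : ℝ} {z : Plane × ℝ}

/-- The inverse of the received power, as a real number. -/
def invPower (α : ℝ) (z : Plane × ℝ) : ℝ := ‖z.1‖ ^ α / z.2

lemma invPower_pos (hnorm : 0 < ‖z.1‖) (hgain : 0 < z.2) : 0 < invPower α z := by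
  unfold invPower
  positivity

lemma invPower_mul_gain (hgain : 0 < z.2) : invPower α z * z.2 = ‖z.1‖ ^ α :=
  div_mul_cancel₀ _ hgain.ne'

lemma power_eq_ofReal_inv (hnorm : 0 < ‖z.1‖) (hgain : 0 < z.2) :
    power α z = ENNReal.ofReal (invPower α z)⁻¹ := by
  rw [← Prod.mk.eta (p := z), power_of_pos hnorm hgain.le, invPower, inv_div,
    Real.rpow_neg hnorm.le, div_eq_mul_inv]

lemma power_lt_power_iff {w : Plane × ℝ} (hz : 0 < ‖z.1‖) (hz' : 0 < z.2) (hw : 0 < ‖w.1‖)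
    (hw' : 0 < w.2) : power α z < power α w ↔ invPower α w < invPower α z := by
  have hzpos := invPower_pos (α := α) hz hz'
  have hwpos := invPower_pos (α := α) hw hw'
  rw [power_eq_ofReal_inv hz hz', power_eq_ofReal_inv hw hw',
    ENNReal.ofReal_lt_ofReal_iff (inv_pos.2 hwpos), inv_lt_inv₀ hzpos hwpos]

end InvPower

section ShiftCovers

variable {α θ a b : ℝ}

/-- The coverage event of the shifted configuration, expressed in the original one. -/
def ShiftCovers (α θ a b : ℝ) (z : ℕ → Plane × ℝ) : Prop :=
  ∃ i, IsCovering α θ z i ∧ ∀ j, ¬IsCovering α θ z j →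
    invPower α (z i) * gainMap α a b (z i).2 < invPower α (z j) * gainMap α a b (z j).2

/-- The factor by which the shift divides the received powers. -/
def shiftScale (α a b : ℝ) : ℝ := √(gammaMoment a a (2 / α) / gammaMoment b b (2 / α)) ^ α

lemma shiftScale_pos (hα : 0 < α) (ha : 0 < a) (hb : 0 < b) : 0 < shiftScale α a b := by
  have _ := gammaMoment_self_pos hα ha
  have _ := gammaMoment_self_pos hα hb
  unfold shiftScale
  positivity

lemma norm_shift_rpow (hα : 0 < α) (ha : 0 < a) (hb : 0 < b) {z : Plane × ℝ} (hz : 0 < z.2) :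
    ‖(shift α a b z).1‖ ^ α = shiftScale α a b * (invPower α z * gainMap α a b z.2) := by
  have hfactor := (radialFactor_pos hα ha hb hz).le
  have _ := gainMap_pos hα ha hb hz
  have _ := gammaMoment_self_pos hα ha
  have _ := gammaMoment_self_pos hα hb
  rw [shift, norm_smul, Real.norm_of_nonneg hfactor, Real.mul_rpow hfactor (norm_nonneg _),
    radialFactor, Real.mul_rpow (by positivity) (by positivity),
    Real.rpow_inv_rpow (by positivity) hα.ne', shiftScale, invPower]
  ring

lemma power_shift (hα : 0 < α) (ha : 0 < a) (hb : 0 < b) {z : Plane × ℝ} (hnorm : 0 < ‖z.1‖)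
    (hgain : 0 < z.2) :
    power α (shift α a b z) = ENNReal.ofReal (shiftScale α a b)⁻¹ * power α z := by
  have hgain' := gainMap_pos hα ha hb hgain
  have hscale := shiftScale_pos hα ha hb
  have hnorm' : 0 < ‖(shift α a b z).1‖ := by
    rw [shift, norm_smul, Real.norm_of_nonneg (radialFactor_pos hα ha hb hgain).le]
    exact mul_pos (radialFactor_pos hα ha hb hgain) hnorm
  have hinv : invPower α (shift α a b z) = shiftScale α a b * invPower α z := by
    rw [invPower, norm_shift_rpow hα ha hb hgain, ← mul_assoc]
    exact mul_div_cancel_right₀ _ hgain'.ne'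
  rw [power_eq_ofReal_inv hnorm' hgain', power_eq_ofReal_inv hnorm hgain, hinv, mul_inv,
    ENNReal.ofReal_mul (by positivity)]

variable {z : ℕ → Plane × ℝ}

lemma isCovering_shift_iff (hα : 0 < α) (ha : 0 < a) (hb : 0 < b) (h : IsGood α z) (i : ℕ) :
    IsCovering α θ (fun i => shift α a b (z i)) i ↔ IsCovering α θ z i := by
  have hpower : ∀ i, power α (shift α a b (z i)) =
      ENNReal.ofReal (shiftScale α a b)⁻¹ * power α (z i) :=
    fun i => power_shift hα ha hb (h.norm_pos i) (h.gain_pos i)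
  have hscale : ENNReal.ofReal (shiftScale α a b)⁻¹ ≠ 0 :=
    (ENNReal.ofReal_pos.2 (inv_pos.2 (shiftScale_pos hα ha hb))).ne'
  simp_rw [IsCovering, total, hpower]
  rw [ENNReal.tsum_mul_left, mul_left_comm, mul_left_comm (ENNReal.ofReal (1 + θ)),
    ENNReal.mul_lt_mul_iff_right hscale ENNReal.ofReal_ne_top]

lemma closestCovers_shift_iff (hα : 0 < α) (ha : 0 < a) (hb : 0 < b) (h : IsGood α z) :
    ClosestCovers α θ (fun i => shift α a b (z i)) ↔ ShiftCovers α θ a b z := by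
  simp only [ClosestCovers, ShiftCovers, isCovering_shift_iff hα ha hb h]
  refine exists_congr fun i => and_congr_right fun _ => forall_congr' fun j => imp_congr_right
    fun _ => ?_
  rw [← Real.rpow_lt_rpow_iff (norm_nonneg _) (norm_nonneg _) hα,
    norm_shift_rpow hα ha hb (h.gain_pos i), norm_shift_rpow hα ha hb (h.gain_pos j),
    mul_lt_mul_iff_right₀ (shiftScale_pos hα ha hb)]

lemma IsGood.invPower_lt_of_isCovering (h : IsGood α z) {i j : ℕ}
    (hi : IsCovering α θ z i) (hj : ¬IsCovering α θ z j) :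
    invPower α (z i) < invPower α (z j) := by
  rw [← power_lt_power_iff (h.norm_pos j) (h.gain_pos j) (h.norm_pos i) (h.gain_pos i)]
  by_contra! hle
  exact hj (hi.trans_le (mul_le_mul_right hle _))

lemma mul_lt_mul_of_strictMonoOn_of_div_lt {χ : ℝ → ℝ} (hpos : ∀ u, 0 < u → 0 < χ u)
    (hmono : StrictMonoOn χ (Set.Ioi 0)) (hdiv : ∀ u v, 0 < u → u < v → χ v / v < χ u / u)
    {p q u v : ℝ} (hp : 0 < p) (hpq : p < q) (hu : 0 < u) (hv : 0 < v) (h : p * u < q * v) :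
    p * χ u < q * χ v := by
  rcases le_or_gt u v with huv | hvu
  · exact (mul_le_mul_of_nonneg_left (hmono.monotoneOn hu hv huv) hp.le).trans_lt
      (mul_lt_mul_of_pos_right hpq (hpos v hv))
  · calc p * χ u = (p * u) * (χ u / u) := by field_simp
      _ < (p * u) * (χ v / v) := mul_lt_mul_of_pos_left (hdiv v u hv hvu) (mul_pos hp hu)
      _ < (q * v) * (χ v / v) := mul_lt_mul_of_pos_right h (div_pos (hpos v hv) hv)
      _ = q * χ v := by field_simp

-- The shift to a larger parameter compares `invPower * gainMap` instead of
-- `invPower * gain = norm ^ α`: a closer point of larger power stays closer.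
lemma IsGood.invPower_mul_gainMap_lt (hα : 0 < α) (ha : 0 < a) (hab : a < b) (h : IsGood α z)
    {i j : ℕ} (hi : IsCovering α θ z i) (hj : ¬IsCovering α θ z j)
    (hij : ‖(z i).1‖ < ‖(z j).1‖) :
    invPower α (z i) * gainMap α a b (z i).2 < invPower α (z j) * gainMap α a b (z j).2 := by
  refine mul_lt_mul_of_strictMonoOn_of_div_lt (fun u => gainMap_pos hα ha (ha.trans hab))
    (strictMonoOn_gainMap hα ha (ha.trans hab)) (fun u v => gainMap_div_lt hα ha hab)
    (invPower_pos (h.norm_pos i) (h.gain_pos i)) (h.invPower_lt_of_isCovering hi hj)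
    (h.gain_pos i) (h.gain_pos j) ?_
  rw [invPower_mul_gain (h.gain_pos i), invPower_mul_gain (h.gain_pos j)]
  exact Real.rpow_lt_rpow (norm_nonneg _) hij hα

lemma ClosestCovers.shiftCovers (hα : 0 < α) (ha : 0 < a) (hab : a < b) (h : IsGood α z)
    (hcov : ClosestCovers α θ z) : ShiftCovers α θ a b z :=
  have ⟨i, hi, hlt⟩ := hcov
  ⟨i, hi, fun j hj => h.invPower_mul_gainMap_lt hα ha hab hi hj (hlt j hj)⟩

-- As `b → ∞` the order by `invPower * gainMap` becomes the order by `invPower`, in which every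
-- covering point comes first.
lemma eventually_shiftCovers (hα : 0 < α) (ha : 0 < a) (h : IsGood α z) {i : ℕ}
    (hi : IsCovering α θ z i) : ∀ᶠ b in atTop, ShiftCovers α θ a b z := by
  have hlim : ∀ j, Tendsto (fun b => invPower α (z j) * gainMap α a b (z j).2) atTop
      (𝓝 (invPower α (z j))) := fun j => by
    simpa only [mul_one] using (tendsto_gainMap hα ha (h.gain_pos j)).const_mul (invPower α (z j))
  have hnear : ∀ᶠ b in atTop, ∀ j ∈ {j | ‖(z j).1‖ ≤ ‖(z i).1‖}, ¬IsCovering α θ z j →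
      invPower α (z i) * gainMap α a b (z i).2 < invPower α (z j) * gainMap α a b (z j).2 :=
    (Set.Finite.eventually_all (h.finite _)).2 fun j _ => eventually_imp_distrib_left.2 fun hj =>
      (hlim i).eventually_lt (hlim j) (h.invPower_lt_of_isCovering hi hj)
  filter_upwards [hnear, eventually_gt_atTop a] with b hb hab
  refine ⟨i, hi, fun j hj => ?_⟩
  rcases le_or_gt ‖(z j).1‖ ‖(z i).1‖ with hji | hij
  · exact hb j hji hj
  · exact h.invPower_mul_gainMap_lt hα ha hab hi hj hij

end ShiftCovers

/-! ### Configurations with a dominant pair of points -/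

section Dominant

variable {α θ a b R ε : ℝ}

/-- A pair of marked points that, when all other points lie outside the ball of radius `R` and
contribute a total power of at most `ε`, makes the first point the only covering one: the second
point is closer to the origin, but the shift from `a` to `b` moves it behind the first one. -/
structure IsDominant (α θ a b R ε : ℝ) (p q : Plane × ℝ) : Prop where
  gain_pos_fst : 0 < p.2
  gain_pos_snd : 0 < q.2
  norm_pos : 0 < ‖q.1‖
  norm_lt_norm : ‖q.1‖ < ‖p.1‖
  norm_lt : ‖p.1‖ < R
  strong : θ * ((invPower α q)⁻¹ + ε) < (invPower α p)⁻¹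
  weak : (invPower α q)⁻¹ < θ * (invPower α p)⁻¹
  small : ε < θ * (invPower α p)⁻¹
  reverses : invPower α p * gainMap α a b p.2 < invPower α q * gainMap α a b q.2

lemma exists_lt_one_gainMap_lt (hα : 0 < α) (ha : 0 < a) (hab : a < b) (L : ℝ) :
    ∃ v w : ℝ, 0 < v ∧ 0 < w ∧ w * v < 1 ∧ L < w ∧
      gainMap α a b 1 < w * gainMap α a b v := by
  have hL : 1 < |L| + 2 := by linarith [abs_nonneg L]
  have hv : 0 < (|L| + 2)⁻¹ := by positivity
  have hgain := gainMap_pos hα ha (ha.trans hab) hv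
  have hstar := gainMap_div_lt hα ha hab hv (inv_lt_one_of_one_lt₀ hL)
  rw [div_one, div_inv_eq_mul, mul_comm, ← div_lt_iff₀ hgain] at hstar
  obtain ⟨w, hw, hwv⟩ := exists_between (max_lt hstar (by linarith [le_abs_self L] : L < |L| + 2))
  obtain ⟨hratio, hLw⟩ := max_lt_iff.1 hw
  have hwpos : 0 < w := (div_pos (gainMap_pos hα ha (ha.trans hab) one_pos) hgain).trans hratio
  refine ⟨_, w, hv, hwpos, ?_, hLw, (div_lt_iff₀ hgain).1 hratio⟩
  rwa [← div_eq_mul_inv, div_lt_one (by positivity)]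

-- The first point has power `1` and distance `1`; the second one has the much smaller power `w⁻¹`
-- and lies closer because its gain `v` is smaller still.
lemma exists_isDominant (hα : 0 < α) (hθ : 0 < θ) (ha : 0 < a) (hab : a < b) :
    ∃ R ε p q, 0 < ε ∧ IsDominant α θ a b R ε p q := by
  obtain ⟨v, w, hv, hw, hwv, hLw, hgain⟩ :=
    exists_lt_one_gainMap_lt hα ha hab (2 * θ + θ⁻¹)
  obtain ⟨x₁, hx₁⟩ := exists_norm_eq Plane (zero_le_one' ℝ)
  obtain ⟨x₂, hx₂⟩ := exists_norm_eq Plane (c := (w * v) ^ α⁻¹) (by positivity)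
  have hpower₁ : invPower α (x₁, 1) = 1 := by simp [invPower, hx₁]
  have hpower₂ : invPower α (x₂, v) = w := by
    rw [invPower, hx₂, Real.rpow_inv_rpow (by positivity) hα.ne', mul_div_cancel_right₀ _ hv.ne']
  have hstrong : 2 * θ < w := by linarith [inv_pos.2 hθ]
  have hweak : w⁻¹ < θ := inv_lt_of_inv_lt₀ hθ (by linarith)
  refine ⟨2, w⁻¹, (x₁, 1), (x₂, v), inv_pos.2 hw, ?_⟩
  constructor <;> simp only [hpower₁, hpower₂, hx₁, hx₂, inv_one, mul_one, one_mul]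
  case norm_lt_norm => exact Real.rpow_lt_one (by positivity) hwv (inv_pos.2 hα)
  case strong =>
    rwa [← two_mul, ← mul_assoc, ← div_eq_mul_inv, div_lt_one hw, mul_comm θ]
  case norm_pos => positivity
  all_goals first | assumption | norm_num

lemma continuousAt_invPower (hα : 0 < α) {z : Plane × ℝ} (hz : 0 < z.2) :
    ContinuousAt (invPower α) z :=
  (continuousAt_fst.norm.rpow_const (Or.inr hα.le)).div continuousAt_snd hz.ne'

lemma continuousAt_gainMap (hα : 0 < α) (ha : 0 < a) (hb : 0 < b) {v : ℝ} (hv : 0 < v) :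
    ContinuousAt (gainMap α a b) v :=
  continuousAt_transport (isPosLaw_tiltedLaw hα ha) (isPosLaw_tiltedLaw hα hb) hv

lemma isOpen_setOf_isDominant (hα : 0 < α) (ha : 0 < a) (hb : 0 < b) :
    IsOpen {y : (Plane × ℝ) × Plane × ℝ | IsDominant α θ a b R ε y.1 y.2} := by
  refine isOpen_iff_eventually.2 fun y (h : IsDominant α θ a b R ε y.1 y.2) => ?_
  have hfst : ContinuousAt (fun y : (Plane × ℝ) × Plane × ℝ => invPower α y.1) y :=
    (continuousAt_invPower hα h.gain_pos_fst).comp continuousAt_fst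
  have hsnd : ContinuousAt (fun y : (Plane × ℝ) × Plane × ℝ => invPower α y.2) y :=
    (continuousAt_invPower hα h.gain_pos_snd).comp continuousAt_snd
  have hfst' := hfst.inv₀ (invPower_pos (h.norm_pos.trans h.norm_lt_norm) h.gain_pos_fst).ne'
  have hsnd' := hsnd.inv₀ (invPower_pos h.norm_pos h.gain_pos_snd).ne'
  have hgain₁ : ContinuousAt (fun y : (Plane × ℝ) × Plane × ℝ => gainMap α a b y.1.2) y :=
    ContinuousAt.comp (f := fun y : (Plane × ℝ) × Plane × ℝ => y.1.2)
      (continuousAt_gainMap hα ha hb h.gain_pos_fst) (by fun_prop)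
  have hgain₂ : ContinuousAt (fun y : (Plane × ℝ) × Plane × ℝ => gainMap α a b y.2.2) y :=
    ContinuousAt.comp (f := fun y : (Plane × ℝ) × Plane × ℝ => y.2.2)
      (continuousAt_gainMap hα ha hb h.gain_pos_snd) (by fun_prop)
  have hnorm₁ : ContinuousAt (fun y : (Plane × ℝ) × Plane × ℝ => ‖y.1.1‖) y := by fun_prop
  have hnorm₂ : ContinuousAt (fun y : (Plane × ℝ) × Plane × ℝ => ‖y.2.1‖) y := by fun_prop
  filter_upwards [continuousAt_const.eventually_lt continuousAt_fst.snd h.gain_pos_fst,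
    continuousAt_const.eventually_lt continuousAt_snd.snd h.gain_pos_snd,
    continuousAt_const.eventually_lt hnorm₂ h.norm_pos,
    hnorm₂.eventually_lt hnorm₁ h.norm_lt_norm,
    hnorm₁.eventually_lt continuousAt_const h.norm_lt,
    ((hsnd'.add_const ε).const_mul θ).eventually_lt hfst' h.strong,
    hsnd'.eventually_lt (hfst'.const_mul θ) h.weak,
    continuousAt_const.eventually_lt (hfst'.const_mul θ) h.small,
    (hfst.mul hgain₁).eventually_lt (hsnd.mul hgain₂) h.reverses]
  exact fun _ h₁ h₂ h₃ h₄ h₅ h₆ h₇ h₈ h₉ => ⟨h₁, h₂, h₃, h₄, h₅, h₆, h₇, h₈, h₉⟩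

lemma exists_isOpen_isDominant (hα : 0 < α) (hθ : 0 < θ) (ha : 0 < a) (hab : a < b) :
    ∃ (R ε : ℝ) (A B : Set (Plane × ℝ)), 0 < ε ∧ IsOpen A ∧ IsOpen B ∧ A.Nonempty ∧
      B.Nonempty ∧ ∀ p ∈ A, ∀ q ∈ B, IsDominant α θ a b R ε p q := by
  obtain ⟨R, ε, p, q, hε, hdom⟩ := exists_isDominant hα hθ ha hab
  obtain ⟨A, B, hA, hB, hp, hq, hAB⟩ :=
    isOpen_prod_iff.1 (isOpen_setOf_isDominant hα ha (ha.trans hab)) p q hdom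
  exact ⟨R, ε, A, B, hε, hA, hB, ⟨p, hp⟩, ⟨q, hq⟩, fun x hx y hy => hAB (Set.mk_mem_prod hx hy)⟩

variable {z : ℕ → Plane × ℝ}

lemma not_isCovering_of_power_le (hθ : 0 ≤ θ) {i k : ℕ} (hik : i ≠ k)
    (hle : power α (z k) ≤ ENNReal.ofReal θ * power α (z i)) : ¬IsCovering α θ z k := by
  rw [IsCovering, not_lt, ENNReal.ofReal_add zero_le_one hθ, ENNReal.ofReal_one, add_mul, one_mul]
  calc power α (z k) + ENNReal.ofReal θ * power α (z k)
      ≤ ENNReal.ofReal θ * power α (z i) + ENNReal.ofReal θ * power α (z k) := by gcongr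
    _ = ENNReal.ofReal θ * ∑ j ∈ {i, k}, power α (z j) := by rw [Finset.sum_pair hik, mul_add]
    _ ≤ ENNReal.ofReal θ * total α z := by gcongr; exact ENNReal.sum_le_tsum _

lemma isCovering_of_total_le (hθ : 0 ≤ θ) {i : ℕ} {s : ℝ≥0∞} (hi : power α (z i) ≠ ⊤)
    (htotal : total α z ≤ power α (z i) + s) (hs : ENNReal.ofReal θ * s < power α (z i)) :
    IsCovering α θ z i := by
  rw [IsCovering, ENNReal.ofReal_add zero_le_one hθ, ENNReal.ofReal_one, add_mul, one_mul, add_comm]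
  calc ENNReal.ofReal θ * total α z
      ≤ ENNReal.ofReal θ * power α (z i) + ENNReal.ofReal θ * s := by rw [← mul_add]; gcongr
    _ < ENNReal.ofReal θ * power α (z i) + power α (z i) :=
      ENNReal.add_lt_add_left (ENNReal.mul_ne_top ENNReal.ofReal_ne_top hi) hs

lemma IsGood.power_le_of_total_le (h : IsGood α z) {s : ℝ≥0∞} {i j k : ℕ} (hij : i ≠ j)
    (hki : k ≠ i) (hkj : k ≠ j) (htotal : total α z ≤ power α (z i) + (power α (z j) + s)) :
    power α (z k) ≤ s := by
  have hsum := (ENNReal.sum_le_tsum (f := fun k => power α (z k)) {i, j, k}).trans htotal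
  rw [Finset.sum_insert (by simp [hij, hki.symm]), Finset.sum_pair hkj.symm] at hsum
  rwa [ENNReal.add_le_add_iff_left (power_ne_top (h.norm_pos i)),
    ENNReal.add_le_add_iff_left (power_ne_top (h.norm_pos j))] at hsum

lemma IsDominant.isCovering_iff (hθ : 0 ≤ θ) (hε : 0 ≤ ε) (h : IsGood α z) {i j k : ℕ}
    (hdom : IsDominant α θ a b R ε (z i) (z j))
    (htotal : total α z ≤ power α (z i) + (power α (z j) + ENNReal.ofReal ε)) :
    IsCovering α θ z k ↔ k = i := by
  have hi := power_eq_ofReal_inv (α := α) (h.norm_pos i) (h.gain_pos i)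
  have hj := power_eq_ofReal_inv (α := α) (h.norm_pos j) (h.gain_pos j)
  have hij : i ≠ j := fun hij => hdom.norm_lt_norm.ne' (by rw [hij])
  have hjpos := inv_pos.2 (invPower_pos (α := α) (h.norm_pos j) (h.gain_pos j))
  constructor
  · contrapose!
    intro hki
    refine not_isCovering_of_power_le hθ hki.symm ?_
    rw [hi, ← ENNReal.ofReal_mul hθ]
    rcases eq_or_ne k j with rfl | hkj
    · exact hj.trans_le (ENNReal.ofReal_le_ofReal hdom.weak.le)
    · exact (h.power_le_of_total_le hij hki hkj htotal).trans
        (ENNReal.ofReal_le_ofReal hdom.small.le)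
  · rintro rfl
    refine isCovering_of_total_le hθ (power_ne_top (h.norm_pos k)) htotal ?_
    rw [hi, hj, ← ENNReal.ofReal_add hjpos.le hε, ← ENNReal.ofReal_mul hθ]
    exact ENNReal.ofReal_lt_ofReal_iff_of_nonneg
      (mul_nonneg hθ (add_nonneg hjpos.le hε)) |>.2 hdom.strong

lemma IsDominant.shiftCovers_and_not_closestCovers (hα : 0 < α) (hθ : 0 ≤ θ) (ha : 0 < a)
    (hab : a < b) (hε : 0 ≤ ε) (h : IsGood α z) {i j : ℕ}
    (hdom : IsDominant α θ a b R ε (z i) (z j))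
    (hfar : ∀ k, k ≠ i → k ≠ j → R ≤ ‖(z k).1‖)
    (htotal : total α z ≤ power α (z i) + (power α (z j) + ENNReal.ofReal ε)) :
    ShiftCovers α θ a b z ∧ ¬ClosestCovers α θ z := by
  have hcov : ∀ k, IsCovering α θ z k ↔ k = i := fun k => hdom.isCovering_iff hθ hε h htotal
  refine ⟨⟨i, (hcov i).2 rfl, fun k hk => ?_⟩, ?_⟩
  · rcases eq_or_ne k j with rfl | hkj
    · exact hdom.reverses
    · exact h.invPower_mul_gainMap_lt hα ha hab ((hcov i).2 rfl) hk
        (hdom.norm_lt.trans_le (hfar k (mt (hcov k).2 hk) hkj))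
  · rintro ⟨k, hk, hlt⟩
    obtain rfl := (hcov k).1 hk
    have hjk : ¬IsCovering α θ z j := fun hj =>
      hdom.norm_lt_norm.ne (by rw [(hcov j).1 hj])
    exact hdom.norm_lt_norm.not_gt (hlt j hjk)

end Dominant

/-! ### The closest point covers more often after a shift -/

lemma one_sub_expNeg_nsmul_le (n : ℕ) (x : ℝ≥0∞) :
    1 - expNeg (n • x) ≤ n * (1 - expNeg x) := by
  induction n with
  | zero => simp
  | succ n ih =>
    calc 1 - expNeg ((n + 1) • x)
        = (1 - expNeg x) + (1 - expNeg (n • x)) * expNeg x := by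
          rw [succ_nsmul, one_sub_expNeg_add]
      _ ≤ (1 - expNeg x) + n * (1 - expNeg x) * 1 := by gcongr; exact expNeg_le_one x
      _ = (n + 1 : ℕ) * (1 - expNeg x) := by push_cast; ring

lemma tendsto_lintegral_one_sub_expNeg_nsmul_div {E : Type*} [MeasurableSpace E] {Λ : Measure E}
    {f : E → ℝ≥0∞} (hf : Measurable f) (hint : ∫⁻ z, (1 - expNeg (f z)) ∂Λ ≠ ⊤) :
    Tendsto (fun n : ℕ => ∫⁻ z, (1 - expNeg (n • f z)) / n ∂Λ) atTop (𝓝 0) := by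
  rw [← lintegral_zero (μ := Λ)]
  refine tendsto_lintegral_of_dominated_convergence (fun z => 1 - expNeg (f z))
    (fun n => ?_) (fun n => ae_of_all _ fun z => ?_) hint (ae_of_all _ fun z => ?_)
  · simp only [nsmul_eq_mul]
    exact (continuous_one_sub_expNeg.measurable.fun_comp (hf.const_mul _)).div_const _
  · rcases n.eq_zero_or_pos with rfl | _
    · simp
    · exact ENNReal.div_le_of_le_mul' (one_sub_expNeg_nsmul_le n (f z))
  · refine tendsto_of_tendsto_of_tendsto_of_le_of_le tendsto_const_nhds
      ENNReal.tendsto_inv_nat_nhds_zero (fun n => zero_le) fun n => ?_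
    rw [ENNReal.div_eq_inv_mul]
    exact mul_le_of_le_one_right' tsub_le_self

section Independence

variable {Ω E : Type*} [MeasurableSpace Ω] [MeasurableSpace E] {P : Measure Ω}
  [IsProbabilityMeasure P] {Z : ℕ → Ω → E} {Λ : Measure E}

-- If the sum exceeded `ε` almost surely, its Laplace transform at `n` would be at most `e^{-nε}`,
-- but its exponent grows sublinearly in `n`.
lemma IsPoisson.measure_tsum_le_ne_zero (hZ : IsPoisson P Z Λ) {f : E → ℝ≥0∞} (hf : Measurable f)
    (hint : ∫⁻ z, (1 - expNeg (f z)) ∂Λ ≠ ⊤) {ε : ℝ≥0∞} (hε : 0 < ε) :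
    P {ω | ∑' i, f (Z i ω) ≤ ε} ≠ 0 := by
  intro hnull
  have hlt : ∀ᵐ ω ∂P, ε ≤ ∑' i, f (Z i ω) := by
    filter_upwards [measure_eq_zero_iff_ae_notMem.1 hnull] with ω hω using (not_le.1 hω).le
  have hlaplace : ∀ n : ℕ, n • ε ≤ ∫⁻ z, (1 - expNeg (n • f z)) ∂Λ := fun n => by
    rw [← expNeg_strictAnti.le_iff_ge, ← hZ.laplace (fun z => n • f z) (hf.const_smul n)]
    calc ∫⁻ ω, expNeg (∑' i, n • f (Z i ω)) ∂P ≤ ∫⁻ _, expNeg (n • ε) ∂P := by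
          refine lintegral_mono_ae (hlt.mono fun ω hω => expNeg_strictAnti.antitone ?_)
          simp only [nsmul_eq_mul, ENNReal.tsum_mul_left]
          gcongr
      _ = expNeg (n • ε) := by simp
  refine hε.not_ge (ge_of_tendsto (tendsto_lintegral_one_sub_expNeg_nsmul_div hf hint) ?_)
  filter_upwards [eventually_ne_atTop 0] with n hn
  have hdiv : ∫⁻ z, (1 - expNeg (n • f z)) / n ∂Λ = (∫⁻ z, (1 - expNeg (n • f z)) ∂Λ) / n := by
    simp only [div_eq_mul_inv]
    rw [lintegral_mul_const' _ _ (ENNReal.inv_ne_top.2 (by exact_mod_cast hn))]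
  rw [hdiv, ENNReal.le_div_iff_mul_le (Or.inl (by exact_mod_cast hn))
    (Or.inl (ENNReal.natCast_ne_top n)), mul_comm, ← nsmul_eq_mul]
  exact hlaplace n

lemma IsPoisson.measure_forall_tsum_ne_zero (hZ : IsPoisson P Z Λ) {ι : Type*} [Finite ι]
    {A : ι → Set E} {f : ι → E → ℝ≥0∞} {S : ι → Set ℝ≥0∞} (hA : ∀ j, MeasurableSet (A j))
    (hd : Pairwise (Function.onFun Disjoint A)) (hf : ∀ j, Measurable (f j))
    (hS : ∀ j, MeasurableSet (S j))
    (h0 : ∀ j, P {ω | ∑' i, (A j).indicator (f j) (Z i ω) ∈ S j} ≠ 0) :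
    P {ω | ∀ j, ∑' i, (A j).indicator (f j) (Z i ω) ∈ S j} ≠ 0 := by
  have := Fintype.ofFinite ι
  have hind := hZ.iIndepFun_tsum (f := fun j => (A j).indicator (f j))
    (fun j => (hf j).indicator (hA j)) fun i j z hij => by
      by_cases hz : z ∈ A i
      · exact Or.inr (Set.indicator_of_notMem (Set.disjoint_left.1 (hd hij) hz) _)
      · exact Or.inl (Set.indicator_of_notMem hz _)
  have hprod := hind.measure_inter_preimage_eq_mul Finset.univ (sets := S) fun j _ => hS j
  have hset : {ω | ∀ j, ∑' i, (A j).indicator (f j) (Z i ω) ∈ S j} =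
      ⋂ j ∈ Finset.univ, (fun ω => ∑' i, (A j).indicator (f j) (Z i ω)) ⁻¹' S j := by
    ext ω
    simp
  rw [hset, hprod]
  exact Finset.prod_ne_zero_iff.2 fun j _ => h0 j

end Independence

section Strict

variable {α θ a b R ε : ℝ} {lam : ℝ≥0} {F : Measure ℝ}

/-- The power of a point outside the ball of radius `R`, and `⊤` inside: a finite sum of these
excludes points in the ball. -/
def farPower (α R : ℝ) (z : Plane × ℝ) : ℝ≥0∞ :=
  if ‖z.1‖ < R then ⊤ else power α z

lemma measurable_farPower (α R : ℝ) : Measurable (farPower α R) :=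
  Measurable.ite (measurableSet_lt measurable_fst.norm measurable_const) measurable_const
    (measurable_power α)

lemma power_le_farPower (α R : ℝ) (z : Plane × ℝ) : power α z ≤ farPower α R z := by
  unfold farPower
  split_ifs <;> simp

lemma measurableSet_norm_fst_lt (R : ℝ) : MeasurableSet {z : Plane × ℝ | ‖z.1‖ < R} :=
  measurableSet_lt measurable_fst.norm measurable_const

lemma intensity_norm_fst_lt_ne_top [IsProbabilityMeasure F] (R : ℝ) :
    intensity lam F {z | ‖z.1‖ < R} ≠ ⊤ := by
  have hball : {z : Plane × ℝ | ‖z.1‖ < R} = Prod.fst ⁻¹' Metric.ball (0 : Plane) R := by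
    ext z
    simp
  rw [hball, intensity_fst_preimage]
  exact ENNReal.mul_ne_top ENNReal.coe_ne_top measure_ball_lt_top.ne

lemma lintegral_one_sub_expNeg_farPower_ne_top (hα : 2 < α) (hF : IsFading α F) (R : ℝ) :
    ∫⁻ z, (1 - expNeg (farPower α R z)) ∂(intensity lam F) ≠ ⊤ := by
  have := hF.isProb
  have hpower := lintegral_one_sub_expNeg_power (lam := lam) hα hF zero_le_one
  simp only [ENNReal.ofReal_one, one_mul] at hpower
  have hle : ∀ z, 1 - expNeg (farPower α R z) ≤
      {z : Plane × ℝ | ‖z.1‖ < R}.indicator 1 z + (1 - expNeg (power α z)) := fun z => by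
    by_cases hz : ‖z.1‖ < R <;> simp [farPower, hz]
  refine ne_top_of_le_ne_top ?_ (lintegral_mono hle)
  rw [lintegral_add_left (measurable_one.indicator (measurableSet_norm_fst_lt R)),
    lintegral_indicator_one (measurableSet_norm_fst_lt R), hpower]
  exact ENNReal.add_ne_top.2 ⟨intensity_norm_fst_lt_ne_top R,
    ENNReal.mul_ne_top ENNReal.ofReal_ne_top hF.moment⟩

lemma intensity_ne_zero_of_isOpen (hlam : 0 < lam) (hF : IsPosLaw F) {A : Set (Plane × ℝ)}
    (hA : IsOpen A) (hpos : ∃ z ∈ A, 0 < z.2) : intensity lam F A ≠ 0 := by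
  have := hF.isProb
  obtain ⟨⟨x, y⟩, hz, hy⟩ := hpos
  obtain ⟨U, V, hU, hV, hxU, hyV, hUV⟩ := isOpen_prod_iff.1 hA x y hz
  obtain ⟨c, hyc, hcV⟩ := exists_Ico_subset_of_mem_nhds (hV.mem_nhds hyV) ⟨y + 1, lt_add_one y⟩
  obtain ⟨d, hyd, hdc⟩ := exists_between hyc
  have hFV : F V ≠ 0 := fun h0 => hF.pos y d hy.le hyd
    (measure_mono_null (fun t ht => hcV ⟨ht.1.le, ht.2.trans_lt hdc⟩) h0)
  refine mt (measure_mono_null hUV) ?_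
  rw [intensity, Measure.prod_prod]
  exact mul_ne_zero (mul_ne_zero (by exact_mod_cast hlam.ne') (hU.measure_pos volume ⟨x, hxU⟩).ne')
    hFV

variable {A B : Set (Plane × ℝ)} {z : ℕ → Plane × ℝ}

lemma total_le_add_tsum_indicator {D : Set (Plane × ℝ)} {i j : ℕ}
    (hD : ∀ k, k ≠ i → k ≠ j → z k ∈ D) :
    total α z ≤ power α (z i) + (power α (z j) + ∑' k, D.indicator (power α) (z k)) := by
  have hle : ∀ k, power α (z k) ≤ (if k = i then power α (z i) else 0) +
      ((if k = j then power α (z j) else 0) + D.indicator (power α) (z k)) := fun k => by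
    rcases eq_or_ne k i with rfl | hki
    · simp
    rcases eq_or_ne k j with rfl | hkj
    · simp [hki]
    · simp [hki, hkj, hD k hki hkj]
  refine (ENNReal.tsum_le_tsum hle).trans_eq ?_
  rw [ENNReal.tsum_add, ENNReal.tsum_add, tsum_ite_eq, tsum_ite_eq]

lemma shiftCovers_and_not_closestCovers_of_num_eq_one (hα : 0 < α) (hθ : 0 ≤ θ) (ha : 0 < a)
    (hab : a < b) (hε : 0 ≤ ε) (h : IsGood α z)
    (hdom : ∀ p ∈ A, ∀ q ∈ B, IsDominant α θ a b R ε p q) (hnumA : num A z = 1)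
    (hnumB : num B z = 1)
    (hrest : ∑' i, (A ∪ B)ᶜ.indicator (farPower α R) (z i) ≤ ENNReal.ofReal ε) :
    ShiftCovers α θ a b z ∧ ¬ClosestCovers α θ z := by
  obtain ⟨i, hi⟩ := one_le_num.1 hnumA.ge
  obtain ⟨j, hj⟩ := one_le_num.1 hnumB.ge
  have hmem : ∀ k, k ≠ i → k ≠ j → z k ∈ (A ∪ B)ᶜ := by
    rintro k hki hkj (hk | hk)
    · exact absurd (two_le_num hki hk hi) (by rw [hnumA]; norm_num)
    · exact absurd (two_le_num hkj hk hj) (by rw [hnumB]; norm_num)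
  refine (hdom _ hi _ hj).shiftCovers_and_not_closestCovers hα hθ ha hab hε h
    (fun k hki hkj => ?_) ((total_le_add_tsum_indicator hmem).trans ?_)
  · by_contra! hk
    have hle := (ENNReal.le_tsum k).trans hrest
    rw [Set.indicator_of_mem (hmem k hki hkj), farPower, if_pos hk] at hle
    exact ENNReal.ofReal_ne_top (top_unique hle)
  · gcongr
    refine (ENNReal.tsum_le_tsum fun k => ?_).trans hrest
    exact Set.indicator_le_indicator (power_le_farPower α R _)

variable {Ω : Type*} [MeasurableSpace Ω] {P : Measure Ω} [IsProbabilityMeasure P]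
  {Z : ℕ → Ω → Plane × ℝ}

lemma IsPoisson.measure_num_eq_one_and_tsum_farPower_le_ne_zero (hα : 2 < α) (hF : IsFading α F)
    (hZ : IsPoisson P Z (intensity lam F)) (hA : MeasurableSet A) (hB : MeasurableSet B)
    (hdisj : Disjoint A B) (hA0 : intensity lam F A ≠ 0) (hAfin : intensity lam F A ≠ ⊤)
    (hB0 : intensity lam F B ≠ 0) (hBfin : intensity lam F B ≠ ⊤) {δ : ℝ≥0∞} (hδ : 0 < δ) :
    P {ω | num A (fun i => Z i ω) = 1 ∧ num B (fun i => Z i ω) = 1 ∧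
      ∑' i, (A ∪ B)ᶜ.indicator (farPower α R) (Z i ω) ≤ δ} ≠ 0 := by
  have hN := (hA.union hB).compl
  have hdisjA : Disjoint A (A ∪ B)ᶜ := disjoint_compl_right.mono_left le_sup_left
  have hdisjB : Disjoint B (A ∪ B)ᶜ := disjoint_compl_right.mono_left le_sup_right
  have hindep := hZ.measure_forall_tsum_ne_zero (A := ![A, B, (A ∪ B)ᶜ])
    (f := ![fun _ => 1, fun _ => 1, farPower α R]) (S := ![{1}, {1}, Set.Iic δ]) ?_ ?_ ?_ ?_ ?_
  · refine mt (measure_mono_null fun ω hω => ?_) hindep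
    exact ⟨hω 0, hω 1, hω 2⟩
  · intro j
    fin_cases j
    exacts [hA, hB, hN]
  · intro i j hij
    fin_cases i <;> fin_cases j <;> first
      | exact absurd rfl hij
      | assumption
      | exact Disjoint.symm ‹_›
  · simpa [Fin.forall_fin_succ] using measurable_farPower α R
  · simp [Fin.forall_fin_succ]
  · have hrest := hZ.measure_tsum_le_ne_zero ((measurable_farPower α R).indicator hN)
      (ne_top_of_le_ne_top (lintegral_one_sub_expNeg_farPower_ne_top hα hF R)
        (lintegral_mono fun z => one_sub_expNeg_mono (Set.indicator_le_self' (by simp) z))) hδ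
    intro j
    fin_cases j
    exacts [hZ.measure_num_eq_one_ne_zero hA hA0 hAfin,
      hZ.measure_num_eq_one_ne_zero hB hB0 hBfin, hrest]

theorem IsPoisson.measure_shiftCovers_and_not_closestCovers_ne_zero (hα : 2 < α) (hθ : 0 < θ)
    (hlam : 0 < lam) (ha : 0 < a) (hab : a < b) (hF : IsFading α F) (hF' : IsPosLaw F)
    (hZ : IsPoisson P Z (intensity lam F)) :
    P {ω | ShiftCovers α θ a b (fun i => Z i ω) ∧ ¬ClosestCovers α θ fun i => Z i ω} ≠ 0 := by
  have hα0 : 0 < α := two_pos.trans hα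
  have := hF.isProb
  obtain ⟨R, ε, A, B, hε, hA, hB, ⟨p, hp⟩, ⟨q, hq⟩, hdom⟩ :=
    exists_isOpen_isDominant hα0 hθ ha hab
  have hdisj : Disjoint A B := Set.disjoint_left.2 fun z hzA hzB =>
    lt_irrefl _ (hdom z hzA z hzB).norm_lt_norm
  have hAfin : intensity lam F A ≠ ⊤ := ne_top_of_le_ne_top (intensity_norm_fst_lt_ne_top R)
    (measure_mono fun z hz => (hdom z hz q hq).norm_lt)
  have hBfin : intensity lam F B ≠ ⊤ := ne_top_of_le_ne_top (intensity_norm_fst_lt_ne_top R)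
    (measure_mono fun z hz => (hdom p hp z hz).norm_lt_norm.trans (hdom p hp z hz).norm_lt)
  have hA0 := intensity_ne_zero_of_isOpen hlam hF' hA ⟨p, hp, (hdom p hp q hq).gain_pos_fst⟩
  have hB0 := intensity_ne_zero_of_isOpen hlam hF' hB ⟨q, hq, (hdom p hp q hq).gain_pos_snd⟩
  refine fun h0 => hZ.measure_num_eq_one_and_tsum_farPower_le_ne_zero (R := R) hα hF
    hA.measurableSet hB.measurableSet hdisj hA0 hAfin hB0 hBfin (ENNReal.ofReal_pos.2 hε) ?_
  refine measure_mono_null (fun ω ⟨hnumA, hnumB, hrest⟩ => or_iff_not_imp_right.2 fun hgood => ?_)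
    (measure_union_null h0 (ae_iff.1 (hZ.ae_isGood hα hlam hF)))
  exact shiftCovers_and_not_closestCovers_of_num_eq_one hα0 hθ.le ha hab hε.le (not_not.1 hgood)
    hdom hnumA hnumB hrest

end Strict

/-! ### The Mecke formula and the mean number of covering points -/

section Mecke

variable {Ω E : Type*} [MeasurableSpace Ω] [MeasurableSpace E] {P : Measure Ω}
  [IsProbabilityMeasure P] {Z : ℕ → Ω → E} {Λ : Measure E} {v : E → ℝ≥0∞}

lemma IsPoisson.lintegral_tsum_indicator_mul_expNeg_nsmul (hZ : IsPoisson P Z Λ)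
    (hv : Measurable v) {A : Set E} (hA : MeasurableSet A) (n : ℕ) :
    ∫⁻ ω, (∑' i, A.indicator 1 (Z i ω)) * expNeg (n • ∑' j, v (Z j ω)) ∂P =
      ∫⁻ z in A, ∫⁻ ω, expNeg (n • (v z + ∑' j, v (Z j ω))) ∂P ∂Λ := by
  have hnv : Measurable fun z => n • v z := hv.const_smul n
  have htsum : ∀ ω, n • ∑' j, v (Z j ω) = ∑' j, n • v (Z j ω) := fun ω => by
    simp_rw [nsmul_eq_mul, ENNReal.tsum_mul_left]
  have hinner : ∀ z, ∫⁻ ω, expNeg (n • (v z + ∑' j, v (Z j ω))) ∂P =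
      expNeg (n • v z) * expNeg (∫⁻ z, (1 - expNeg (n • v z)) ∂Λ) := fun z => by
    simp_rw [smul_add, htsum, expNeg_add]
    rw [lintegral_const_mul _ (measurable_expNeg.fun_comp (hZ.measurable_tsum hnv)),
      hZ.laplace _ hnv]
  simp_rw [htsum, hinner]
  rw [hZ.lintegral_tsum_mul_expNeg (measurable_one.indicator hA) hnv,
    lintegral_mul_const _ (measurable_expNeg.fun_comp hnv), ← lintegral_indicator hA]
  congr 2 with z
  by_cases hz : z ∈ A <;> simp [hz]

lemma IsPoisson.tsum_measure_prod_eq_lintegral (hZ : IsPoisson P Z Λ) (hv : Measurable v)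
    {A : Set E} (hA : MeasurableSet A) (hfin : Λ A ≠ ⊤) {S : Set ℝ≥0∞} (hS : MeasurableSet S) :
    ∑' i, P {ω | Z i ω ∈ A ∧ ∑' j, v (Z j ω) ∈ S} =
      ∫⁻ z, P {ω | z ∈ A ∧ v z + ∑' j, v (Z j ω) ∈ S} ∂Λ := by
  have hT : Measurable fun ω => ∑' j, v (Z j ω) := hZ.measurable_tsum hv
  have hvT : Measurable fun q : E × Ω => v q.1 + ∑' j, v (Z j q.2) :=
    (hv.comp measurable_fst).add (hT.comp measurable_snd)
  have hZA : ∀ i, MeasurableSet {ω | Z i ω ∈ A} := fun i => hZ.measurable i hA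
  have hexp : ∀ n : ℕ, Measurable fun x : ℝ≥0∞ => expNeg (n • x) := fun n =>
    measurable_expNeg.fun_comp (measurable_const_smul n)
  let μ := Measure.sum fun i => (P.restrict {ω | Z i ω ∈ A}).map fun ω => ∑' j, v (Z j ω)
  let ν := ((Λ.restrict A).prod P).map fun q => v q.1 + ∑' j, v (Z j q.2)
  have hlaplace : ∀ n : ℕ, ∫⁻ x, expNeg (n • x) ∂μ = ∫⁻ x, expNeg (n • x) ∂ν := fun n => by
    rw [lintegral_map (hexp n) hvT, lintegral_prod _ ((hexp n).fun_comp hvT).aemeasurable,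
      ← hZ.lintegral_tsum_indicator_mul_expNeg_nsmul hv hA, lintegral_sum_measure]
    simp_rw [← ENNReal.tsum_mul_right]
    rw [lintegral_tsum fun i => (((measurable_one.indicator hA).fun_comp (hZ.measurable i)).fun_mul
      ((hexp n).fun_comp hT)).aemeasurable]
    refine tsum_congr fun i => ?_
    rw [lintegral_map (hexp n) hT, ← lintegral_indicator (hZA i)]
    refine lintegral_congr fun ω => ?_
    by_cases hω : Z i ω ∈ A <;> simp [hω]
  have hmass : μ Set.univ = ν Set.univ := by simpa using hlaplace 0
  have : IsFiniteMeasure (Λ.restrict A) := ⟨by simpa using hfin.lt_top⟩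
  have : IsFiniteMeasure μ := ⟨hmass ▸ measure_lt_top ν _⟩
  have heq : μ S = ν S := by rw [measure_eq_of_laplace_nsmul hlaplace]
  rw [Measure.sum_apply _ hS, Measure.map_apply hvT hS, Measure.prod_apply (hvT hS)] at heq
  calc ∑' i, P {ω | Z i ω ∈ A ∧ ∑' j, v (Z j ω) ∈ S}
      = ∑' i, (P.restrict {ω | Z i ω ∈ A}).map (fun ω => ∑' j, v (Z j ω)) S := by
        refine tsum_congr fun i => ?_
        rw [Measure.map_apply hT hS, Measure.restrict_apply (hT hS), Set.inter_comm]
        rfl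
    _ = ∫⁻ z in A, P {ω | v z + ∑' j, v (Z j ω) ∈ S} ∂Λ := heq
    _ = ∫⁻ z, P {ω | z ∈ A ∧ v z + ∑' j, v (Z j ω) ∈ S} ∂Λ := by
        rw [← lintegral_indicator hA]
        refine lintegral_congr fun z => ?_
        by_cases hz : z ∈ A <;> simp [hz]

lemma measure_eq_of_prod_of_sigmaFinite {F : Type*} [MeasurableSpace F] (Λ : Measure E)
    [SigmaFinite Λ] {μ ν : Measure (E × F)}
    (hrect : ∀ {A S}, MeasurableSet A → Λ A ≠ ⊤ → MeasurableSet S → μ (A ×ˢ S) = ν (A ×ˢ S))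
    (hfin : ∀ {A}, MeasurableSet A → Λ A ≠ ⊤ → ν (A ×ˢ Set.univ) ≠ ⊤) : μ = ν := by
  have hΛ : ∀ n, Λ (spanningSets Λ n) ≠ ⊤ := fun n => (measure_spanningSets_lt_top Λ n).ne
  refine Measure.ext_of_generateFrom_of_cover
    (T := Set.range fun n => spanningSets Λ n ×ˢ (Set.univ : Set F))
    generateFrom_prod.symm (Set.countable_range _) isPiSystem_prod ?_ ?_ ?_ ?_
  · rw [Set.sUnion_range, ← Set.iUnion_prod_const, iUnion_spanningSets, Set.univ_prod_univ]
  · rintro _ ⟨n, rfl⟩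
    rw [hrect (measurableSet_spanningSets Λ n) (hΛ n) .univ]
    exact hfin (measurableSet_spanningSets Λ n) (hΛ n)
  · rintro _ ⟨n, rfl⟩ _ ⟨A, hA, S, hS, rfl⟩
    rw [Set.prod_inter_prod, Set.inter_univ]
    exact hrect (hA.inter (measurableSet_spanningSets Λ n))
      (measure_ne_top_of_subset Set.inter_subset_right (hΛ n)) hS
  · rintro _ ⟨n, rfl⟩
    exact hrect (measurableSet_spanningSets Λ n) (hΛ n) .univ

theorem IsPoisson.tsum_measure_eq_lintegral [SigmaFinite Λ] (hZ : IsPoisson P Z Λ)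
    (hv : Measurable v) {C : Set (E × ℝ≥0∞)} (hC : MeasurableSet C) :
    ∑' i, P {ω | (Z i ω, ∑' j, v (Z j ω)) ∈ C} =
      ∫⁻ z, P {ω | (z, v z + ∑' j, v (Z j ω)) ∈ C} ∂Λ := by
  have hT : Measurable fun ω => ∑' j, v (Z j ω) := hZ.measurable_tsum hv
  have hZT : ∀ i, Measurable fun ω => (Z i ω, ∑' j, v (Z j ω)) := fun i =>
    (hZ.measurable i).prodMk hT
  have hvT : Measurable fun q : E × Ω => (q.1, v q.1 + ∑' j, v (Z j q.2)) :=
    measurable_fst.prodMk ((hv.comp measurable_fst).add (hT.comp measurable_snd))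
  let μ := Measure.sum fun i => P.map fun ω => (Z i ω, ∑' j, v (Z j ω))
  let ν := (Λ.prod P).map fun q => (q.1, v q.1 + ∑' j, v (Z j q.2))
  have hμ : ∀ {C}, MeasurableSet C → μ C = ∑' i, P {ω | (Z i ω, ∑' j, v (Z j ω)) ∈ C} :=
    fun hC => by
      rw [Measure.sum_apply _ hC]
      exact tsum_congr fun i => Measure.map_apply (hZT i) hC
  have hν : ∀ {C}, MeasurableSet C → ν C = ∫⁻ z, P {ω | (z, v z + ∑' j, v (Z j ω)) ∈ C} ∂Λ :=
    fun hC => by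
      rw [Measure.map_apply hvT hC, Measure.prod_apply (hvT hC)]
      rfl
  have hrect : ∀ {A S}, MeasurableSet A → Λ A ≠ ⊤ → MeasurableSet S →
      μ (A ×ˢ S) = ν (A ×ˢ S) := fun {A S} hA hfin hS => by
    rw [hμ (hA.prod hS), hν (hA.prod hS)]
    exact hZ.tsum_measure_prod_eq_lintegral hv hA hfin hS
  have hmass : ∀ {A}, MeasurableSet A → ν (A ×ˢ Set.univ) = Λ A := fun {A} hA => by
    rw [Measure.map_apply hvT (hA.prod .univ), ← mul_one (Λ A), ← measure_univ (μ := P),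
      ← Measure.prod_prod, Set.prod_univ, Set.prod_univ]
    rfl
  have hμν : μ = ν := measure_eq_of_prod_of_sigmaFinite Λ hrect fun hA hfin => by rwa [hmass hA]
  rw [← hμ hC, ← hν hC, hμν]

end Mecke

section Rayleigh

variable {α θ : ℝ}

lemma IsCovering.unique {z : ℕ → Plane × ℝ} {i k : ℕ} (hθ : 1 ≤ θ)
    (hi : IsCovering α θ z i) (hk : IsCovering α θ z k) : i = k := by
  by_contra hik
  have hle : power α (z i) + power α (z k) ≤ total α z := by
    rw [← Finset.sum_pair (f := fun k => power α (z k)) hik]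
    exact ENNReal.sum_le_tsum _
  have hθ2 : ENNReal.ofReal (1 + θ) ≤ ENNReal.ofReal θ * 2 := by
    rw [← ENNReal.ofReal_ofNat, ← ENNReal.ofReal_mul (by linarith)]
    exact ENNReal.ofReal_le_ofReal (by linarith)
  refine lt_irrefl (ENNReal.ofReal θ * 2 * total α z) ?_
  calc ENNReal.ofReal θ * 2 * total α z
      = ENNReal.ofReal θ * total α z + ENNReal.ofReal θ * total α z := by ring
    _ < ENNReal.ofReal (1 + θ) * power α (z i) + ENNReal.ofReal (1 + θ) * power α (z k) :=
        ENNReal.add_lt_add hi hk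
    _ = ENNReal.ofReal (1 + θ) * (power α (z i) + power α (z k)) := (mul_add _ _ _).symm
    _ ≤ ENNReal.ofReal θ * 2 * total α z := by gcongr

lemma IsPoisson.measurableSet_isCovering {Ω : Type*} [MeasurableSpace Ω] {P : Measure Ω}
    {Z : ℕ → Ω → Plane × ℝ} {Λ : Measure (Plane × ℝ)} (hZ : IsPoisson P Z Λ) (α θ : ℝ) (i : ℕ) :
    MeasurableSet {ω | IsCovering α θ (fun i => Z i ω) i} :=
  measurableSet_lt ((hZ.measurable_tsum (measurable_power α)).const_mul _)
    (((measurable_power α).comp (hZ.measurable i)).const_mul _)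

lemma gammaMeasure_one_one_Ioi {t : ℝ} (ht : 0 ≤ t) :
    gammaMeasure 1 1 (Set.Ioi t) = ENNReal.ofReal (Real.exp (-t)) := by
  have := isProbabilityMeasure_gammaMeasure one_pos one_pos
  have hcdf : cdf (gammaMeasure 1 1) t = 1 - Real.exp (-t) := by
    have h := cdf_expMeasure_eq one_pos t
    rwa [if_pos ht, one_mul] at h
  rw [← Set.compl_Iic, prob_compl_eq_one_sub measurableSet_Iic, ← ofReal_cdf, hcdf,
    ← ENNReal.ofReal_one, ← ENNReal.ofReal_sub _ (by simpa using ht), sub_sub_cancel]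

lemma gammaMeasure_one_one_lt_power {x : Plane} (hx : 0 < ‖x‖) (c : ℝ≥0∞) :
    gammaMeasure 1 1 {y | c < power α (x, y)} = expNeg (ENNReal.ofReal (‖x‖ ^ α) * c) := by
  have hxα : 0 < ‖x‖ ^ α := by positivity
  rcases eq_or_ne c ⊤ with rfl | hc
  · simp [ENNReal.mul_top (ENNReal.ofReal_pos.2 hxα).ne']
  · lift c to ℝ≥0 using hc
    rw [← ENNReal.ofReal_coe_nnreal, ← ENNReal.ofReal_mul hxα.le, expNeg_ofReal (by positivity),
      ← gammaMeasure_one_one_Ioi (by positivity)]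
    refine measure_congr (eventuallyEq_set.2 ?_)
    filter_upwards [ae_pos_gammaMeasure one_pos one_pos] with y hy
    change ENNReal.ofReal c < power α (x, y) ↔ ‖x‖ ^ α * c < y
    rw [power_of_pos hx hy.le, ENNReal.ofReal_lt_ofReal_iff_of_nonneg c.coe_nonneg,
      Real.rpow_neg hx.le, ← div_eq_mul_inv, lt_div_iff₀ hxα, mul_comm]

lemma lintegral_exp_neg_mul_sq_norm {V : Type*} [NormedAddCommGroup V] [InnerProductSpace ℝ V]
    [FiniteDimensional ℝ V] [MeasurableSpace V] [BorelSpace V] {b : ℝ} (hb : 0 < b) :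
    ∫⁻ x : V, ENNReal.ofReal (Real.exp (-b * ‖x‖ ^ 2)) =
      ENNReal.ofReal ((Real.pi / b) ^ (Module.finrank ℝ V / 2 : ℝ)) := by
  have h := GaussianFourier.integral_rexp_neg_mul_sq_norm (V := V) hb
  have hint : Integrable fun x : V => Real.exp (-b * ‖x‖ ^ 2) :=
    Integrable.of_integral_ne_zero (h ▸ (Real.rpow_pos_of_pos (div_pos Real.pi_pos hb) _).ne')
  rw [← ofReal_integral_eq_lintegral_ofReal hint (ae_of_all _ fun x => (Real.exp_pos _).le), h]

variable {Ω : Type*} [MeasurableSpace Ω] {P : Measure Ω} [IsProbabilityMeasure P]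
  {Z : ℕ → Ω → Plane × ℝ} {lam : ℝ≥0}

lemma lintegral_measure_lt_power_gammaMeasure_one_one {T : Ω → ℝ≥0∞} (hT : Measurable T)
    {x : Plane} (hx : 0 < ‖x‖) :
    ∫⁻ y, P {ω | T ω < power α (x, y)} ∂(gammaMeasure 1 1) =
      ∫⁻ ω, expNeg (ENNReal.ofReal (‖x‖ ^ α) * T ω) ∂P := by
  have := isProbabilityMeasure_gammaMeasure one_pos one_pos
  have hmeas : MeasurableSet {q : ℝ × Ω | T q.2 < power α (x, q.1)} :=
    measurableSet_lt (hT.comp measurable_snd)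
      ((measurable_power α).comp (measurable_const.prodMk measurable_fst))
  rw [← lintegral_congr fun ω => gammaMeasure_one_one_lt_power hx (T ω)]
  exact (Measure.prod_apply hmeas).symm.trans (Measure.prod_apply_symm hmeas)

namespace IsPoisson

lemma lintegral_measure_mul_tsum_lt_power (hα : 2 < α) (hθ : 0 < θ)
    (hZ : IsPoisson P Z (intensity lam (gammaMeasure 1 1))) {x : Plane} (hx : 0 < ‖x‖) :
    ∫⁻ y, P {ω | ENNReal.ofReal θ * ∑' j, power α (Z j ω) < power α (x, y)} ∂(gammaMeasure 1 1) =
      ENNReal.ofReal (Real.exp (-(lam * (Real.pi * Real.Gamma (1 - 2 / α)) *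
        Real.Gamma (1 + 2 / α) * θ ^ (2 / α)) * ‖x‖ ^ 2)) := by
  have hα0 : 0 < α := by linarith
  have hδ : 0 < 1 - 2 / α := sub_pos.2 ((div_lt_one hα0).2 hα)
  have _ : 0 < Real.Gamma (1 - 2 / α) := Real.Gamma_pos_of_pos hδ
  have _ : 0 < Real.Gamma (1 + 2 / α) := Real.Gamma_pos_of_pos (by positivity)
  have hpow := measurable_power α
  have hnorm : (‖x‖ ^ α * θ) ^ (2 / α) = ‖x‖ ^ 2 * θ ^ (2 / α) := by
    rw [Real.mul_rpow (by positivity) hθ.le, ← Real.rpow_mul hx.le, mul_div_cancel₀ _ hα0.ne',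
      Real.rpow_two]
  have hmoment : gammaMoment 1 1 (2 / α) = Real.Gamma (1 + 2 / α) := by
    rw [gammaMoment, Real.Gamma_one, Real.one_rpow, mul_one, div_one]
  rw [lintegral_measure_lt_power_gammaMeasure_one_one ((hZ.measurable_tsum hpow).const_mul _) hx]
  simp_rw [← mul_assoc, ← ENNReal.ofReal_mul (show 0 ≤ ‖x‖ ^ α by positivity),
    ← ENNReal.tsum_mul_left]
  rw [hZ.laplace _ (hpow.const_mul _), lintegral_one_sub_expNeg_power hα
    (isFading_gammaMeasure hα0 one_pos one_pos) (by positivity),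
    lintegral_rpow_gammaMeasure one_pos one_pos (by positivity), hmoment, hnorm,
    ← ENNReal.ofReal_mul (by positivity), expNeg_ofReal (by positivity)]
  congr 2
  ring

lemma tsum_measure_isCovering_eq_lintegral {F : Measure ℝ} [SigmaFinite F] (hθ : 0 ≤ θ)
    (hZ : IsPoisson P Z (intensity lam F)) :
    ∑' i, P {ω | IsCovering α θ (fun i => Z i ω) i} =
      ∫⁻ z, P {ω | ENNReal.ofReal θ * ∑' j, power α (Z j ω) < power α z} ∂(intensity lam F) := by
  have : SigmaFinite (intensity lam F) := by
    unfold intensity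
    infer_instance
  have hpow := measurable_power α
  have hmeas : MeasurableSet {q : (Plane × ℝ) × ℝ≥0∞ |
      ENNReal.ofReal θ * q.2 < ENNReal.ofReal (1 + θ) * power α q.1} :=
    measurableSet_lt (measurable_snd.const_mul _) ((hpow.comp measurable_fst).const_mul _)
  refine (hZ.tsum_measure_eq_lintegral hpow hmeas).trans (lintegral_congr_ae ?_)
  filter_upwards [ae_intensity_fst (p := fun x => 0 < ‖x‖) (by simp [ae_iff])] with z hz
  congr 1 with ω
  change ENNReal.ofReal θ * (power α z + ∑' j, power α (Z j ω)) <
    ENNReal.ofReal (1 + θ) * power α z ↔ ENNReal.ofReal θ * ∑' j, power α (Z j ω) < power α z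
  rw [mul_add, ENNReal.ofReal_add zero_le_one hθ, ENNReal.ofReal_one, add_mul, one_mul,
    add_comm (power α z), ENNReal.add_lt_add_iff_left
    (ENNReal.mul_ne_top ENNReal.ofReal_ne_top (power_ne_top hz))]

theorem tsum_measure_isCovering (hα : 2 < α) (hθ : 0 < θ) (hlam : 0 < lam)
    (hZ : IsPoisson P Z (intensity lam (gammaMeasure 1 1))) :
    ∑' i, P {ω | IsCovering α θ (fun i => Z i ω) i} =
      ENNReal.ofReal (1 / (Real.Gamma (1 - 2 / α) * Real.Gamma (1 + 2 / α) * θ ^ (2 / α))) := by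
  have := isProbabilityMeasure_gammaMeasure one_pos one_pos
  have hδ : 0 < 1 - 2 / α := sub_pos.2 ((div_lt_one (by linarith)).2 hα)
  have _ : 0 < Real.Gamma (1 - 2 / α) := Real.Gamma_pos_of_pos hδ
  have _ : 0 < Real.Gamma (1 + 2 / α) := Real.Gamma_pos_of_pos (by positivity)
  have _ : (0 : ℝ) < lam := hlam
  have hmeas : Measurable fun z => P {ω | ENNReal.ofReal θ * ∑' j, power α (Z j ω) < power α z} :=
    measurable_measure_prodMk_left (measurableSet_lt
      (((hZ.measurable_tsum (measurable_power α)).comp measurable_snd).const_mul _)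
      ((measurable_power α).comp measurable_fst))
  have hnorm : ∀ᵐ x : Plane, 0 < ‖x‖ := by simp [ae_iff]
  rw [hZ.tsum_measure_isCovering_eq_lintegral hθ.le, intensity,
    lintegral_prod _ hmeas.aemeasurable, lintegral_smul_measure,
    lintegral_congr_ae (hnorm.mono fun x hx => hZ.lintegral_measure_mul_tsum_lt_power hα hθ hx),
    lintegral_exp_neg_mul_sq_norm (by positivity), finrank_euclideanSpace_fin, Nat.cast_ofNat,
    div_self two_ne_zero, Real.rpow_one, ENNReal.smul_def, smul_eq_mul,
    ← ENNReal.ofReal_coe_nnreal, ← ENNReal.ofReal_mul lam.coe_nonneg]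
  congr 1
  field_simp

theorem measure_exists_isCovering (hα : 2 < α) (hθ : 1 ≤ θ) (hlam : 0 < lam)
    (hZ : IsPoisson P Z (intensity lam (gammaMeasure 1 1))) :
    P {ω | ∃ i, IsCovering α θ (fun i => Z i ω) i} =
      ENNReal.ofReal (1 / (Real.Gamma (1 - 2 / α) * Real.Gamma (1 + 2 / α) * θ ^ (2 / α))) := by
  rw [← hZ.tsum_measure_isCovering hα (by linarith) hlam, Set.ofPred_exists,
    measure_iUnion _ (hZ.measurableSet_isCovering α θ)]
  exact fun i k hik => Set.disjoint_left.2 fun ω (hi : IsCovering α θ (fun i => Z i ω) i) hk =>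
    hik (hi.unique hθ hk)

end IsPoisson

lemma two_mul_zetaCoeff_one (hα : α ≠ 0) :
    2 * zetaCoeff α 1 = Real.Gamma (1 - 2 / α) * Real.Gamma (1 + 2 / α) := by
  have hΓ := Real.Gamma_add_one (s := -(2 / α)) (by simpa using hα)
  rw [neg_add_eq_sub] at hΓ
  rw [zetaCoeff, hΓ, Real.Gamma_one]
  field_simp

end Rayleigh

/-! ### Coverage probabilities of networks -/

section Coverage

variable {α θ a b : ℝ} {lam : ℝ≥0} {F : Measure ℝ}

section

variable {Ω : Type*} [MeasurableSpace Ω] {P : Measure Ω} [IsProbabilityMeasure P]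
  {X : ℕ → Ω → Plane} {g : ℕ → Ω → ℝ}

namespace IsNetwork

lemma coverageClosest_eq (hα : 2 < α) (hθ : 0 ≤ θ) (hlam : 0 < lam) (hF : IsFading α F)
    (h : IsNetwork P X g lam F) :
    coverageClosest P X g α θ = P.real {ω | ClosestCovers α θ fun i => (X i ω, g i ω)} := by
  have := hF.isProb
  refine measureReal_congr (eventuallyEq_set.2 ?_)
  filter_upwards [h.isPoisson.ae_isGood hα hlam hF] with ω hω
  exact exists_lt_sir_closest_iff hθ hω

lemma coverageStrongest_eq (hα : 2 < α) (hθ : 0 ≤ θ) (hlam : 0 < lam) (hF : IsFading α F)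
    (h : IsNetwork P X g lam F) :
    coverageStrongest P X g α θ =
      P.real {ω | ∃ i, IsCovering α θ (fun i => (X i ω, g i ω)) i} := by
  have := hF.isProb
  refine measureReal_congr (eventuallyEq_set.2 ?_)
  filter_upwards [h.isPoisson.ae_isGood hα hlam hF] with ω hω
  exact exists_lt_sir_strongest_iff hθ hω

variable {Ω' : Type*} [MeasurableSpace Ω'] {P' : Measure Ω'} [IsProbabilityMeasure P']
  {Z : ℕ → Ω' → Plane × ℝ} {X' : ℕ → Ω' → Plane} {g' : ℕ → Ω' → ℝ}

lemma coverageClosest_eq_of_isPoisson (hα : 2 < α) (hθ : 0 ≤ θ) (hlam : 0 < lam)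
    (hF : IsFading α F) (h : IsNetwork P X g lam F) (hZ : IsPoisson P' Z (intensity lam F)) :
    coverageClosest P X g α θ = P'.real {ω | ClosestCovers α θ fun i => Z i ω} := by
  have := hF.isProb
  rw [h.coverageClosest_eq hα hθ hlam hF, measureReal_def,
    h.isPoisson.measure_closestCovers_eq hα hlam hF hZ, measureReal_def]

lemma coverageClosest_congr (hα : 2 < α) (hθ : 0 ≤ θ) (hlam : 0 < lam) (hF : IsFading α F)
    (h : IsNetwork P X g lam F) (h' : IsNetwork P' X' g' lam F) :
    coverageClosest P X g α θ = coverageClosest P' X' g' α θ := by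
  have := hF.isProb
  rw [h.coverageClosest_eq_of_isPoisson hα hθ hlam hF h'.isPoisson,
    h'.coverageClosest_eq hα hθ hlam hF]

end IsNetwork

end

lemma tendsto_measureReal_of_ae_eventually_mem_iff {Ω ι : Type*} [MeasurableSpace Ω]
    {P : Measure Ω} [IsFiniteMeasure P] {l : Filter ι} [l.IsCountablyGenerated] {A : ι → Set Ω}
    {B : Set Ω} (hA : ∀ᶠ i in l, NullMeasurableSet (A i) P) (hB : NullMeasurableSet B P)
    (h : ∀ᵐ ω ∂P, ∀ᶠ i in l, ω ∈ A i ↔ ω ∈ B) :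
    Tendsto (fun i => P.real (A i)) l (𝓝 (P.real B)) := by
  have hint : ∀ {S : Set Ω}, NullMeasurableSet S P → ∫ ω, S.indicator 1 ω ∂P = P.real S :=
    fun hS => by simp [integral_indicator₀ hS]
  have hlim : Tendsto (fun i => ∫ ω, (A i).indicator (1 : Ω → ℝ) ω ∂P) l
      (𝓝 (∫ ω, B.indicator 1 ω ∂P)) := by
    refine tendsto_integral_filter_of_dominated_convergence 1 ?_ ?_ (integrable_const 1) ?_
    · exact hA.mono fun i hi => aestronglyMeasurable_one.indicator₀ hi
    · exact .of_forall fun i => ae_of_all _ fun ω =>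
        (norm_indicator_le_norm_self _ _).trans (by simp)
    · filter_upwards [h] with ω hω
      exact tendsto_const_nhds.congr' (hω.mono fun i hi => Set.indicator_eq_indicator hi.symm rfl)
  rw [← hint hB]
  exact hlim.congr' (hA.mono fun i => hint)

section Coupling

variable {Ω : Type*} [MeasurableSpace Ω] {P : Measure Ω} [IsProbabilityMeasure P]
  {Z : ℕ → Ω → Plane × ℝ}

namespace IsPoisson

lemma closestCovers_shift_ae_eq (hα : 2 < α) (hlam : 0 < lam) (ha : 0 < a) (hb : 0 < b)
    (hZ : IsPoisson P Z (intensity lam (gammaMeasure a a))) :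
    {ω | ClosestCovers α θ fun i => shift α a b (Z i ω)} =ᵐ[P]
      {ω | ShiftCovers α θ a b fun i => Z i ω} := by
  have hα0 : 0 < α := two_pos.trans hα
  refine eventuallyEq_set.2 ?_
  filter_upwards [hZ.ae_isGood hα hlam (isFading_gammaMeasure hα0 ha ha)] with ω hω
  exact closestCovers_shift_iff hα0 ha hb hω

lemma nullMeasurableSet_shiftCovers (hα : 2 < α) (hlam : 0 < lam) (ha : 0 < a) (hb : 0 < b)
    (hZ : IsPoisson P Z (intensity lam (gammaMeasure a a))) :
    NullMeasurableSet {ω | ShiftCovers α θ a b fun i => Z i ω} P :=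
  have hα0 : 0 < α := two_pos.trans hα
  ((hZ.isPoisson_shift hα0 ha hb).nullMeasurableSet_closestCovers hα hlam
    (isFading_gammaMeasure hα0 hb hb)).congr (hZ.closestCovers_shift_ae_eq hα hlam ha hb)

lemma measureReal_closestCovers_lt_shiftCovers (hα : 2 < α) (hθ : 0 < θ) (hlam : 0 < lam)
    (ha : 0 < a) (hab : a < b) (hZ : IsPoisson P Z (intensity lam (gammaMeasure a a))) :
    P.real {ω | ClosestCovers α θ fun i => Z i ω} <
      P.real {ω | ShiftCovers α θ a b fun i => Z i ω} := by
  have hα0 : 0 < α := two_pos.trans hα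
  have hF := isFading_gammaMeasure hα0 ha ha
  set A := {ω | ClosestCovers α θ fun i => Z i ω}
  set B := {ω | ShiftCovers α θ a b fun i => Z i ω}
  have hAB : P A ≤ P (B ∩ A) := by
    refine measure_mono_ae ?_
    filter_upwards [hZ.ae_isGood hα hlam hF] with ω hω hcov
    exact ⟨ClosestCovers.shiftCovers hα0 ha hab hω hcov, hcov⟩
  have hdiff : P (B \ A) ≠ 0 := hZ.measure_shiftCovers_and_not_closestCovers_ne_zero hα hθ hlam ha
    hab hF (isPosLaw_gammaMeasure ha ha)
  refine (ENNReal.toReal_lt_toReal (measure_ne_top _ _) (measure_ne_top _ _)).2 ?_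
  calc P A < P A + P (B \ A) := ENNReal.lt_add_right (measure_ne_top _ _) hdiff
    _ ≤ P (B ∩ A) + P (B \ A) := by gcongr
    _ = P B := measure_inter_add_sdiff₀ B (hZ.nullMeasurableSet_closestCovers hα hlam hF)

end IsPoisson

lemma IsPoisson.tendsto_measureReal_shiftCovers (hα : 2 < α) (hlam : 0 < lam) (ha : 0 < a)
    (hZ : IsPoisson P Z (intensity lam (gammaMeasure a a))) :
    Tendsto (fun b => P.real {ω | ShiftCovers α θ a b fun i => Z i ω}) atTop
      (𝓝 (P.real {ω | ∃ i, IsCovering α θ (fun i => Z i ω) i})) := by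
  have hα0 : 0 < α := two_pos.trans hα
  have hB : MeasurableSet {ω | ∃ i, IsCovering α θ (fun i => Z i ω) i} := by
    rw [Set.ofPred_exists]
    exact .iUnion (hZ.measurableSet_isCovering α θ)
  refine tendsto_measureReal_of_ae_eventually_mem_iff
    ((eventually_gt_atTop 0).mono fun b hb => hZ.nullMeasurableSet_shiftCovers hα hlam ha hb)
    hB.nullMeasurableSet ?_
  filter_upwards [hZ.ae_isGood hα hlam (isFading_gammaMeasure hα0 ha ha)] with ω hω
  by_cases hcov : ∃ i, IsCovering α θ (fun i => Z i ω) i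
  · obtain ⟨i, hi⟩ := hcov
    filter_upwards [eventually_shiftCovers hα0 ha hω hi] with b hb using iff_of_true hb ⟨i, hi⟩
  · exact .of_forall fun b => iff_of_false (fun h => hcov (h.imp fun _ hi => hi.1)) hcov

variable {Ω' : Type*} [MeasurableSpace Ω'] {P' : Measure Ω'} [IsProbabilityMeasure P']
  {X : ℕ → Ω → Plane} {g : ℕ → Ω → ℝ} {X' : ℕ → Ω' → Plane} {g' : ℕ → Ω' → ℝ}

namespace IsNetwork

lemma coverageClosest_eq_shiftCovers (hα : 2 < α) (hθ : 0 ≤ θ) (hlam : 0 < lam) (ha : 0 < a)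
    (hb : 0 < b) (h : IsNetwork P' X' g' lam (gammaMeasure b b))
    (hZ : IsPoisson P Z (intensity lam (gammaMeasure a a))) :
    coverageClosest P' X' g' α θ = P.real {ω | ShiftCovers α θ a b fun i => Z i ω} := by
  have hα0 : 0 < α := two_pos.trans hα
  rw [h.coverageClosest_eq_of_isPoisson hα hθ hlam (isFading_gammaMeasure hα0 hb hb)
    (hZ.isPoisson_shift hα0 ha hb), measureReal_congr (hZ.closestCovers_shift_ae_eq hα hlam ha hb)]

theorem coverageClosest_lt_of_shape_lt (hα : 2 < α) (hθ : 0 < θ) (hlam : 0 < lam) (ha : 0 < a)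
    (hab : a < b) (h : IsNetwork P X g lam (gammaMeasure a a))
    (h' : IsNetwork P' X' g' lam (gammaMeasure b b)) :
    coverageClosest P X g α θ < coverageClosest P' X' g' α θ := by
  have hF := isFading_gammaMeasure (two_pos.trans hα) ha ha
  have := hF.isProb
  rw [h.coverageClosest_eq hα hθ.le hlam hF,
    h'.coverageClosest_eq_shiftCovers hα hθ.le hlam ha (ha.trans hab) h.isPoisson]
  exact h.isPoisson.measureReal_closestCovers_lt_shiftCovers hα hθ hlam ha hab

theorem tendsto_coverageClosest {ι : Type*} {l : Filter ι} {k : ι → ℝ} {Ω' : ι → Type*}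
    [∀ i, MeasurableSpace (Ω' i)] {P' : ∀ i, Measure (Ω' i)} [∀ i, IsProbabilityMeasure (P' i)]
    {X' : ∀ i, ℕ → Ω' i → Plane} {g' : ∀ i, ℕ → Ω' i → ℝ} (hα : 2 < α) (hθ : 0 ≤ θ)
    (hlam : 0 < lam) (ha : 0 < a) (hk : Tendsto k l atTop)
    (h : IsNetwork P X g lam (gammaMeasure a a))
    (h' : ∀ i, 0 < k i → IsNetwork (P' i) (X' i) (g' i) lam (gammaMeasure (k i) (k i))) :
    Tendsto (fun i => coverageClosest (P' i) (X' i) (g' i) α θ) l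
      (𝓝 (coverageStrongest P X g α θ)) := by
  have hF := isFading_gammaMeasure (two_pos.trans hα) ha ha
  have := hF.isProb
  rw [h.coverageStrongest_eq hα hθ hlam hF]
  refine ((h.isPoisson.tendsto_measureReal_shiftCovers hα hlam ha).comp hk).congr' ?_
  filter_upwards [hk.eventually_gt_atTop 0] with i hi
  exact ((h' i hi).coverageClosest_eq_shiftCovers hα hθ hlam ha hi h.isPoisson).symm

theorem coverageStrongest_nlosFading (hα : 2 < α) (hθ : 1 ≤ θ) (hlam : 0 < lam)
    (h : IsNetwork P X g lam nlosFading) :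
    coverageStrongest P X g α θ = 1 / (2 * zetaCoeff α 1 * θ ^ (2 / α)) := by
  have hα0 : 0 < α := two_pos.trans hα
  have hδ : 0 < 1 - 2 / α := sub_pos.2 ((div_lt_one hα0).2 hα)
  have _ : 0 < Real.Gamma (1 - 2 / α) := Real.Gamma_pos_of_pos hδ
  have _ : 0 < Real.Gamma (1 + 2 / α) := Real.Gamma_pos_of_pos (by positivity)
  have hF : IsFading α nlosFading := isFading_gammaMeasure hα0 one_pos one_pos
  have := hF.isProb
  rw [h.coverageStrongest_eq hα (by linarith) hlam hF, measureReal_def,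
    h.isPoisson.measure_exists_isCovering hα hθ hlam, ENNReal.toReal_ofReal (by positivity),
    two_mul_zetaCoeff_one hα0.ne']

end IsNetwork

end Coupling

end Coverage

end CellularNetwork

end

open CellularNetwork in
theorem mainTheorem3_general
    (α θ : ℝ) (hα : 2 < α) (hθ : 0 < θ) (lam : ℝ≥0) (hlam : 0 < lam)
    {ι : Type*} (k : ι → ℝ)
    {Ω : ι → Type*} [∀ i, MeasurableSpace (Ω i)]
    (P : ∀ i, Measure (Ω i)) [∀ i, IsProbabilityMeasure (P i)]
    (X : ∀ i, ℕ → Ω i → Plane) (g : ∀ i, ℕ → Ω i → ℝ)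
    (hLOS : ∀ i, 0 < k i → IsNetwork (P i) (X i) (g i) lam (gammaMeasure (k i) (k i)))
    {Ω' : Type*} [MeasurableSpace Ω'] (P' : Measure Ω') [IsProbabilityMeasure P']
    (X' : ℕ → Ω' → Plane) (g' : ℕ → Ω' → ℝ)
    (hNLOS : IsNetwork P' X' g' lam nlosFading) :
    (∀ i j, 0 < k i → k i < k j →
      coverageClosest (P i) (X i) (g i) α θ < coverageClosest (P j) (X j) (g j) α θ) ∧
    (∀ i, k i = 1 →
      coverageClosest (P i) (X i) (g i) α θ = coverageClosest P' X' g' α θ) ∧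
    (∀ i, 1 < k i →
      coverageClosest P' X' g' α θ < coverageClosest (P i) (X i) (g i) α θ) ∧
    (∀ l : Filter ι, Tendsto k l atTop →
      Tendsto (fun i => coverageClosest (P i) (X i) (g i) α θ) l
        (𝓝 (coverageStrongest P' X' g' α θ))) ∧
    (1 ≤ θ → coverageStrongest P' X' g' α θ = 1 / (2 * zetaCoeff α 1 * θ ^ (2 / α))) := by
  have hRayleigh : IsNetwork P' X' g' lam (gammaMeasure 1 1) := hNLOS
  refine ⟨fun i j hi hij => ?_, fun i hi => ?_, fun i hi => ?_, fun l hk => ?_, fun hθ1 => ?_⟩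
  · exact (hLOS i hi).coverageClosest_lt_of_shape_lt hα hθ hlam hi hij (hLOS j (hi.trans hij))
  · have hi' := hLOS i (by simp [hi])
    rw [hi] at hi'
    exact hi'.coverageClosest_congr hα hθ.le hlam
      (isFading_gammaMeasure (two_pos.trans hα) one_pos one_pos) hRayleigh
  · exact hRayleigh.coverageClosest_lt_of_shape_lt hα hθ hlam one_pos hi
      (hLOS i (one_pos.trans hi))
  · exact hRayleigh.tendsto_coverageClosest hα hθ.le hlam one_pos hk hLOS
  · exact hNLOS.coverageStrongest_nlosFading hα hθ1 hlam

theorem mainTheorem3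
    (α θ : ℝ) (hα : 2 < α) (hθ : 0 < θ) (lam : ℝ≥0) (hlam : 0 < lam)
    -- for every `m ≥ 1`, a network with LOS (Nakagami-`m`) fading
    {Ω : ℕ → Type*} [∀ m, MeasurableSpace (Ω m)]
    (P : ∀ m, Measure (Ω m)) [∀ m, IsProbabilityMeasure (P m)]
    (X : ∀ m, ℕ → Ω m → CellularNetwork.Plane) (g : ∀ m, ℕ → Ω m → ℝ)
    (hLOS : ∀ m : ℕ, 1 ≤ m →
      CellularNetwork.IsNetwork (P m) (X m) (g m) lam (CellularNetwork.losFading m))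
    -- a network with NLOS (Rayleigh) fading
    {Ω' : Type*} [MeasurableSpace Ω'] (P' : Measure Ω') [IsProbabilityMeasure P']
    (X' : ℕ → Ω' → CellularNetwork.Plane) (g' : ℕ → Ω' → ℝ)
    (hNLOS : CellularNetwork.IsNetwork P' X' g' lam CellularNetwork.nlosFading) :
    -- strict monotonicity in `m`
    (∀ m : ℕ, 1 ≤ m →
      CellularNetwork.coverageClosest (P m) (X m) (g m) α θ <
        CellularNetwork.coverageClosest (P (m + 1)) (X (m + 1)) (g (m + 1)) α θ) ∧
    -- comparison with the Rayleigh value: equality for `m = 1`, strictly larger for `m ≥ 2`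
    CellularNetwork.coverageClosest (P 1) (X 1) (g 1) α θ =
      CellularNetwork.coverageClosest P' X' g' α θ ∧
    (∀ m : ℕ, 2 ≤ m →
      CellularNetwork.coverageClosest P' X' g' α θ <
        CellularNetwork.coverageClosest (P m) (X m) (g m) α θ) ∧
    -- limit as `m → ∞`: the strongest-association value under Rayleigh fading
    Tendsto (fun m : ℕ => CellularNetwork.coverageClosest (P m) (X m) (g m) α θ) atTop
      (𝓝 (CellularNetwork.coverageStrongest P' X' g' α θ)) ∧
    -- which has its closed form when `θ ≥ 1`
    (1 ≤ θ → CellularNetwork.coverageStrongest P' X' g' α θ =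
      1 / (2 * CellularNetwork.zetaCoeff α 1 * θ ^ (2 / α))) := by
  obtain ⟨hlt, hone, hNLOS_lt, hlim, hclosed⟩ := mainTheorem3_general α θ hα hθ lam hlam
    (fun m : ℕ => (m : ℝ)) P X g (fun m hm => hLOS m (Nat.cast_pos.1 hm)) P' X' g' hNLOS
  exact ⟨fun m hm => hlt m (m + 1) (by positivity) (by simp), hone 1 Nat.cast_one,
    fun m hm => hNLOS_lt m (Nat.one_lt_cast.2 hm), hlim _ tendsto_natCast_atTop_atTop, hclosed⟩
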